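/- There is an absolute constant $c>0$ with the following property. Let $f_1,f_2:\mathbb{N}_{\ge 1}\to\mathbb{C}$ be completely multiplicative functions (that is, $f_j(1)=1$ and $f_j(mn)=f_j(m)f_j(n)$ for all $m,n\ge 1$) with $|f_1(n)|\le 1$ and $|f_2(n)|\le 1$ for all $n\ge 1$. Let $\eta>0$ and let $x_1,x_2>0$ be real numbers such that $$\Big|\sum_{n\le x_j} f_j(n)\Big|\ge \eta\, x_j\qquad (j=1,2).$$ Put $\xi=c\,\eta^6$. Then there is a real number $x\ge (\min(x_1,x_2))^{\xi}$ such that $$\Big|\sum_{n\le x} f_1(n)f_2(n)\Big|\ge \xi\, x .$$ In particular, with the same constant $c$: if $\chi_1,\chi_2$ are Dirichlet characters modulo $q$ (for any integer $q\ge 1$), and $\eta>0$ and real $x_1,x_2>0$ satisfy $\big|\sum_{n\le x_j}\chi_j(n)\big|\ge\eta x_j$ for $j=1,2$, then with $\xi=c\,\eta^6$ there is a real number $x\ge(\min(x_1,x_2))^{\xi}$ such that $\big|\sum_{n\le x}(\chi_1\chi_2)(n)\big|\ge \xi\, x$. (All sums are over positive integers $n$.) -/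

import Mathlib

/-- A completely multiplicative function `f` on the positive integers, given as a function on `ℕ`
whose value at `0` is irrelevant. -/
structure IsCompletelyMultiplicative (f : ℕ → ℂ) : Prop where
  map_one : f 1 = 1
  map_mul : ∀ m n : ℕ, 1 ≤ m → 1 ≤ n → f (m * n) = f m * f n

/-- The partial sum `∑_{n ≤ x} f n` over the positive integers `n ≤ x`, for real `x`. -/
noncomputable def partialSum (f : ℕ → ℂ) (x : ℝ) : ℂ :=
  ∑ n ∈ Finset.Icc 1 ⌊x⌋₊, f n

/-!
The theorem is an instance of the principle that a completely multiplicative function bounded by `1` with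
large partial sums must imitate `n ↦ n ^ (i t)` for some `t`, and that imitation is inherited by products.

Write `S` for the partial sums of `f`, `F` for its Dirichlet series and `L = log x`.

*Large sums force a large Dirichlet series* (`exists_large_LSeries`, a form of Halász's theorem). If
`|S(x)| ≥ η x`, then `|F(s) / s| ≫ η ^ (3 / 2) L` for some `s` with `Re s = 1 + 1 / L`. First,
`f log = f Λ * f` and an upper bound for primes in short intervals (`exists_psi_sub_psi_le`, deduced from
Selberg's formula) bound `|S(x)| log x` by `x ∫ |S(u)| / u ^ 2 du` and small terms
(`exists_norm_partialSum_mul_log_le`). Then the Cauchy–Schwarz inequality passes to a mean square of the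
partial sums of `f log`, which Plancherel's theorem (`mellin_plancherel`) turns into one of `F' / s`. There
`F / s` is bounded pointwise and `F' / F` in mean square (`exists_integral_norm_sq_LSeries_vonMangoldt_le`).

*Products* (`exists_norm_LSeries_mul_ge`). By the Euler product, `|F(σ + i t)| / ζ(σ)` is comparable to
`exp (-D)`, where `D = ∑ p ^ (-σ) (1 - Re f(p) p ^ (-i t))`. From
`1 - Re z w ≤ 2 (1 - Re z) + 2 (1 - Re w)` in the unit disc, the series `F₁₂` of `f₁ f₂` satisfies
`|F₁₂(σ + i (t₁ + t₂))| ≫ ζ(σ) (|F₁(s₁)| / ζ(σ₁)) ^ 2 (|F₂(s₂)| / ζ(σ₂)) ^ 2` whenever `σ ≥ σ₁, σ₂`.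

*Conclusion* (`exists_large_norm_partialSum_mul`). With `X = min x₁ x₂` and `σ = 1 + 1 / log X` the two facts give
`|F₁₂(s) / s| ≫ η ^ 6 log X` for some `s` with `Re s = σ`. If the partial sums of `f₁ f₂` were smaller than
`ξ u` for all `u ≥ X ^ ξ`, partial summation would give `|F₁₂(s) / s| ≤ 2 ξ log X`
(`norm_LSeries_le_of_norm_partialSum_le`), which is impossible if `ξ` is a small multiple of `η ^ 6`. When
`X ^ ξ < 2` this asymptotic argument is not available, but then `x = X ^ ξ` works, with partial sum `1`.
-/

/-! ### Plancherel for Dirichlet series -/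

open MeasureTheory FourierTransform SchwartzMap ContDiff in
/-- For `g` in `L¹ ∩ L²` the `L²` Fourier transform, which is defined by extension from Schwartz
functions, is represented by the Fourier integral: the two agree as tempered distributions. -/
theorem Lp_fourier_ae_eq {g : ℝ → ℂ} (h1 : Integrable g) (h2 : MemLp g 2) :
    (𝓕 (h2.toLp g) : Lp ℂ 2 (volume : Measure ℝ)) =ᵐ[volume] 𝓕 g := by
  have hL : Continuous fun p : ℝ × ℝ ↦ innerₗ ℝ p.1 p.2 := by
    simp only [innerₗ_apply_apply]; fun_prop
  have hcont : Continuous (𝓕 g) :=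
    VectorFourier.fourierIntegral_continuous Real.continuous_fourierChar hL h1
  have hloc : LocallyIntegrable (fun x => (𝓕 (h2.toLp g) : Lp ℂ 2 (volume : Measure ℝ)) x - 𝓕 g x) :=
    ((Lp.memLp _).locallyIntegrable (by norm_num)).sub hcont.locallyIntegrable
  have key : ∀ᵐ x, (𝓕 (h2.toLp g) : Lp ℂ 2 (volume : Measure ℝ)) x - 𝓕 g x = 0 := by
    refine ae_eq_zero_of_integral_contDiff_smul_eq_zero hloc fun φ hφ hφc => ?_
    have hg₁ : HasCompactSupport (Complex.ofRealCLM ∘ φ) := hφc.comp_left rfl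
    have hg₂ : ContDiff ℝ ∞ (Complex.ofRealCLM ∘ φ) := by fun_prop
    set ψ : 𝓢(ℝ, ℂ) := hg₁.toSchwartzMap hg₂ with hψ
    have hψφ : ∀ x, ψ x = (φ x : ℂ) := fun x => by simp [hψ]
    -- both sides pair with `ψ` to give `∫ g * 𝓕 ψ`
    have e1 : ∫ x, ψ x • (𝓕 (h2.toLp g) : Lp ℂ 2 (volume : Measure ℝ)) x = ∫ x, (𝓕 ψ) x • g x := by
      have h := congrArg (fun T : 𝓢'(ℝ, ℂ) => T ψ) (Lp.fourier_toTemperedDistribution_eq (h2.toLp g))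
      simp only [TemperedDistribution.fourier_apply, Lp.toTemperedDistribution_apply] at h
      rw [← h]
      refine integral_congr_ae ?_
      filter_upwards [h2.coeFn_toLp] with x hx
      rw [hx]
    have e2 : ∫ x, ψ x • (𝓕 g) x = ∫ x, (𝓕 ψ) x • g x := by
      have h := VectorFourier.integral_fourierIntegral_smul_eq_flip (μ := volume) (ν := volume)
        (f := (ψ : ℝ → ℂ)) (g := g) (L := innerₗ ℝ) Real.continuous_fourierChar hL ψ.integrable h1
      rw [flip_innerₗ] at h
      rw [SchwartzMap.fourier_coe]
      exact h.symm
    have i1 : Integrable (fun x => ψ x • (𝓕 (h2.toLp g) : Lp ℂ 2 (volume : Measure ℝ)) x) :=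
      MemLp.integrable_mul (ψ.memLp 2) (Lp.memLp _)
    have i2 : Integrable (fun x => ψ x • (𝓕 g) x) := by
      refine ψ.integrable.mul_of_top_left ?_
      refine memLp_top_of_bound hcont.aestronglyMeasurable (∫ v, ‖g v‖) (ae_of_all _ fun w => ?_)
      exact VectorFourier.norm_fourierIntegral_le_integral_norm _ _ _ _ _
    calc ∫ x, φ x • ((𝓕 (h2.toLp g) : Lp ℂ 2 (volume : Measure ℝ)) x - 𝓕 g x)
        = ∫ x, (ψ x • (𝓕 (h2.toLp g) : Lp ℂ 2 (volume : Measure ℝ)) x - ψ x • 𝓕 g x) := by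
          refine integral_congr_ae (ae_of_all _ fun x => ?_)
          simp [hψφ, mul_sub]
      _ = 0 := by rw [integral_sub i1 i2, e1, e2, sub_self]
  filter_upwards [key] with x hx using sub_eq_zero.mp hx

open MeasureTheory FourierTransform in
/-- Plancherel's theorem for a function in `L¹ ∩ L²`. -/
theorem integral_norm_sq_fourier {g : ℝ → ℂ} (h1 : Integrable g) (h2 : MemLp g 2) :
    Integrable (fun w => ‖𝓕 g w‖ ^ 2) ∧ ∫ w, ‖𝓕 g w‖ ^ 2 = ∫ v, ‖g v‖ ^ 2 := by
  have hae := Lp_fourier_ae_eq h1 h2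
  have hm : MemLp (𝓕 g) 2 := (memLp_congr_ae hae).mp (Lp.memLp _)
  refine ⟨hm.integrable_norm_pow (by norm_num), ?_⟩
  have hn : eLpNorm (𝓕 g) 2 = eLpNorm g 2 := by
    rw [← eLpNorm_congr_ae hae, ← eLpNorm_congr_ae h2.coeFn_toLp, ← Lp.enorm_def, ← Lp.enorm_def,
      ← ofReal_norm, ← ofReal_norm, Lp.norm_fourier_eq]
  have := congrArg (fun z => z.toReal ^ 2) hn
  have conv : ∀ {h : ℝ → ℂ}, MemLp h 2 → (eLpNorm h 2).toReal ^ 2 = ∫ v, ‖h v‖ ^ 2 := by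
    intro h hh
    rw [hh.eLpNorm_eq_integral_rpow_norm (by norm_num) (by norm_num), ENNReal.toReal_ofReal (by positivity)]
    simp only [ENNReal.toReal_ofNat, Real.rpow_ofNat]
    rw [← Real.rpow_natCast, ← Real.rpow_mul (by positivity)]
    norm_num
  rwa [conv hm, conv h2] at this

open MeasureTheory in
theorem measurable_partialSum (b : ℕ → ℂ) : Measurable (partialSum b) :=
  (measurable_from_top (f := fun n : ℕ => ∑ k ∈ Finset.Icc 1 n, b k)).comp Nat.measurable_floor

open Set in
theorem exp_image_Ioi : Real.exp '' Ioi 0 = Ioi 1 := by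
  ext u
  simp only [mem_image, mem_Ioi]
  refine ⟨fun ⟨v, hv, h⟩ => h ▸ Real.one_lt_exp_iff.mpr hv, fun h => ⟨Real.log u, Real.log_pos h, Real.exp_log (by linarith)⟩⟩

open MeasureTheory in
theorem integral_Ioi_one_eq_exp (h : ℝ → ℂ) :
    ∫ u in Set.Ioi (1:ℝ), h u = ∫ v in Set.Ioi (0:ℝ), (Real.exp v : ℂ) * h (Real.exp v) := by
  rw [← exp_image_Ioi, integral_image_eq_integral_abs_deriv_smul measurableSet_Ioi
    (fun x _ => (Real.hasDerivAt_exp x).hasDerivWithinAt) Real.exp_injective.injOn]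
  simp

open MeasureTheory in
theorem integrableOn_Ioi_one_iff_exp (h : ℝ → ℝ) :
    IntegrableOn h (Set.Ioi (1:ℝ)) ↔
      IntegrableOn (fun v => Real.exp v * h (Real.exp v)) (Set.Ioi (0:ℝ)) := by
  rw [← exp_image_Ioi, integrableOn_image_iff_integrableOn_abs_deriv_smul measurableSet_Ioi
    (fun x _ => (Real.hasDerivAt_exp x).hasDerivWithinAt) Real.exp_injective.injOn]
  simp

open MeasureTheory in
theorem integral_Ioi_one_eq_exp_real (h : ℝ → ℝ) :
    ∫ u in Set.Ioi (1:ℝ), h u = ∫ v in Set.Ioi (0:ℝ), Real.exp v * h (Real.exp v) := by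
  rw [← exp_image_Ioi, integral_image_eq_integral_abs_deriv_smul measurableSet_Ioi
    (fun x _ => (Real.hasDerivAt_exp x).hasDerivWithinAt) Real.exp_injective.injOn]
  simp

open MeasureTheory FourierTransform Complex Real in
/-- Parseval's identity for the Mellin transform of a partial sum: since
`B(s) / s = ∫ S(u) u ^ (-s - 1)` over `u > 1`, the substitution `u = exp v` makes `t ↦ B(θ + i t) / (θ + i t)`
the Fourier transform of `S(exp v) exp (-θ v)`. -/
theorem mellin_plancherel {b : ℕ → ℂ} {C r θ : ℝ} (hr : 0 ≤ r) (hθ : r < θ)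
    (hb : ∀ n : ℕ, 1 ≤ n → ∑ k ∈ Finset.Icc 1 n, ‖b k‖ ≤ C * (n:ℝ) ^ r) :
    Integrable (fun t : ℝ => ‖LSeries b (θ + t * I) / (θ + t * I)‖ ^ 2) ∧
    IntegrableOn (fun u : ℝ => ‖partialSum b u‖ ^ 2 * u ^ (-(2 * θ) - 1)) (Set.Ioi 1) ∧
    ∫ t : ℝ, ‖LSeries b (θ + t * I) / (θ + t * I)‖ ^ 2 =
      2 * π * ∫ u in Set.Ioi (1:ℝ), ‖partialSum b u‖ ^ 2 * u ^ (-(2 * θ) - 1) := by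
  have hC : 0 ≤ C := by
    have := hb 1 le_rfl
    simp at this
    exact (norm_nonneg _).trans this
  have hS : ∀ u : ℝ, 1 ≤ u → ‖partialSum b u‖ ≤ C * u ^ r := by
    intro u hu
    have hn : 1 ≤ ⌊u⌋₊ := Nat.one_le_floor_iff _ |>.mpr hu
    refine (norm_sum_le _ _).trans ((hb _ hn).trans ?_)
    gcongr
    exact Nat.floor_le (by linarith)
  have hO : (fun n ↦ ∑ k ∈ Finset.Icc 1 n, ‖b k‖) =O[Filter.atTop] fun n ↦ (n:ℝ) ^ r := by
    refine Asymptotics.IsBigO.of_bound C ?_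
    filter_upwards [Filter.eventually_ge_atTop 1] with n hn
    rw [Real.norm_of_nonneg (Finset.sum_nonneg fun _ _ => norm_nonneg _),
      Real.norm_of_nonneg (by positivity)]
    exact hb n hn
  set g : ℝ → ℂ := (Set.Ioi (0:ℝ)).indicator
    (fun v => partialSum b (Real.exp v) * (Real.exp (-θ * v) : ℂ)) with hg
  have hgm : Measurable g := by
    refine Measurable.indicator ?_ measurableSet_Ioi
    have := (measurable_partialSum b).comp Real.measurable_exp
    exact this.mul (by fun_prop)
  have hgb : ∀ v ∈ Set.Ioi (0:ℝ), ‖g v‖ ≤ C * Real.exp (-(θ - r) * v) := by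
    intro v hv
    rw [hg, Set.indicator_of_mem hv, norm_mul, norm_real, Real.norm_of_nonneg (Real.exp_pos _).le]
    refine (mul_le_mul_of_nonneg_right (hS _ (Real.one_le_exp (le_of_lt hv))) (Real.exp_pos _).le).trans ?_
    rw [← Real.exp_mul, mul_assoc, ← Real.exp_add]
    apply le_of_eq; ring_nf
  have hsupp : Function.support g ⊆ Set.Ioi 0 := Set.support_indicator_subset
  have h1 : Integrable g := by
    rw [← integrableOn_iff_integrable_of_support_subset hsupp]
    refine Integrable.mono' ((integrableOn_exp_mul_Ioi (a := -(θ - r)) (by linarith) 0).const_mul C)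
      hgm.aestronglyMeasurable ?_
    filter_upwards [ae_restrict_mem measurableSet_Ioi] with v hv using hgb v hv
  have h2' : IntegrableOn (fun v => ‖g v‖ ^ 2) (Set.Ioi 0) := by
    refine Integrable.mono' ((integrableOn_exp_mul_Ioi (a := -(2 * (θ - r))) (by linarith) 0).const_mul (C ^ 2))
      (hgm.norm.pow_const 2).aestronglyMeasurable ?_
    filter_upwards [ae_restrict_mem measurableSet_Ioi] with v hv
    rw [Real.norm_of_nonneg (by positivity)]
    refine (pow_le_pow_left₀ (norm_nonneg _) (hgb v hv) 2).trans ?_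
    rw [mul_pow, ← Real.exp_nat_mul]
    apply le_of_eq; push_cast; ring_nf
  have hsupp2 : Function.support (fun v => ‖g v‖ ^ 2) ⊆ Set.Ioi 0 := by
    intro v hv
    apply hsupp
    intro h0
    simp [h0] at hv
  have h2 : MemLp g 2 := by
    rw [memLp_two_iff_integrable_sq_norm hgm.aestronglyMeasurable]
    exact (integrableOn_iff_integrable_of_support_subset hsupp2).mp h2'
  have hF : ∀ w : ℝ, 𝓕 g w = LSeries b (θ + (2 * π * w : ℝ) * I) / (θ + (2 * π * w : ℝ) * I) := by
    intro w
    have hs0 : (θ + (2 * π * w : ℝ) * I : ℂ) ≠ 0 := by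
      intro h
      have := congrArg Complex.re h
      simp at this
      linarith
    rw [LSeries_eq_mul_integral' b hr (s := θ + (2 * π * w : ℝ) * I) (by simpa using hθ) hO,
      mul_div_cancel_left₀ _ hs0, integral_Ioi_one_eq_exp, Real.fourier_real_eq_integral_exp_smul,
      ← setIntegral_eq_integral_of_forall_compl_eq_zero (s := Set.Ioi (0:ℝ))]
    · refine setIntegral_congr_fun measurableSet_Ioi fun v hv => ?_
      simp only [hg, Set.indicator_of_mem hv, smul_eq_mul, partialSum]
      have : ((Real.exp v : ℝ) : ℂ) ^ (-(θ + (2 * π * w : ℝ) * I + 1)) =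
          cexp (v * (-(θ + (2 * π * w : ℝ) * I + 1))) := by
        rw [cpow_def_of_ne_zero (by exact_mod_cast (Real.exp_pos v).ne'), ← ofReal_log (Real.exp_pos v).le,
          Real.log_exp]
      rw [this, mul_left_comm, mul_left_comm (_ : ℂ) _ (cexp _), ofReal_exp, ofReal_exp, ← Complex.exp_add, ← Complex.exp_add]
      congr 2
      push_cast
      ring
    · intro v hv
      simp [hg, Set.indicator_of_notMem hv]
  obtain ⟨hi, he⟩ := integral_norm_sq_fourier h1 h2
  have hgn : ∀ v ∈ Set.Ioi (0:ℝ), Real.exp v * (‖partialSum b (Real.exp v)‖ ^ 2 * (Real.exp v) ^ (-(2 * θ) - 1))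
      = ‖g v‖ ^ 2 := by
    intro v hv
    rw [hg, Set.indicator_of_mem hv, norm_mul, norm_real, Real.norm_of_nonneg (Real.exp_pos _).le,
      mul_pow, ← Real.exp_mul, mul_left_comm, ← Real.exp_add, ← Real.exp_nat_mul]
    congr 2; push_cast; ring
  have h2pi : (0:ℝ) < 2 * π := by positivity
  set G : ℝ → ℝ := fun t => ‖LSeries b (θ + t * I) / (θ + t * I)‖ ^ 2 with hG
  have hGF : (fun w => ‖𝓕 g w‖ ^ 2) = fun w => G (2 * π * w) := by
    funext w; rw [hF, hG]
  rw [hGF] at hi he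
  refine ⟨?_, ?_, ?_⟩
  · exact (integrable_comp_mul_left_iff G h2pi.ne').mp hi
  · rw [integrableOn_Ioi_one_iff_exp]
    exact h2'.congr_fun (fun v hv => (hgn v hv).symm) measurableSet_Ioi
  · rw [integral_Ioi_one_eq_exp_real, setIntegral_congr_fun measurableSet_Ioi hgn,
      setIntegral_eq_integral_of_forall_compl_eq_zero, ← he, Measure.integral_comp_mul_left,
      abs_of_pos (by positivity), smul_eq_mul, mul_inv_cancel_left₀ h2pi.ne']
    intro v hv
    by_contra h
    exact hv (hsupp2 h)

/-! ### Elementary asymptotics of logarithmic sums -/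

/-- A sequence whose increments are dominated by those of `-K / √n` converges at the rate `K / √n`. -/
theorem exists_abs_sub_le_of_abs_succ_sub_le {a : ℕ → ℝ} {K : ℝ} (hK : 0 ≤ K)
    (h : ∀ n : ℕ, 1 ≤ n → |a (n + 1) - a n| ≤ K * (1 / √(n:ℝ) - 1 / √((n:ℝ) + 1))) :
    ∃ l, ∀ n : ℕ, 1 ≤ n → |a n - l| ≤ K / √(n:ℝ) := by
  set u : ℕ → ℝ := fun n => a (n + 1) - K / √((n:ℝ) + 1) with hu
  set v : ℕ → ℝ := fun n => a (n + 1) + K / √((n:ℝ) + 1) with hv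
  have hkey (n : ℕ) := abs_le.mp (h (n + 1) (by omega))
  have hum : Monotone u := monotone_nat_of_le_succ fun n => by
    have := (hkey n).1
    simp only [hu]; push_cast at this ⊢
    simp only [mul_sub, mul_one_div] at this
    linarith
  have hvm : Antitone v := antitone_nat_of_succ_le fun n => by
    have := (hkey n).2
    simp only [hv]; push_cast at this ⊢
    simp only [mul_sub, mul_one_div] at this
    linarith
  have huv : ∀ n, u n ≤ v n := fun n => by
    simp only [hu, hv]
    have : 0 ≤ K / √((n:ℝ) + 1) := by positivity
    linarith
  have hle : ∀ n m, u n ≤ v m := fun n m =>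
    (hum (le_max_left n m)).trans ((huv _).trans (hvm (le_max_right n m)))
  refine ⟨⨆ n, u n, fun n hn => ?_⟩
  obtain ⟨m, rfl⟩ : ∃ m, n = m + 1 := ⟨n - 1, by omega⟩
  have h1 : u m ≤ ⨆ n, u n := le_ciSup ⟨v 0, by rintro _ ⟨n, rfl⟩; exact hle n 0⟩ m
  have h2 : ⨆ n, u n ≤ v m := ciSup_le fun n => hle n m
  simp only [hu, hv] at h1 h2
  rw [abs_le]; push_cast
  constructor <;> simp only [hu] <;> linarith

theorem log_succ_sub_log_bounds {n : ℕ} (hn : 1 ≤ n) :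
    1 / ((n:ℝ) + 1) ≤ Real.log (n + 1) - Real.log n ∧ Real.log (n + 1) - Real.log n ≤ 1 / (n:ℝ) := by
  have hn0 : (0:ℝ) < n := by exact_mod_cast hn
  rw [← Real.log_div (by positivity) (by positivity)]
  constructor
  · have := Real.one_sub_inv_le_log_of_pos (x := ((n:ℝ) + 1) / n) (by positivity)
    refine le_trans (le_of_eq ?_) this
    field_simp; ring
  · have := Real.log_le_sub_one_of_pos (x := ((n:ℝ) + 1) / n) (by positivity)
    refine this.trans (le_of_eq ?_)
    field_simp; ring

/-- The increment of `-1 / √n`, in terms of `s = √n` and `t = √(n + 1)`; this clears the square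
roots from the comparisons below. -/
theorem one_div_sqrt_sub_one_div_sqrt_succ {n : ℕ} (hn : 1 ≤ n) :
    ∃ s t : ℝ, 1 ≤ s ∧ s ≤ t ∧ t ≤ 2 * s ∧ s ^ 2 = n ∧ t ^ 2 = n + 1 ∧
      1 / √(n:ℝ) - 1 / √((n:ℝ) + 1) = 1 / (s * t * (s + t)) := by
  have hn0 : (1:ℝ) ≤ n := by exact_mod_cast hn
  have hs1 : 1 ≤ √(n:ℝ) := Real.one_le_sqrt.mpr hn0
  have hst : √(n:ℝ) ≤ √((n:ℝ) + 1) := Real.sqrt_le_sqrt (by linarith)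
  have hs2 : √(n:ℝ) ^ 2 = n := Real.sq_sqrt (by linarith)
  have ht2 : √((n:ℝ) + 1) ^ 2 = n + 1 := Real.sq_sqrt (by linarith)
  refine ⟨√(n:ℝ), √((n:ℝ) + 1), hs1, hst, ?_, hs2, ht2, ?_⟩
  · nlinarith
  · have h0 : 0 < √(n:ℝ) := by linarith
    have h0' : 0 < √((n:ℝ) + 1) := by linarith
    field_simp
    nlinarith

theorem exists_harmonic_asymp :
    ∃ γ : ℝ, ∀ n : ℕ, 1 ≤ n → |∑ k ∈ Finset.Ioc 0 n, 1 / (k:ℝ) - Real.log n - γ| ≤ 2 / √(n:ℝ) := by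
  refine exists_abs_sub_le_of_abs_succ_sub_le
    (a := fun n => ∑ k ∈ Finset.Ioc 0 n, 1 / (k:ℝ) - Real.log n) zero_le_two fun n hn => ?_
  obtain ⟨s, t, hs, hst, -, hs2, ht2, h⟩ := one_div_sqrt_sub_one_div_sqrt_succ hn
  have hs0 : 0 < s := by linarith
  have ht0 : 0 < t := by linarith
  rw [h, Finset.sum_Ioc_succ_top (by omega)]
  push_cast
  obtain ⟨h1, h2⟩ := log_succ_sub_log_bounds hn
  have h3 : 1 / (n:ℝ) - 1 / (n + 1) ≤ 2 * (1 / (s * t * (s + t))) := by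
    rw [← ht2, ← hs2]
    have : 1 / s ^ 2 - 1 / t ^ 2 = 1 / (s ^ 2 * t ^ 2) := by
      field_simp; rw [ht2, hs2]; ring
    rw [this, mul_one_div, div_le_div_iff₀ (by positivity) (by positivity)]
    have : s + t ≤ 2 * (s * t) := by nlinarith
    have h5 : 0 < s * t := by positivity
    nlinarith [mul_le_mul_of_nonneg_left this h5.le]
  rw [abs_le]
  constructor <;> linarith

/-- The analogue for `∑ log k / k` of the asymptotic formula for the harmonic sum. -/
theorem exists_sum_log_div_asymp :
    ∃ γ : ℝ, ∀ n : ℕ, 1 ≤ n →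
      |∑ k ∈ Finset.Ioc 0 n, Real.log k / (k:ℝ) - Real.log n ^ 2 / 2 - γ| ≤ 9 / √(n:ℝ) := by
  refine exists_abs_sub_le_of_abs_succ_sub_le
    (a := fun n => ∑ k ∈ Finset.Ioc 0 n, Real.log k / (k:ℝ) - Real.log n ^ 2 / 2) (by norm_num)
    fun n hn => ?_
  obtain ⟨s, t, hs, hst, ht, hs2, ht2, h⟩ := one_div_sqrt_sub_one_div_sqrt_succ hn
  have hs0 : 0 < s := by linarith
  have ht0 : 0 < t := by linarith
  rw [h, Finset.sum_Ioc_succ_top (by omega)]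
  push_cast
  obtain ⟨h1, h2⟩ := log_succ_sub_log_bounds hn
  have hB : Real.log ((n:ℝ) + 1) ≤ 2 * t := by
    rw [← ht2, Real.log_pow]
    have := Real.log_le_self (x := t) (by linarith)
    push_cast; linarith
  have hB0 : 0 ≤ Real.log ((n:ℝ) + 1) := Real.log_nonneg (by linarith)
  set B := Real.log ((n:ℝ) + 1)
  set A := Real.log n
  have e : (∑ k ∈ Finset.Ioc 0 n, Real.log k / (k:ℝ) + B / (n + 1) - B ^ 2 / 2 -
      (∑ k ∈ Finset.Ioc 0 n, Real.log k / (k:ℝ) - A ^ 2 / 2)) =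
      -(B * ((B - A) - 1 / (n + 1))) + (B - A) ^ 2 / 2 := by ring
  rw [e]
  have h3 : 1 / (n:ℝ) - 1 / (n + 1) = 1 / (s ^ 2 * t ^ 2) := by
    rw [← ht2, ← hs2]; field_simp; rw [ht2, hs2]; ring
  have h4 : B * ((B - A) - 1 / (n + 1)) ≤ 2 * t * (1 / (s ^ 2 * t ^ 2)) := by
    rw [← h3]
    exact mul_le_mul hB (by linarith) (by linarith) (by linarith)
  have h4' : 0 ≤ B * ((B - A) - 1 / (n + 1)) := mul_nonneg hB0 (by linarith)
  have h5 : 2 * t * (1 / (s ^ 2 * t ^ 2)) ≤ 6 * (1 / (s * t * (s + t))) := by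
    rw [mul_one_div, mul_one_div, div_le_div_iff₀ (by positivity) (by positivity)]
    have h6 : s + t ≤ 3 * s := by linarith
    have h7 : 0 ≤ 2 * s * t ^ 2 := by positivity
    nlinarith [mul_le_mul_of_nonneg_left h6 h7]
  have h8 : (B - A) ^ 2 / 2 ≤ 3 * (1 / (s * t * (s + t))) := by
    have h9 : (B - A) ^ 2 ≤ (1 / s ^ 2) ^ 2 := by
      rw [hs2]
      refine pow_le_pow_left₀ ?_ h2 2
      have : (0:ℝ) < 1 / (n + 1) := by positivity
      linarith
    refine (div_le_div_of_nonneg_right h9 zero_le_two).trans ?_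
    rw [show (1 / s ^ 2) ^ 2 / 2 = 1 / (2 * s ^ 4) by field_simp, mul_one_div,
      div_le_div_iff₀ (by positivity) (by positivity)]
    have h10 : t * (s + t) ≤ 2 * s * (3 * s) := mul_le_mul ht (by linarith) (by linarith) (by linarith)
    have h11 : s ^ 3 ≤ s ^ 4 := pow_le_pow_right₀ hs (by norm_num)
    nlinarith [mul_le_mul_of_nonneg_left h10 hs0.le]
  have h9 : 0 ≤ (B - A) ^ 2 / 2 := by positivity
  rw [abs_le]
  constructor <;> nlinarith

/-- An antiderivative of `log²`. -/
noncomputable def logSqPrimitive (u : ℝ) : ℝ := u * Real.log u ^ 2 - 2 * u * Real.log u + 2 * u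

theorem hasDerivAt_logSqPrimitive {u : ℝ} (hu : 0 < u) :
    HasDerivAt logSqPrimitive (Real.log u ^ 2) u := by
  have hl := Real.hasDerivAt_log hu.ne'
  have := (((hasDerivAt_id u).mul (hl.pow 2)).sub (((hasDerivAt_id u).const_mul 2).mul hl)).add
    ((hasDerivAt_id u).const_mul 2)
  refine (this.congr_deriv ?_).congr_of_eventuallyEq (Filter.Eventually.of_forall fun v => ?_)
  · simp only [id_eq, Nat.cast_ofNat, Pi.pow_apply]
    field_simp
    ring
  · simp [logSqPrimitive]

theorem logSqPrimitive_sub_bounds {a b : ℝ} (ha : 1 ≤ a) (hab : a ≤ b) :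
    (b - a) * Real.log a ^ 2 ≤ logSqPrimitive b - logSqPrimitive a ∧
    logSqPrimitive b - logSqPrimitive a ≤ (b - a) * Real.log b ^ 2 := by
  rcases hab.eq_or_lt with rfl | hab
  · simp
  obtain ⟨c, ⟨hc1, hc2⟩, hc⟩ := exists_hasDerivAt_eq_slope logSqPrimitive (fun u => Real.log u ^ 2) hab
    (fun x hx => (hasDerivAt_logSqPrimitive (by linarith [hx.1])).continuousAt.continuousWithinAt)
    (fun x hx => hasDerivAt_logSqPrimitive (by linarith [hx.1]))
  rw [eq_div_iff (by linarith), mul_comm] at hc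
  rw [← hc]
  have h1 : 0 ≤ Real.log a := Real.log_nonneg ha
  have h2 : Real.log a ≤ Real.log c := Real.log_le_log (by linarith) hc1.le
  have h3 : Real.log c ≤ Real.log b := Real.log_le_log (by linarith) hc2.le
  have : 0 ≤ b - a := by linarith
  have h4 := h1.trans h2
  constructor <;> gcongr

theorem sum_log_sq_bounds (n : ℕ) (hn : 1 ≤ n) :
    -2 ≤ ∑ k ∈ Finset.Ioc 0 n, Real.log k ^ 2 - logSqPrimitive n ∧
    ∑ k ∈ Finset.Ioc 0 n, Real.log k ^ 2 - logSqPrimitive n ≤ -2 + Real.log n ^ 2 := by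
  induction n, hn using Nat.le_induction with
  | base => simp [logSqPrimitive]
  | succ n hn ih =>
    rw [Finset.sum_Ioc_succ_top (by omega)]
    have := logSqPrimitive_sub_bounds (a := n) (b := (n:ℝ) + 1) (by exact_mod_cast hn) (by linarith)
    push_cast
    constructor <;> linarith

theorem abs_sum_log_sq_sub_le {u : ℝ} (hu : 1 ≤ u) :
    |∑ k ∈ Finset.Ioc 0 ⌊u⌋₊, Real.log k ^ 2 - logSqPrimitive u| ≤ 2 + 2 * Real.log u ^ 2 := by
  have hn : 1 ≤ ⌊u⌋₊ := (Nat.one_le_floor_iff _).mpr hu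
  have hN : (1:ℝ) ≤ (⌊u⌋₊ : ℝ) := by exact_mod_cast hn
  have h1 := sum_log_sq_bounds _ hn
  have hle := Nat.floor_le (by linarith : 0 ≤ u)
  have hlt := Nat.lt_floor_add_one u
  have h2 := logSqPrimitive_sub_bounds hN hle
  have h3 : (u - ⌊u⌋₊) * Real.log u ^ 2 ≤ 1 * Real.log u ^ 2 := by gcongr; linarith
  have h4 : 0 ≤ (u - ⌊u⌋₊) * Real.log (⌊u⌋₊ : ℝ) ^ 2 := mul_nonneg (by linarith) (sq_nonneg _)
  have h5 : Real.log (⌊u⌋₊ : ℝ) ^ 2 ≤ Real.log u ^ 2 := by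
    have := Real.log_nonneg hN
    gcongr
  have h6 := sq_nonneg (Real.log u)
  rw [abs_le]
  constructor <;> linarith [h1.1, h1.2, h2.1, h2.2]

/-! ### Selberg's formula and primes in short intervals -/

/-- The fourth root `p` of `u`, so that all error terms become polynomial in `p`. -/
theorem exists_fourth_root {u : ℝ} (hu : 1 ≤ u) :
    ∃ p : ℝ, 1 ≤ p ∧ p ^ 4 = u ∧ √u = p ^ 2 ∧ u ^ (3 / 4 : ℝ) = p ^ 3 ∧ Real.log u ≤ 4 * p := by
  have h0 : 0 ≤ u := by linarith
  have h4 : (u ^ (1 / 4 : ℝ)) ^ 4 = u := by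
    rw [← Real.rpow_natCast, ← Real.rpow_mul h0]; norm_num
  have h1 : 1 ≤ u ^ (1 / 4 : ℝ) := Real.one_le_rpow hu (by norm_num)
  refine ⟨u ^ (1 / 4 : ℝ), h1, h4, ?_, ?_, ?_⟩
  · rw [Real.sqrt_eq_rpow, ← Real.rpow_natCast, ← Real.rpow_mul h0]; norm_num
  · rw [← Real.rpow_natCast, ← Real.rpow_mul h0]; norm_num
  · conv_lhs => rw [← h4]
    rw [Real.log_pow]
    have := Real.log_le_self (x := u ^ (1 / 4 : ℝ)) (by linarith)
    push_cast; linarith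

theorem log_sub_log_floor_bounds {u : ℝ} (hu : 1 ≤ u) :
    0 ≤ Real.log u - Real.log (⌊u⌋₊ : ℝ) ∧ Real.log u - Real.log (⌊u⌋₊ : ℝ) ≤ 2 / u := by
  have hN : (1:ℝ) ≤ (⌊u⌋₊ : ℝ) := by exact_mod_cast (Nat.one_le_floor_iff _).mpr hu
  have hle := Nat.floor_le (by linarith : 0 ≤ u)
  have hlt := Nat.lt_floor_add_one u
  refine ⟨sub_nonneg.mpr (Real.log_le_log (by linarith) hle), ?_⟩
  rw [← Real.log_div (by linarith) (by linarith)]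
  refine (Real.log_le_sub_one_of_pos (by positivity)).trans ?_
  rw [div_sub_one (by linarith), div_le_div_iff₀ (by linarith) (by linarith)]
  nlinarith

/-- The candidate main term `2 u log u + a u + b` for the summatory function of `μ * log²`. -/
noncomputable def selbergMain (a b u : ℝ) : ℝ := 2 * u * Real.log u + a * u + b

/-- The constants `a` and `b` can be chosen so that `∑ selbergMain (u / k)` over `k ≤ u` agrees with
`∑ log² k` up to a power of `u` smaller than `1`. Möbius inversion then turns `selbergMain` into the main
term for `μ * log²`. -/
theorem exists_sum_selbergMain_approx :
    ∃ a b C : ℝ, 0 ≤ C ∧ ∀ u : ℝ, 1 ≤ u →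
      |∑ k ∈ Finset.Ioc 0 ⌊u⌋₊, Real.log k ^ 2 - ∑ k ∈ Finset.Ioc 0 ⌊u⌋₊, selbergMain a b (u / k)| ≤
        C * u ^ (3 / 4 : ℝ) := by
  obtain ⟨γ, hγ⟩ := exists_harmonic_asymp
  obtain ⟨γ₁, hγ₁⟩ := exists_sum_log_div_asymp
  set a := -2 - 2 * γ with ha
  set b := 2 + 2 * γ₁ - a * γ with hb
  refine ⟨a, b, 34 + 40 + 60 + 5 * |a| + |b|, by positivity, fun u hu => ?_⟩
  obtain ⟨p, hp, hp4, hp2, hp3, hlog⟩ := exists_fourth_root hu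
  have hn : 1 ≤ ⌊u⌋₊ := (Nat.one_le_floor_iff _).mpr hu
  have hN : (1:ℝ) ≤ (⌊u⌋₊ : ℝ) := by exact_mod_cast hn
  have hle := Nat.floor_le (by linarith : 0 ≤ u)
  have hlt := Nat.lt_floor_add_one u
  obtain ⟨hε0, hε⟩ := log_sub_log_floor_bounds hu
  have hQ := abs_sum_log_sq_sub_le hu
  have h1 := hγ _ hn
  have h2 := hγ₁ _ hn
  have hl0 : 0 ≤ Real.log u := Real.log_nonneg hu
  have hp0 : 0 < p := by linarith
  -- `√⌊u⌋ ≥ √u / √2`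
  have hsq : 1 / √(⌊u⌋₊ : ℝ) ≤ 3 / 2 / p ^ 2 := by
    rw [← hp2, div_le_div_iff₀ (by positivity) (by positivity)]
    have h4 : √u ≤ √((3 / 2) ^ 2 * (⌊u⌋₊ : ℝ)) := Real.sqrt_le_sqrt (by linarith)
    rw [Real.sqrt_mul (by norm_num), Real.sqrt_sq (by norm_num)] at h4
    linarith
  set h := ∑ k ∈ Finset.Ioc 0 ⌊u⌋₊, 1 / (k:ℝ) with hh
  set l := ∑ k ∈ Finset.Ioc 0 ⌊u⌋₊, Real.log k / (k:ℝ) with hl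
  set Q := ∑ k ∈ Finset.Ioc 0 ⌊u⌋₊, Real.log k ^ 2
  have hK : ∑ k ∈ Finset.Ioc 0 ⌊u⌋₊, selbergMain a b (u / k) =
      2 * u * (Real.log u * h - l) + a * u * h + b * ⌊u⌋₊ := by
    have : ∀ k ∈ Finset.Ioc 0 ⌊u⌋₊, selbergMain a b (u / k) =
        2 * u * (Real.log u * (1 / (k:ℝ)) - Real.log k / (k:ℝ)) + a * u * (1 / (k:ℝ)) + b := by
      intro k hk
      have hk0 : (0:ℝ) < k := by exact_mod_cast (Finset.mem_Ioc.mp hk).1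
      rw [selbergMain, Real.log_div (by linarith) hk0.ne']
      field_simp
    rw [Finset.sum_congr rfl this, Finset.sum_add_distrib, Finset.sum_add_distrib, ← Finset.mul_sum,
      ← Finset.mul_sum, Finset.sum_sub_distrib, ← Finset.mul_sum, Finset.sum_const, Nat.card_Ioc]
    simp only [Nat.sub_zero, nsmul_eq_mul, ← hh, ← hl]
    ring
  set ε := Real.log u - Real.log (⌊u⌋₊ : ℝ) with hεdef
  have hpu : 1 / p ^ 4 ≤ 1 / p ^ 2 :=
    one_div_le_one_div_of_le (by positivity) (pow_le_pow_right₀ hp (by norm_num))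
  have hε2 : ε ≤ 2 * (1 / p ^ 2) := by
    rw [← hp4] at hε
    refine hε.trans ?_
    rw [← mul_one_div]; linarith
  set E1 := h - Real.log u - γ with hE1
  set E2 := l - Real.log u ^ 2 / 2 - γ₁ with hE2
  have hE1b : |E1| ≤ 5 * (1 / p ^ 2) := by
    have : E1 = (h - Real.log (⌊u⌋₊ : ℝ) - γ) - ε := by rw [hE1, hεdef]; ring
    rw [this]
    refine (abs_sub _ _).trans ?_
    rw [abs_of_nonneg hε0]
    rw [div_eq_mul_one_div (2:ℝ)] at h1
    have : 3 / 2 / p ^ 2 = 3 / 2 * (1 / p ^ 2) := by ring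
    linarith
  have hE2b : |E2| ≤ 30 * (1 / p ^ 2) := by
    have : E2 = (l - Real.log (⌊u⌋₊ : ℝ) ^ 2 / 2 - γ₁) - ε * (Real.log u + Real.log (⌊u⌋₊ : ℝ)) / 2 := by
      rw [hE2, hεdef]; ring
    rw [this]
    refine (abs_sub _ _).trans ?_
    have h4 : 0 ≤ Real.log (⌊u⌋₊ : ℝ) := Real.log_nonneg hN
    rw [abs_of_nonneg (a := _ / (2:ℝ)) (by positivity)]
    rw [div_eq_mul_one_div (9:ℝ)] at h2
    have h5 : 3 / 2 / p ^ 2 = 3 / 2 * (1 / p ^ 2) := by ring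
    have h6 : ε * (Real.log u + Real.log (⌊u⌋₊ : ℝ)) / 2 ≤ ε * Real.log u := by
      have : Real.log (⌊u⌋₊ : ℝ) ≤ Real.log u := by linarith
      nlinarith
    have h7 : ε * Real.log u ≤ 2 / p ^ 4 * (4 * p) := by
      rw [hp4]; gcongr
    have h8 : 2 / p ^ 4 * (4 * p) = 8 * (1 / p ^ 3) := by field_simp; ring
    have h9 : 1 / p ^ 3 ≤ 1 / p ^ 2 :=
      one_div_le_one_div_of_le (by positivity) (pow_le_pow_right₀ hp (by norm_num))
    linarith
  have key : Q - ∑ k ∈ Finset.Ioc 0 ⌊u⌋₊, selbergMain a b (u / k) =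
      (Q - logSqPrimitive u) - 2 * u * Real.log u * E1 + 2 * u * E2 - a * u * E1 + b * (u - ⌊u⌋₊) := by
    rw [hK, logSqPrimitive, hE1, hE2, hb, ha]; ring
  rw [key, hp3]
  have hp23 : p ^ 2 ≤ p ^ 3 := pow_le_pow_right₀ hp (by norm_num)
  have hp03 : 1 ≤ p ^ 3 := one_le_pow₀ hp
  have t1 : |Q - logSqPrimitive u| ≤ 34 * p ^ 3 := by
    have : Real.log u ^ 2 ≤ (4 * p) ^ 2 := pow_le_pow_left₀ hl0 hlog 2
    nlinarith
  have t2 : |2 * u * Real.log u * E1| ≤ 40 * p ^ 3 := by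
    rw [abs_mul, abs_of_nonneg (by positivity : 0 ≤ 2 * u * Real.log u)]
    calc 2 * u * Real.log u * |E1| ≤ 2 * u * (4 * p) * (5 * (1 / p ^ 2)) := by gcongr
      _ = 40 * p ^ 3 := by rw [← hp4]; field_simp; ring
  have t3 : |2 * u * E2| ≤ 60 * p ^ 3 := by
    rw [abs_mul, abs_of_nonneg (by positivity : 0 ≤ 2 * u)]
    calc 2 * u * |E2| ≤ 2 * u * (30 * (1 / p ^ 2)) := by gcongr
      _ = 60 * p ^ 2 := by rw [← hp4]; field_simp; ring
      _ ≤ 60 * p ^ 3 := by linarith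
  have t4 : |a * u * E1| ≤ 5 * |a| * p ^ 3 := by
    rw [abs_mul, abs_mul, abs_of_nonneg (by linarith : 0 ≤ u)]
    calc |a| * u * |E1| ≤ |a| * u * (5 * (1 / p ^ 2)) := by gcongr
      _ = 5 * |a| * p ^ 2 := by rw [← hp4]; field_simp
      _ ≤ 5 * |a| * p ^ 3 := by gcongr
  have t5 : |b * (u - ⌊u⌋₊)| ≤ |b| * p ^ 3 := by
    rw [abs_mul, abs_of_nonneg (by linarith : 0 ≤ u - ⌊u⌋₊)]
    gcongr; linarith
  have r1 := abs_le.mp t1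
  have r2 := abs_le.mp t2
  have r3 := abs_le.mp t3
  have r4 := abs_le.mp t4
  have r5 := abs_le.mp t5
  have e : (34 + 40 + 60 + 5 * |a| + |b|) * p ^ 3 =
      34 * p ^ 3 + 40 * p ^ 3 + 60 * p ^ 3 + 5 * |a| * p ^ 3 + |b| * p ^ 3 := by ring
  rw [abs_le, e]
  constructor <;> linarith [r1.1, r1.2, r2.1, r2.2, r3.1, r3.2, r4.1, r4.2, r5.1, r5.2]

theorem sum_Ioc_sum_Ioc_div {M : Type*} [AddCommMonoid M] (g : ℕ → ℕ → M) (N : ℕ) :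
    ∑ d ∈ Finset.Ioc 0 N, ∑ n ∈ Finset.Ioc 0 (N / d), g d n =
      ∑ m ∈ Finset.Ioc 0 N, ∑ p ∈ m.divisorsAntidiagonal, g p.1 p.2 := by
  rw [Finset.sum_sigma', Finset.sum_sigma']
  refine Finset.sum_bij' (fun x _ => ⟨x.1 * x.2, (x.1, x.2)⟩) (fun y _ => ⟨y.2.1, y.2.2⟩) ?_ ?_ ?_ ?_ ?_
  · rintro ⟨d, n⟩ h
    simp only [Finset.mem_sigma, Finset.mem_Ioc, Nat.mem_divisorsAntidiagonal, ne_eq] at h ⊢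
    obtain ⟨⟨hd, -⟩, hn, hle⟩ := h
    rw [Nat.le_div_iff_mul_le hd, mul_comm] at hle
    have : 0 < d * n := Nat.mul_pos hd hn
    exact ⟨⟨this, hle⟩, trivial, this.ne'⟩
  · rintro ⟨m, d, n⟩ h
    simp only [Finset.mem_sigma, Finset.mem_Ioc, Nat.mem_divisorsAntidiagonal, ne_eq] at h ⊢
    obtain ⟨⟨hm, hmN⟩, rfl, -⟩ := h
    have hd := Nat.pos_of_mul_pos_right hm
    have hn := Nat.pos_of_mul_pos_left hm
    rw [Nat.le_div_iff_mul_le hd, mul_comm n]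
    exact ⟨⟨hd, (Nat.le_mul_of_pos_right d hn).trans hmN⟩, hn, hmN⟩
  · rintro ⟨d, n⟩ h; rfl
  · rintro ⟨m, d, n⟩ h
    simp only [Finset.mem_sigma, Finset.mem_Ioc, Nat.mem_divisorsAntidiagonal, ne_eq] at h
    obtain ⟨-, rfl, -⟩ := h
    rfl
  · rintro ⟨d, n⟩ h; rfl

open ArithmeticFunction in
/-- Möbius inversion for functions of a real variable. -/
theorem sum_moebius_mul_sum_div (H : ℝ → ℝ) {x : ℝ} (hx : 1 ≤ x) :
    ∑ d ∈ Finset.Ioc 0 ⌊x⌋₊, (moebius d : ℝ) * ∑ n ∈ Finset.Ioc 0 ⌊x / d⌋₊, H (x / d / n) = H x := by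
  have hn : 1 ≤ ⌊x⌋₊ := (Nat.one_le_floor_iff _).mpr hx
  simp_rw [Nat.floor_div_natCast, Finset.mul_sum]
  rw [sum_Ioc_sum_Ioc_div (fun d n => (moebius d : ℝ) * H (x / d / n))]
  have : ∀ m ∈ Finset.Ioc 0 ⌊x⌋₊, ∑ p ∈ m.divisorsAntidiagonal, (moebius p.1 : ℝ) * H (x / p.1 / p.2) =
      if m = 1 then H x else 0 := by
    intro m hm
    have h1 : ∀ p ∈ m.divisorsAntidiagonal, (moebius p.1 : ℝ) * H (x / p.1 / p.2) =
        (moebius p.1 : ℝ) * H (x / m) := by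
      intro p hp
      rw [div_div, ← Nat.cast_mul, (Nat.mem_divisorsAntidiagonal.mp hp).1]
    rw [Finset.sum_congr rfl h1, ← Finset.sum_mul, Nat.sum_divisorsAntidiagonal (fun d _ => (moebius d : ℝ))]
    have h2 := congrArg (fun f : ArithmeticFunction ℤ => ((f m : ℤ) : ℝ)) moebius_mul_coe_zeta
    simp only [coe_mul_zeta_apply, one_apply] at h2
    push_cast at h2
    rw [h2]
    split_ifs with h
    · simp [h]
    · simp
  rw [Finset.sum_congr rfl this, Finset.sum_ite_eq' , if_pos (by simp; omega)]

theorem sum_rpow_three_quarters_le {x : ℝ} (hx : 1 ≤ x) :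
    ∑ d ∈ Finset.Ioc 0 ⌊x⌋₊, (x / d) ^ (3 / 4 : ℝ) ≤ 4 * x := by
  have hstep : ∀ n : ℕ, ∑ d ∈ Finset.Ioc 0 n, (1 / (d:ℝ)) ^ (3 / 4 : ℝ) ≤ 4 * (n:ℝ) ^ (1 / 4 : ℝ) := by
    intro n
    induction n with
    | zero => simp
    | succ n ih =>
      rw [Finset.sum_Ioc_succ_top (by omega)]
      have h4 : ∀ k : ℕ, ((k:ℝ) ^ (1 / 4 : ℝ)) ^ 4 = k := fun k => by
        rw [← Real.rpow_natCast, ← Real.rpow_mul (by positivity)]; norm_num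
      have ht : (1 / ((n + 1 : ℕ) : ℝ)) ^ (3 / 4 : ℝ) = 1 / (((n + 1 : ℕ) : ℝ) ^ (1 / 4 : ℝ)) ^ 3 := by
        rw [Real.div_rpow zero_le_one (by positivity), Real.one_rpow, ← Real.rpow_natCast,
          ← Real.rpow_mul (by positivity)]; norm_num
      rw [ht]
      have a1 := h4 n
      have a2 := h4 (n + 1)
      have hs : 0 ≤ (n:ℝ) ^ (1 / 4 : ℝ) := by positivity
      have ht0 : 0 < ((n + 1 : ℕ):ℝ) ^ (1 / 4 : ℝ) := by positivity
      have hst : (n:ℝ) ^ (1 / 4 : ℝ) ≤ ((n + 1 : ℕ):ℝ) ^ (1 / 4 : ℝ) := by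
        apply Real.rpow_le_rpow <;> [positivity; (push_cast; linarith); norm_num]
      set s := (n:ℝ) ^ (1 / 4 : ℝ)
      set t := ((n + 1 : ℕ):ℝ) ^ (1 / 4 : ℝ)
      have h5 : 1 ≤ 4 * t ^ 3 * (t - s) := by
        have e : t ^ 4 - s ^ 4 = 1 := by rw [a1, a2]; push_cast; ring
        have e2 : t ^ 4 - s ^ 4 = (t - s) * (t ^ 3 + t ^ 2 * s + t * s ^ 2 + s ^ 3) := by ring
        have e3 : t ^ 3 + t ^ 2 * s + t * s ^ 2 + s ^ 3 ≤ 4 * t ^ 3 := by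
          have i1 : t ^ 2 * s ≤ t ^ 2 * t := by gcongr
          have i2 : t * s ^ 2 ≤ t * t ^ 2 := by gcongr
          have i3 : s ^ 3 ≤ t ^ 3 := by gcongr
          nlinarith
        nlinarith [mul_le_mul_of_nonneg_left e3 (by linarith : 0 ≤ t - s)]
      have h6 : 1 / t ^ 3 ≤ 4 * (t - s) := by
        rw [div_le_iff₀ (by positivity)]; linarith
      linarith
  have h0 : 0 ≤ x := by linarith
  calc ∑ d ∈ Finset.Ioc 0 ⌊x⌋₊, (x / d) ^ (3 / 4 : ℝ)
      = x ^ (3 / 4 : ℝ) * ∑ d ∈ Finset.Ioc 0 ⌊x⌋₊, (1 / (d:ℝ)) ^ (3 / 4 : ℝ) := by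
        rw [Finset.mul_sum]
        refine Finset.sum_congr rfl fun d _ => ?_
        rw [← Real.mul_rpow h0 (by positivity), mul_one_div]
    _ ≤ x ^ (3 / 4 : ℝ) * (4 * x ^ (1 / 4 : ℝ)) := by
        gcongr
        refine (hstep _).trans ?_
        gcongr
        exact Nat.floor_le h0
    _ = 4 * x := by
        rw [mul_left_comm, ← Real.rpow_add (by linarith)]; norm_num

/-- Selberg's function `μ * log²`, the Dirichlet convolution of the Möbius function with `log²`. -/
noncomputable def selbergLambda : ArithmeticFunction ℝ :=
  (ArithmeticFunction.moebius : ArithmeticFunction ℝ) *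
    ArithmeticFunction.pmul ArithmeticFunction.log ArithmeticFunction.log

open ArithmeticFunction in
/-- Selberg's formula: the sum of `μ * log²` up to `x` is `2 x log x + O(x)`. -/
theorem exists_sum_selbergLambda_approx :
    ∃ a b C : ℝ, 0 ≤ C ∧ ∀ x : ℝ, 1 ≤ x →
      |∑ n ∈ Finset.Ioc 0 ⌊x⌋₊, selbergLambda n - selbergMain a b x| ≤ C * x := by
  obtain ⟨a, b, C, hC, h⟩ := exists_sum_selbergMain_approx
  refine ⟨a, b, C * 4, by positivity, fun x hx => ?_⟩
  rw [selbergLambda, sum_Ioc_mul_eq_sum_sum, ← sum_moebius_mul_sum_div (selbergMain a b) hx,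
    ← Finset.sum_sub_distrib]
  calc _ ≤ ∑ d ∈ Finset.Ioc 0 ⌊x⌋₊, C * (x / d) ^ (3 / 4 : ℝ) := by
        refine (Finset.abs_sum_le_sum_abs _ _).trans (Finset.sum_le_sum fun d hd => ?_)
        obtain ⟨hd0, hdN⟩ := Finset.mem_Ioc.mp hd
        have hd1 : (0:ℝ) < d := by exact_mod_cast hd0
        have hxd : 1 ≤ x / d := by
          rw [le_div_iff₀ hd1, one_mul]
          exact (Nat.le_floor_iff (by linarith)).mp hdN
        have h2 := h _ hxd
        rw [intCoe_apply, ← mul_sub, abs_mul, Nat.floor_div_natCast] at *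
        have h3 : |(moebius d : ℝ)| ≤ 1 := by exact_mod_cast abs_moebius_le_one
        refine (mul_le_mul_of_nonneg_right h3 (abs_nonneg _)).trans ?_
        rw [one_mul]
        refine le_trans (le_of_eq ?_) h2
        simp only [pmul_apply, log_apply, sq]
    _ = C * ∑ d ∈ Finset.Ioc 0 ⌊x⌋₊, (x / d) ^ (3 / 4 : ℝ) := by rw [Finset.mul_sum]
    _ ≤ C * (4 * x) := by gcongr; exact sum_rpow_three_quarters_le hx
    _ = C * 4 * x := by ring

open ArithmeticFunction in
theorem pmul_log_mul (f g : ArithmeticFunction ℝ) :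
    pmul log (f * g) = pmul log f * g + f * pmul log g := by
  ext n
  simp only [pmul_apply, mul_apply, ArithmeticFunction.add_apply, Finset.mul_sum, ← Finset.sum_add_distrib]
  refine Finset.sum_congr rfl fun p hp => ?_
  obtain ⟨h1, h2⟩ := Nat.mem_divisorsAntidiagonal.mp hp
  have h3 : p.1 ≠ 0 ∧ p.2 ≠ 0 := by
    rw [← h1] at h2; exact ⟨left_ne_zero_of_mul h2, right_ne_zero_of_mul h2⟩
  rw [← h1, log_apply, Nat.cast_mul, Real.log_mul (by exact_mod_cast h3.1) (by exact_mod_cast h3.2),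
    log_apply, log_apply]
  ring

open ArithmeticFunction in
/-- The identity `μ * log² = Λ log + Λ * Λ`. -/
theorem selbergLambda_eq :
    selbergLambda = pmul log vonMangoldt + vonMangoldt * vonMangoldt := by
  have h : pmul log log = (pmul log vonMangoldt + vonMangoldt * vonMangoldt) * (zeta : ArithmeticFunction ℝ) := by
    conv_lhs => arg 2; rw [← vonMangoldt_mul_zeta]
    rw [pmul_log_mul]
    have : pmul log (zeta : ArithmeticFunction ℝ) = log := pmul_zeta _
    rw [this, add_mul, mul_assoc vonMangoldt, vonMangoldt_mul_zeta]
  rw [selbergLambda, h, mul_comm, mul_assoc, coe_zeta_mul_coe_moebius, mul_one]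

open ArithmeticFunction in
theorem vonMangoldt_mul_log_le_selbergLambda (n : ℕ) : vonMangoldt n * Real.log n ≤ selbergLambda n := by
  rw [selbergLambda_eq, ArithmeticFunction.add_apply, pmul_apply, log_apply, mul_comm]
  have : 0 ≤ (vonMangoldt * vonMangoldt) n := by
    rw [mul_apply]
    exact Finset.sum_nonneg fun p _ => mul_nonneg vonMangoldt_nonneg vonMangoldt_nonneg
  linarith

open ArithmeticFunction in
/-- A Brun–Titchmarsh type bound, obtained from Selberg's formula and `Λ log ≤ μ * log²`. The term
`y / (1 + log y)` is the error term `O(y)` of that formula divided by `log y`, with `1 + log y` in place of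
`log y` to cover `y` near `1`. -/
theorem exists_psi_sub_psi_le :
    ∃ C : ℝ, 0 < C ∧ ∀ y h : ℝ, 1 ≤ y → 0 ≤ h → h ≤ y →
      Chebyshev.psi (y + h) - Chebyshev.psi y ≤ C * (h + y / (1 + Real.log y)) := by
  obtain ⟨a, b, C, hC, H⟩ := exists_sum_selbergLambda_approx
  refine ⟨2 * (Real.log 4 + 4) + 2 + 4 + |a| + 3 * C, by positivity, fun y h hy hh hhy => ?_⟩
  have hl : 0 ≤ Real.log y := Real.log_nonneg hy
  have hsub : Chebyshev.psi (y + h) - Chebyshev.psi y = ∑ n ∈ Finset.Ioc ⌊y⌋₊ ⌊y + h⌋₊, vonMangoldt n := by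
    rw [Chebyshev.psi, Chebyshev.psi, sub_eq_iff_eq_add', Finset.sum_Ioc_consecutive _ (Nat.zero_le _)
      (Nat.floor_mono (by linarith))]
  have h1 : (Chebyshev.psi (y + h) - Chebyshev.psi y) * Real.log y ≤
      ∑ n ∈ Finset.Ioc ⌊y⌋₊ ⌊y + h⌋₊, selbergLambda n := by
    rw [hsub, Finset.sum_mul]
    refine Finset.sum_le_sum fun n hn => ?_
    refine le_trans ?_ (vonMangoldt_mul_log_le_selbergLambda n)
    have : y ≤ n := (Nat.lt_of_floor_lt (Finset.mem_Ioc.mp hn).1).le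
    have := Real.log_le_log (by linarith) this
    exact mul_le_mul_of_nonneg_left this vonMangoldt_nonneg
  have h2 : ∑ n ∈ Finset.Ioc ⌊y⌋₊ ⌊y + h⌋₊, selbergLambda n =
      ∑ n ∈ Finset.Ioc 0 ⌊y + h⌋₊, selbergLambda n - ∑ n ∈ Finset.Ioc 0 ⌊y⌋₊, selbergLambda n := by
    rw [eq_sub_iff_add_eq', Finset.sum_Ioc_consecutive _ (Nat.zero_le _)
      (Nat.floor_mono (by linarith))]
  have h3 := (abs_le.mp (H (y + h) (by linarith))).2
  have h4 := (abs_le.mp (H y hy)).1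
  have h5 : selbergMain a b (y + h) - selbergMain a b y ≤ 2 * h * Real.log y + 4 * y + |a| * y := by
    have e1 : Real.log (y + h) ≤ Real.log y + h / y := by
      have : y + h = y * (1 + h / y) := by field_simp
      rw [this, Real.log_mul (by linarith) (by positivity)]
      have := Real.log_le_sub_one_of_pos (x := 1 + h / y) (by positivity)
      linarith
    have e2 : 2 * (y + h) * Real.log (y + h) ≤ 2 * (y + h) * (Real.log y + h / y) := by gcongr
    have e3 : 2 * (y + h) * (h / y) ≤ 2 * (y + y) * (y / y) := by gcongr
    rw [div_self (by linarith)] at e3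
    have e4 : a * h ≤ |a| * y := by
      refine (mul_le_mul_of_nonneg_right (le_abs_self a) hh).trans ?_
      gcongr
    simp only [selbergMain]
    nlinarith
  have h6 : Chebyshev.psi (y + h) ≤ (Real.log 4 + 4) * (2 * y) := by
    refine (Chebyshev.psi_le_const_mul_self (by linarith)).trans ?_
    have : 0 ≤ Real.log 4 := Real.log_nonneg (by norm_num)
    gcongr; linarith
  have h7 := Chebyshev.psi_nonneg y
  have h8 : (Chebyshev.psi (y + h) - Chebyshev.psi y) * (1 + Real.log y) ≤
      (2 * (Real.log 4 + 4) + 2 + 4 + |a| + 3 * C) * (h * (1 + Real.log y) + y) := by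
    have e1 : C * (y + h) + C * y ≤ 3 * C * y := by nlinarith
    have e2 : (Chebyshev.psi (y + h) - Chebyshev.psi y) * (1 + Real.log y) ≤
      2 * h * Real.log y + (2 * (Real.log 4 + 4) + 4 + |a| + 3 * C) * y := by nlinarith
    have e3 : 0 ≤ 2 * (Real.log 4 + 4) + 4 + |a| + 3 * C := by positivity
    have e4 : 0 ≤ h * (1 + Real.log y) := by positivity
    nlinarith [mul_nonneg e3 e4]
  have : (h + y / (1 + Real.log y)) = (h * (1 + Real.log y) + y) / (1 + Real.log y) := by
    field_simp
  rw [this, ← mul_div_assoc, le_div_iff₀ (by linarith)]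
  exact h8

/-! ### Weighted sums over prime powers -/

open ArithmeticFunction in
/-- The upper bound in Mertens' first theorem. -/
theorem sum_vonMangoldt_div_le {w : ℝ} (hw : 1 ≤ w) :
    ∑ k ∈ Finset.Ioc 0 ⌊w⌋₊, vonMangoldt k / k ≤ Real.log w + (Real.log 4 + 4) := by
  have hn : 1 ≤ ⌊w⌋₊ := (Nat.one_le_floor_iff _).mpr hw
  have hN : (1:ℝ) ≤ (⌊w⌋₊ : ℝ) := by exact_mod_cast hn
  have hle := Nat.floor_le (by linarith : 0 ≤ w)
  set N := ⌊w⌋₊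
  have h1 : ∑ n ∈ Finset.Ioc 0 N, Real.log n = ∑ n ∈ Finset.Ioc 0 N, vonMangoldt n * ((N / n : ℕ) : ℝ) := by
    rw [← sum_Ioc_mul_zeta_eq_sum, vonMangoldt_mul_zeta]
    rfl
  have h2 : ∑ n ∈ Finset.Ioc 0 N, Real.log n ≤ N * Real.log N := by
    refine (Finset.sum_le_card_nsmul _ _ (Real.log N) fun n hn => ?_).trans ?_
    · obtain ⟨a, b⟩ := Finset.mem_Ioc.mp hn
      exact Real.log_le_log (by exact_mod_cast a) (by exact_mod_cast b)
    · simp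
  have h3 : Chebyshev.psi N ≤ (Real.log 4 + 4) * N := Chebyshev.psi_le_const_mul_self (by positivity)
  rw [Chebyshev.psi, Nat.floor_natCast] at h3
  have h4 : N * ∑ k ∈ Finset.Ioc 0 N, vonMangoldt k / k ≤
      ∑ n ∈ Finset.Ioc 0 N, vonMangoldt n * ((N / n : ℕ) : ℝ) + ∑ n ∈ Finset.Ioc 0 N, vonMangoldt n := by
    rw [Finset.mul_sum, ← Finset.sum_add_distrib]
    refine Finset.sum_le_sum fun k hk => ?_
    have hk0 : (0:ℝ) < k := by exact_mod_cast (Finset.mem_Ioc.mp hk).1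
    have : (N:ℝ) / k ≤ ((N / k : ℕ) : ℝ) + 1 := by
      have := Nat.lt_floor_add_one ((N:ℝ) / k)
      rw [Nat.floor_div_natCast, Nat.floor_natCast] at this
      exact this.le
    calc (N:ℝ) * (vonMangoldt k / k) = vonMangoldt k * (N / k) := by ring
      _ ≤ vonMangoldt k * (((N / k : ℕ) : ℝ) + 1) := mul_le_mul_of_nonneg_left this vonMangoldt_nonneg
      _ = _ := by ring
  have h5 : N * ∑ k ∈ Finset.Ioc 0 N, vonMangoldt k / k ≤ N * (Real.log N + (Real.log 4 + 4)) := by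
    linarith
  have h6 := le_of_mul_le_mul_left h5 (by linarith)
  have h7 := Real.log_le_log (by linarith) hle
  linarith

open ArithmeticFunction in
/-- A sum over the primes and prime powers up to `w` that weighs down `k` by `(k / w) ^ T`, so that
only `k` in the short range `w * exp (-1 / T) < k ≤ w` matter. -/
theorem exists_sum_vonMangoldt_div_mul_rpow_le :
    ∃ C : ℝ, 0 < C ∧ ∀ T w : ℝ, 2 ≤ T → 1 ≤ w →
      ∑ k ∈ Finset.Ioc 0 ⌊w⌋₊, vonMangoldt k / k * (k / w) ^ T ≤ C * (1 / T + 1 / (1 + Real.log w)) := by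
  obtain ⟨C, hC, H⟩ := exists_psi_sub_psi_le
  refine ⟨8 * C, by positivity, fun T w hT hw => ?_⟩
  have hT0 : 0 < T := by linarith
  have hT2 : 1 / T ≤ 1 / 2 := one_div_le_one_div_of_le (by norm_num) hT
  have hTp : 0 < 1 / T := by positivity
  have hexp : Real.exp (1 / T) - 1 ≤ 2 * (1 / T) := by
    have := Real.abs_exp_sub_one_le (x := 1 / T) (by rw [abs_of_pos hTp]; linarith)
    rw [abs_of_pos hTp] at this
    exact (le_abs_self _).trans this
  -- induction on the number of steps of ratio `exp (1 / T)` from `w` down to `1`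
  have main : ∀ n : ℕ, ∀ w : ℝ, 1 ≤ w → T * Real.log w < n →
      ∑ k ∈ Finset.Ioc 0 ⌊w⌋₊, vonMangoldt k / k * (k / w) ^ T ≤
        8 * C * (1 / T + 1 / (1 + Real.log w)) := by
    intro n
    induction n with
    | zero =>
      intro w hw h
      have := Real.log_nonneg hw
      have : 0 ≤ T * Real.log w := by positivity
      simp at h; linarith
    | succ n ih =>
      intro w hw h
      have hlw := Real.log_nonneg hw
      set u := w * Real.exp (-(1 / T)) with hu
      have hu0 : 0 < u := by positivity
      have hwu : w = u * Real.exp (1 / T) := by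
        rw [hu, mul_assoc, ← Real.exp_add]; simp
      have hlu : Real.log u = Real.log w - 1 / T := by
        rw [hu, Real.log_mul (by linarith) (Real.exp_pos _).ne', Real.log_exp]; ring
      have huw : u ≤ w := by
        rw [hwu]; exact le_mul_of_one_le_right hu0.le (Real.one_le_exp hTp.le)
      have hw2 : w ≤ 2 * u := by rw [hwu]; nlinarith
      by_cases hu1 : 1 ≤ u
      · have hlu0 := Real.log_nonneg hu1
        have hi := ih u hu1 (by
          rw [hlu, mul_sub, mul_one_div_cancel hT0.ne']; push_cast at h; linarith)
        have hsplit : ∑ k ∈ Finset.Ioc 0 ⌊w⌋₊, vonMangoldt k / k * (k / w) ^ T =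
            ∑ k ∈ Finset.Ioc 0 ⌊u⌋₊, vonMangoldt k / k * (k / w) ^ T +
            ∑ k ∈ Finset.Ioc ⌊u⌋₊ ⌊w⌋₊, vonMangoldt k / k * (k / w) ^ T := by
          rw [Finset.sum_Ioc_consecutive _ (Nat.zero_le _) (Nat.floor_mono huw)]
        have h1 : ∑ k ∈ Finset.Ioc 0 ⌊u⌋₊, vonMangoldt k / k * (k / w) ^ T =
            Real.exp (-1) * ∑ k ∈ Finset.Ioc 0 ⌊u⌋₊, vonMangoldt k / k * (k / u) ^ T := by
          rw [Finset.mul_sum]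
          refine Finset.sum_congr rfl fun k _ => ?_
          have : (k:ℝ) / w = k / u * Real.exp (-(1 / T)) := by
            rw [hwu, Real.exp_neg]; field_simp
          rw [this, Real.mul_rpow (by positivity) (Real.exp_pos _).le, ← Real.exp_mul]
          have : -(1 / T) * T = -1 := by field_simp
          rw [this]; ring
        have h2 : ∑ k ∈ Finset.Ioc ⌊u⌋₊ ⌊w⌋₊, vonMangoldt k / k * (k / w) ^ T ≤
            1 / u * (Chebyshev.psi w - Chebyshev.psi u) := by
          have : Chebyshev.psi w - Chebyshev.psi u = ∑ n ∈ Finset.Ioc ⌊u⌋₊ ⌊w⌋₊, vonMangoldt n := by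
            rw [Chebyshev.psi, Chebyshev.psi, sub_eq_iff_eq_add', Finset.sum_Ioc_consecutive _ (Nat.zero_le _)
              (Nat.floor_mono huw)]
          rw [this, Finset.mul_sum]
          refine Finset.sum_le_sum fun k hk => ?_
          obtain ⟨ha, hb⟩ := Finset.mem_Ioc.mp hk
          have hk1 : u ≤ k := (Nat.lt_of_floor_lt ha).le
          have hk2 : (k:ℝ) ≤ w := (Nat.le_floor_iff (by linarith)).mp hb
          have h3 : ((k:ℝ) / w) ^ T ≤ 1 :=
            Real.rpow_le_one (by positivity) ((div_le_one (by linarith)).mpr hk2) hT0.le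
          calc vonMangoldt k / k * (k / w) ^ T ≤ vonMangoldt k / k * 1 :=
                mul_le_mul_of_nonneg_left h3 (div_nonneg vonMangoldt_nonneg (by positivity))
            _ = 1 / (k:ℝ) * vonMangoldt k := by ring
            _ ≤ 1 / u * vonMangoldt k :=
                mul_le_mul_of_nonneg_right (one_div_le_one_div_of_le hu0 hk1) vonMangoldt_nonneg
        have h3 := H u (w - u) hu1 (by linarith) (by linarith)
        rw [add_sub_cancel] at h3
        have h4 : 1 / u * (Chebyshev.psi w - Chebyshev.psi u) ≤ 2 * C * (1 / T + 1 / (1 + Real.log w)) := by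
          have a1 : w - u ≤ u * (2 * (1 / T)) := by
            calc w - u = u * (Real.exp (1 / T) - 1) := by rw [hwu]; ring
              _ ≤ _ := by gcongr
          have a2 : 1 / (1 + Real.log u) ≤ 2 * (1 / (1 + Real.log w)) := by
            rw [mul_one_div, div_le_div_iff₀ (by linarith) (by linarith)]; linarith
          calc 1 / u * (Chebyshev.psi w - Chebyshev.psi u)
              ≤ 1 / u * (C * (u * (2 * (1 / T)) + u / (1 + Real.log u))) := by
                gcongr; exact h3.trans (by gcongr)
            _ = C * (2 * (1 / T) + 1 / (1 + Real.log u)) := by field_simp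
            _ ≤ C * (2 * (1 / T) + 2 * (1 / (1 + Real.log w))) := by gcongr
            _ = _ := by ring
        have h5 : 1 / (1 + Real.log u) ≤ 2 * (1 / (1 + Real.log w)) := by
          rw [mul_one_div, div_le_div_iff₀ (by linarith) (by linarith)]; linarith
        rw [hsplit, h1]
        have h6 : Real.exp (-1) ≤ 3 / 8 := by
          rw [Real.exp_neg, inv_le_comm₀ (Real.exp_pos _) (by norm_num)]
          have := Real.exp_one_gt_d9; norm_num at this ⊢; linarith
        have h7 : 0 ≤ 1 / (1 + Real.log u) := by positivity
        calc _ ≤ 3 / 8 * (8 * C * (1 / T + 1 / (1 + Real.log u))) + 2 * C * (1 / T + 1 / (1 + Real.log w)) := by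
              refine add_le_add (mul_le_mul h6 hi (Finset.sum_nonneg fun k _ => ?_) (by norm_num)) (h2.trans h4)
              exact mul_nonneg (div_nonneg vonMangoldt_nonneg (by positivity)) (by positivity)
          _ ≤ 3 / 8 * (8 * C * (1 / T + 2 * (1 / (1 + Real.log w)))) + 2 * C * (1 / T + 1 / (1 + Real.log w)) := by
              gcongr
          _ ≤ 8 * C * (1 / T + 1 / (1 + Real.log w)) := by
              have : 0 < C * (1 / T) := by positivity
              nlinarith
      · -- here `w < 2`, and the sum is empty up to the vanishing term `k = 1`
        have hw2' : w < 2 := by linarith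
        have hf : ⌊w⌋₊ = 1 := by
          rw [Nat.floor_eq_iff (by linarith)]; push_cast; constructor <;> linarith
        rw [hf]
        simp
        positivity
  obtain ⟨n, hn⟩ := exists_nat_gt (T * Real.log w)
  exact main n w hw hn

/-! ### Partial sums and their logarithmic averages -/

theorem partialSum_eq_sum_Ioc (f : ℕ → ℂ) (x : ℝ) :
    partialSum f x = ∑ n ∈ Finset.Ioc 0 ⌊x⌋₊, f n := rfl

theorem norm_partialSum_sub_le {f : ℕ → ℂ} (hf : ∀ n, ‖f n‖ ≤ 1) {a b : ℝ} (ha : 0 ≤ a) (hab : a ≤ b) :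
    ‖partialSum f b - partialSum f a‖ ≤ b - a + 1 := by
  have hfl := Nat.floor_mono hab
  rw [partialSum_eq_sum_Ioc, partialSum_eq_sum_Ioc,
    ← Finset.sum_Ioc_consecutive _ (Nat.zero_le _) hfl, add_sub_cancel_left]
  refine (norm_sum_le_of_le _ fun n _ => hf n).trans ?_
  rw [Finset.sum_const, Nat.card_Ioc, nsmul_eq_mul, mul_one, Nat.cast_sub hfl]
  have := Nat.floor_le (ha.trans hab)
  have := Nat.lt_floor_add_one a
  linarith

theorem norm_partialSum_le {f : ℕ → ℂ} (hf : ∀ n, ‖f n‖ ≤ 1) {u : ℝ} (hu : 0 ≤ u) :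
    ‖partialSum f u‖ ≤ u := by
  rw [partialSum_eq_sum_Ioc]
  refine (norm_sum_le_of_le _ fun n _ => hf n).trans ?_
  simpa using Nat.floor_le hu

theorem sub_le_sum_log (N : ℕ) : N * Real.log N - N ≤ ∑ n ∈ Finset.Ioc 0 N, Real.log n := by
  induction N with
  | zero => simp
  | succ n ih =>
    rw [Finset.sum_Ioc_succ_top (by omega)]
    rcases Nat.eq_zero_or_pos n with rfl | hn
    · simp
    have h := (log_succ_sub_log_bounds hn).2
    have hn0 : (0:ℝ) < n := by exact_mod_cast hn
    rw [le_div_iff₀ hn0] at h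
    push_cast
    nlinarith

/-- Partial summation: `∑ f(n) log (u / n)` over `n ≤ u` is at most `u` in absolute value. -/
theorem norm_partialSum_mul_log_le {f : ℕ → ℂ} (hf : ∀ n, ‖f n‖ ≤ 1) {u : ℝ} (hu : 1 ≤ u) :
    ‖partialSum f u‖ * Real.log u ≤ ‖partialSum (fun n => f n * Real.log n) u‖ + u := by
  have hN : (1:ℝ) ≤ (⌊u⌋₊ : ℝ) := by exact_mod_cast (Nat.one_le_floor_iff _).mpr hu
  have hle := Nat.floor_le (by linarith : 0 ≤ u)
  have hl := Real.log_nonneg hu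
  have h1 : partialSum f u * Real.log u - partialSum (fun n => f n * Real.log n) u =
      ∑ n ∈ Finset.Ioc 0 ⌊u⌋₊, f n * ((Real.log u - Real.log n : ℝ) : ℂ) := by
    rw [partialSum_eq_sum_Ioc, partialSum_eq_sum_Ioc, Finset.sum_mul, ← Finset.sum_sub_distrib]
    refine Finset.sum_congr rfl fun n _ => ?_
    push_cast; ring
  have h2 : ‖partialSum f u * Real.log u - partialSum (fun n => f n * Real.log n) u‖ ≤
      ∑ n ∈ Finset.Ioc 0 ⌊u⌋₊, (Real.log u - Real.log n) := by
    rw [h1]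
    refine norm_sum_le_of_le _ fun n hn => ?_
    obtain ⟨a, b⟩ := Finset.mem_Ioc.mp hn
    have : Real.log n ≤ Real.log u :=
      Real.log_le_log (by exact_mod_cast a) ((Nat.le_floor_iff (by linarith)).mp b)
    rw [norm_mul, Complex.norm_real, Real.norm_of_nonneg (by linarith)]
    exact mul_le_of_le_one_left (by linarith) (hf n)
  have h3 : ∑ n ∈ Finset.Ioc 0 ⌊u⌋₊, (Real.log u - Real.log n) ≤ u := by
    rw [Finset.sum_sub_distrib]
    have := sub_le_sum_log ⌊u⌋₊
    have h4 : (⌊u⌋₊ : ℝ) * (Real.log u - Real.log ⌊u⌋₊) ≤ u - ⌊u⌋₊ := by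
      rw [← Real.log_div (by linarith) (by linarith)]
      have := Real.log_le_sub_one_of_pos (x := u / ⌊u⌋₊) (by positivity)
      calc (⌊u⌋₊ : ℝ) * Real.log (u / ⌊u⌋₊) ≤ ⌊u⌋₊ * (u / ⌊u⌋₊ - 1) := by gcongr
        _ = _ := by field_simp
    simp only [Finset.sum_const, Nat.card_Ioc, Nat.sub_zero, nsmul_eq_mul]
    linarith
  have h4 : ‖partialSum f u * Real.log u‖ = ‖partialSum f u‖ * Real.log u := by
    rw [norm_mul, Complex.norm_real, Real.norm_of_nonneg hl]
  have h5 := norm_sub_norm_le (partialSum f u * Real.log u) (partialSum (fun n => f n * Real.log n) u)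
  linarith

open ArithmeticFunction in
theorem sum_divisorsAntidiagonal_mul_vonMangoldt (f : ℕ →*₀ ℂ) (n : ℕ) :
    ∑ p ∈ n.divisorsAntidiagonal, f p.1 * vonMangoldt p.1 * f p.2 = f n * Real.log n := by
  have h := congrArg (fun g : ArithmeticFunction ℝ => g n) vonMangoldt_mul_zeta
  simp only [coe_mul_zeta_apply, log_apply] at h
  rw [← h, ← Nat.sum_divisorsAntidiagonal (fun d _ => vonMangoldt d), Complex.ofReal_sum, Finset.mul_sum]
  refine Finset.sum_congr rfl fun p hp => ?_
  rw [← (Nat.mem_divisorsAntidiagonal.mp hp).1, map_mul]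
  ring

open ArithmeticFunction in
/-- The identity `f log = f Λ * f`, summed over `n ≤ x`. -/
theorem partialSum_mul_log_eq (f : ℕ →*₀ ℂ) (x : ℝ) :
    partialSum (fun n => f n * Real.log n) x =
      ∑ d ∈ Finset.Ioc 0 ⌊x⌋₊, f d * vonMangoldt d * partialSum f (x / d) := by
  simp_rw [partialSum_eq_sum_Ioc, Nat.floor_div_natCast, Finset.mul_sum]
  rw [sum_Ioc_sum_Ioc_div (fun d n => f d * vonMangoldt d * f n)]
  exact Finset.sum_congr rfl fun n _ => (sum_divisorsAntidiagonal_mul_vonMangoldt f n).symm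

open MeasureTheory in
theorem integrableOn_norm_partialSum_mul {f : ℕ → ℂ} (hf : ∀ n, ‖f n‖ ≤ 1) {φ : ℝ → ℝ} {a b : ℝ}
    (ha : 0 ≤ a) (hφ : IntegrableOn φ (Set.Ioc a b)) :
    IntegrableOn (fun u => ‖partialSum f u‖ * φ u) (Set.Ioc a b) := by
  refine Integrable.bdd_mul (c := b) hφ (measurable_partialSum f).norm.aestronglyMeasurable ?_
  filter_upwards [ae_restrict_mem measurableSet_Ioc] with u hu
  rw [norm_norm]
  exact (norm_partialSum_le hf (ha.trans hu.1.le)).trans hu.2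

open MeasureTheory in
/-- The average of `‖S(v / d)‖` over a short interval, as an integral of `‖S‖` over the fixed
range `1 < u ≤ 2 x`. -/
theorem integral_norm_partialSum_div {f : ℕ → ℂ} {x δ : ℝ} {d : ℕ} (hd : 1 ≤ d)
    (hdx : (d:ℝ) ≤ x) (hδ : 0 < δ) (hδ1 : δ ≤ 1) :
    ∫ v in Set.Ioc x (x * (1 + δ)), ‖partialSum f (v / d)‖ =
      d * ∫ u in Set.Ioc 1 (2 * x), ‖partialSum f u‖ *
        (Set.Ioc (x / d) (x * (1 + δ) / d)).indicator 1 u := by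
  have hd1 : (1:ℝ) ≤ d := by exact_mod_cast hd
  have hx : 1 ≤ x := hd1.trans hdx
  have hle : x ≤ x * (1 + δ) := by nlinarith
  rw [← intervalIntegral.integral_of_le hle,
    intervalIntegral.integral_comp_div (fun u => ‖partialSum f u‖) (by linarith), smul_eq_mul,
    intervalIntegral.integral_of_le (by gcongr)]
  congr 1
  have h2 : Set.Ioc (x / d) (x * (1 + δ) / d) ⊆ Set.Ioc 1 (2 * x) := by
    apply Set.Ioc_subset_Ioc
    · rwa [le_div_iff₀ (by linarith), one_mul]
    · rw [div_le_iff₀ (by linarith)]; nlinarith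
  have h3 : ∀ u, ‖partialSum f u‖ * (Set.Ioc (x / d) (x * (1 + δ) / d)).indicator 1 u =
      (Set.Ioc (x / d) (x * (1 + δ) / d)).indicator (fun u => ‖partialSum f u‖) u := by
    intro u
    by_cases h : u ∈ Set.Ioc (x / d) (x * (1 + δ) / d) <;> simp [h]
  simp_rw [h3]
  rw [setIntegral_indicator measurableSet_Ioc, Set.inter_eq_self_of_subset_right h2]

open ArithmeticFunction MeasureTheory in
/-- A partial sum is controlled by the logarithmic mean of the preceding ones. In
`f log = f Λ * f` each `S(x / d)` is replaced by its average over a short interval of relative length `δ`;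
after exchanging the sum over `d` and the integral, primes in short intervals are counted by
`exists_psi_sub_psi_le`. -/
theorem exists_norm_partialSum_mul_log_le :
    ∃ C : ℝ, 0 < C ∧ ∀ f : ℕ →*₀ ℂ, (∀ n, ‖f n‖ ≤ 1) → ∀ x δ : ℝ, 1 ≤ x → 0 < δ → δ ≤ 1 →
      ‖partialSum f x‖ * Real.log x ≤
        C * (x * (∫ u in Set.Ioc 1 (2 * x), ‖partialSum f u‖ / u ^ 2) + x / δ ^ 2 + δ * x * Real.log x) := by
  obtain ⟨C, hC, H⟩ := exists_psi_sub_psi_le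
  refine ⟨4 * C + 20, by positivity, fun f hf x δ hx hδ hδ1 => ?_⟩
  have hx0 : 0 < x := by linarith
  have hlx := Real.log_nonneg hx
  set N := ⌊x⌋₊ with hN
  set J := ∫ u in Set.Ioc 1 (2 * x), ‖partialSum f u‖ / u ^ 2 with hJ
  have hJ0 : 0 ≤ J := setIntegral_nonneg measurableSet_Ioc fun u _ => by positivity
  have hmem : ∀ d ∈ Finset.Ioc 0 N, 1 ≤ d ∧ (d:ℝ) ≤ x := fun d hd =>
    ⟨(Finset.mem_Ioc.mp hd).1, (Nat.le_floor_iff hx0.le).mp (Finset.mem_Ioc.mp hd).2⟩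
  set I : ℕ → Set ℝ := fun d => Set.Ioc (x / d) (x * (1 + δ) / d) with hI
  -- replace `S(x / d)` by its average over a short interval
  have hone : IntegrableOn (fun _ : ℝ => (1:ℝ)) (Set.Ioc 1 (2 * x)) := by simp
  have hint : ∀ d, IntegrableOn (fun u => ‖partialSum f u‖ * (I d).indicator 1 u) (Set.Ioc 1 (2 * x)) := by
    intro d
    refine integrableOn_norm_partialSum_mul hf zero_le_one ?_
    exact hone.indicator measurableSet_Ioc
  have havg : ∀ d ∈ Finset.Ioc 0 N, δ * x * ‖partialSum f (x / d)‖ ≤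
      d * (∫ u in Set.Ioc 1 (2 * x), ‖partialSum f u‖ * (I d).indicator 1 u) +
        δ * x * (δ * x * (1 / d) + 1) := by
    intro d hd
    obtain ⟨hd1, hdx⟩ := hmem d hd
    have hd0 : (0:ℝ) < d := by exact_mod_cast hd1
    rw [← integral_norm_partialSum_div hd1 hdx hδ hδ1]
    have hvol : ∀ c : ℝ, ∫ v in Set.Ioc x (x * (1 + δ)), c = δ * x * c := by
      intro c
      rw [setIntegral_const, smul_eq_mul, measureReal_def, Real.volume_Ioc, ENNReal.toReal_ofReal (by nlinarith)]
      ring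
    have hi2 : IntegrableOn (fun v => ‖partialSum f (v / d)‖) (Set.Ioc x (x * (1 + δ))) := by
      refine Measure.integrableOn_of_bounded (M := x * (1 + δ) / d) (by simp) ?_ ?_
      · exact ((measurable_partialSum f).comp (measurable_id.div_const _)).norm.aestronglyMeasurable
      · filter_upwards [ae_restrict_mem measurableSet_Ioc] with v hv
        rw [norm_norm]
        refine (norm_partialSum_le hf (div_nonneg (hx0.trans hv.1).le hd0.le)).trans ?_
        gcongr; exact hv.2
    rw [← hvol, ← hvol (δ * x * (1 / d) + 1), ← integral_add hi2 (by simp)]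
    refine setIntegral_mono_on (by simp) (hi2.add (by simp)) measurableSet_Ioc fun v hv => ?_
    have h1 := norm_partialSum_sub_le hf (a := x / d) (b := v / d) (by positivity) (by gcongr; exact hv.1.le)
    have h2 : v / d - x / d ≤ δ * x * (1 / d) := by
      rw [← sub_div, mul_one_div]; gcongr; linarith [hv.2]
    have h3 := norm_sub_norm_le (partialSum f (x / d)) (partialSum f (v / d))
    rw [norm_sub_rev] at h3
    linarith
  -- the pointwise bound for the weight with which `‖S u‖` occurs after summing over `d`
  have hW : ∀ u ∈ Set.Ioc 1 (2 * x),
      ∑ d ∈ Finset.Ioc 0 N, vonMangoldt d * (d * (‖partialSum f u‖ * (I d).indicator 1 u)) ≤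
      4 * C * x ^ 2 * (δ * (‖partialSum f u‖ / u ^ 2) +
        (Set.Ioc (x * Real.exp (-(1 / δ))) x).indicator (fun u => 1 / u) u) := by
    intro u hu
    have hu0 : 0 < u := by linarith [hu.1]
    have hSu := norm_partialSum_le hf hu0.le
    have hind0 : 0 ≤ (Set.Ioc (x * Real.exp (-(1 / δ))) x).indicator (fun u => 1 / u) u := by
      refine Set.indicator_nonneg (fun v hv => ?_) u
      have : 0 < x * Real.exp (-(1 / δ)) := by positivity
      have := hv.1
      have : 0 < v := by linarith
      positivity
    have hiff : ∀ d ∈ Finset.Ioc 0 N, u ∈ I d ↔ d ∈ Finset.Ioc ⌊x / u⌋₊ ⌊x / u + δ * (x / u)⌋₊ := by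
      intro d hd
      have hd0 : (0:ℝ) < d := by exact_mod_cast (hmem d hd).1
      rw [Finset.mem_Ioc, Nat.floor_lt (by positivity), Nat.le_floor_iff (by positivity), hI]
      simp only [Set.mem_Ioc]
      rw [div_lt_iff₀ hd0, div_lt_iff₀ hu0, le_div_iff₀ hd0, mul_comm u,
        show x / u + δ * (x / u) = x * (1 + δ) / u by ring, le_div_iff₀ hu0]
    by_cases hux : u ≤ x
    · have hy : 1 ≤ x / u := by rwa [le_div_iff₀ hu0, one_mul]
      have hy0 : 0 < x / u := by linarith
      have hly := Real.log_nonneg hy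
      have hH := H (x / u) (δ * (x / u)) hy (by positivity) (by nlinarith)
      have hψ : Chebyshev.psi (x / u + δ * (x / u)) - Chebyshev.psi (x / u) =
          ∑ n ∈ Finset.Ioc ⌊x / u⌋₊ ⌊x / u + δ * (x / u)⌋₊, vonMangoldt n := by
        rw [Chebyshev.psi, Chebyshev.psi, sub_eq_iff_eq_add', Finset.sum_Ioc_consecutive _ (Nat.zero_le _)
          (Nat.floor_mono (by nlinarith))]
      have h1 : ∑ d ∈ Finset.Ioc 0 N, vonMangoldt d * (d * (‖partialSum f u‖ * (I d).indicator 1 u)) ≤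
          2 * (x / u) * ‖partialSum f u‖ *
            ∑ n ∈ Finset.Ioc ⌊x / u⌋₊ ⌊x / u + δ * (x / u)⌋₊, vonMangoldt n := by
        rw [Finset.mul_sum]
        calc _ ≤ ∑ d ∈ Finset.Ioc 0 N with d ∈ Finset.Ioc ⌊x / u⌋₊ ⌊x / u + δ * (x / u)⌋₊,
              2 * (x / u) * ‖partialSum f u‖ * vonMangoldt d := by
              rw [Finset.sum_filter]
              refine Finset.sum_le_sum fun d hd => ?_
              by_cases h : u ∈ I d
              · rw [if_pos ((hiff d hd).mp h), Set.indicator_of_mem h, Pi.one_apply, mul_one]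
                have hd2 := (Finset.mem_Ioc.mp ((hiff d hd).mp h)).2
                rw [Nat.le_floor_iff (by positivity)] at hd2
                have hd3 : (d:ℝ) ≤ 2 * (x / u) := by nlinarith
                calc vonMangoldt d * (d * ‖partialSum f u‖)
                    ≤ vonMangoldt d * (2 * (x / u) * ‖partialSum f u‖) :=
                      mul_le_mul_of_nonneg_left (by gcongr) vonMangoldt_nonneg
                  _ = _ := by ring
              · rw [if_neg (fun h' => h ((hiff d hd).mpr h')), Set.indicator_of_notMem h]
                simp
          _ ≤ _ := by
              refine Finset.sum_le_sum_of_subset_of_nonneg (fun d hd => (Finset.mem_filter.mp hd).2)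
                fun d _ _ => mul_nonneg (by positivity) vonMangoldt_nonneg
      rw [← hψ] at h1
      refine h1.trans ?_
      have h2 : 2 * (x / u) * ‖partialSum f u‖ *
          (Chebyshev.psi (x / u + δ * (x / u)) - Chebyshev.psi (x / u)) ≤
          2 * C * x ^ 2 * (‖partialSum f u‖ / u ^ 2 * (δ + 1 / (1 + Real.log (x / u)))) := by
        calc _ ≤ 2 * (x / u) * ‖partialSum f u‖ * (C * (δ * (x / u) + x / u / (1 + Real.log (x / u)))) := by
              gcongr
          _ = _ := by field_simp
      refine h2.trans ?_
      have h3 : ‖partialSum f u‖ / u ^ 2 * (δ + 1 / (1 + Real.log (x / u))) ≤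
          2 * (δ * (‖partialSum f u‖ / u ^ 2) +
            (Set.Ioc (x * Real.exp (-(1 / δ))) x).indicator (fun u => 1 / u) u) := by
        have hS0 : 0 ≤ ‖partialSum f u‖ / u ^ 2 := by positivity
        by_cases hc : 1 / δ ≤ Real.log (x / u)
        · have : 1 / (1 + Real.log (x / u)) ≤ δ := by
            rw [div_le_iff₀ (by positivity)]
            rw [div_le_iff₀ hδ] at hc
            nlinarith
          nlinarith
        · have hmem : u ∈ Set.Ioc (x * Real.exp (-(1 / δ))) x := by
            refine ⟨?_, hux⟩
            push Not at hc
            rw [Real.log_lt_iff_lt_exp hy0, div_lt_iff₀ hu0] at hc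
            rw [Real.exp_neg, ← div_eq_mul_inv, div_lt_iff₀ (Real.exp_pos _)]
            linarith
          rw [Set.indicator_of_mem hmem]
          have h5 : ‖partialSum f u‖ / u ^ 2 ≤ 1 / u := by
            rw [div_le_div_iff₀ (by positivity) hu0]; nlinarith
          have h6 : 1 / (1 + Real.log (x / u)) ≤ 1 := by
            rw [div_le_one (by positivity)]; linarith
          have h7 : 0 < 1 / u := by positivity
          nlinarith
      calc 2 * C * x ^ 2 * (‖partialSum f u‖ / u ^ 2 * (δ + 1 / (1 + Real.log (x / u))))
          ≤ 2 * C * x ^ 2 * (2 * (δ * (‖partialSum f u‖ / u ^ 2) +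
            (Set.Ioc (x * Real.exp (-(1 / δ))) x).indicator (fun u => 1 / u) u)) := by gcongr
        _ = _ := by ring
    · -- for `u > x` only `d = 1` could occur, where the von Mangoldt function vanishes
      have hz : ∑ d ∈ Finset.Ioc 0 N, vonMangoldt d * (d * (‖partialSum f u‖ * (I d).indicator 1 u)) = 0 := by
        refine Finset.sum_eq_zero fun d hd => ?_
        by_cases h : u ∈ I d
        · have hd2 := (Finset.mem_Ioc.mp ((hiff d hd).mp h)).2
          have hxu : x / u < 1 := by rw [div_lt_one hu0]; linarith
          have hxu0 : 0 < x / u := by positivity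
          have : ⌊x / u + δ * (x / u)⌋₊ < 2 := by
            rw [Nat.floor_lt (by positivity)]; push_cast; nlinarith
          have hd1 : d = 1 := by have := (hmem d hd).1; omega
          simp [hd1]
        · simp [Set.indicator_of_notMem h]
      rw [hz]
      positivity
  have hlogint : ∫ u in Set.Ioc 1 (2 * x), (Set.Ioc (x * Real.exp (-(1 / δ))) x).indicator (fun u => 1 / u) u
      ≤ 1 / δ := by
    have hlow : 0 < x * Real.exp (-(1 / δ)) := by positivity
    have hle : x * Real.exp (-(1 / δ)) ≤ x := by
      have : Real.exp (-(1 / δ)) ≤ 1 := Real.exp_le_one_iff.mpr (by simp; positivity)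
      nlinarith
    have hio : IntegrableOn (fun u : ℝ => 1 / u) (Set.Ioc (x * Real.exp (-(1 / δ))) x) := by
      rw [← intervalIntegrable_iff_integrableOn_Ioc_of_le hle]
      refine intervalIntegral.intervalIntegrable_one_div (fun u hu => ?_) continuousOn_id
      rw [Set.uIcc_of_le hle] at hu
      exact (hlow.trans_le hu.1).ne'
    calc _ ≤ ∫ u, (Set.Ioc (x * Real.exp (-(1 / δ))) x).indicator (fun u => 1 / u) u := by
          refine setIntegral_le_integral (hio.integrable_indicator measurableSet_Ioc) (ae_of_all _ fun u => ?_)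
          refine Set.indicator_nonneg (fun v hv => ?_) u
          exact (one_div_pos.mpr (hlow.trans hv.1)).le
      _ = ∫ u in (x * Real.exp (-(1 / δ)))..x, 1 / u := by
          rw [integral_indicator measurableSet_Ioc, intervalIntegral.integral_of_le hle]
      _ = 1 / δ := by
          rw [integral_one_div_of_pos hlow hx0, Real.exp_neg, ← div_eq_mul_inv, div_div_cancel₀ hx0.ne',
            Real.log_exp]
  have hJint : IntegrableOn (fun u => ‖partialSum f u‖ / u ^ 2) (Set.Ioc 1 (2 * x)) := by
    refine integrableOn_norm_partialSum_mul hf (φ := fun u => (u ^ 2)⁻¹) zero_le_one ?_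
    refine (ContinuousOn.integrableOn_Icc ?_).mono_set Set.Ioc_subset_Icc_self
    refine ContinuousOn.inv₀ (by fun_prop) fun u hu => ?_
    have := hu.1
    positivity
  have hindint : IntegrableOn ((Set.Ioc (x * Real.exp (-(1 / δ))) x).indicator (fun u => 1 / u)) (Set.Ioc 1 (2 * x)) := by
    refine Integrable.indicator ?_ measurableSet_Ioc
    refine (ContinuousOn.integrableOn_Icc ?_).mono_set Set.Ioc_subset_Icc_self
    refine ContinuousOn.div₀ (by fun_prop) (by fun_prop) fun u hu => ?_
    have := hu.1
    linarith
  have hmain : ∑ d ∈ Finset.Ioc 0 N, vonMangoldt d *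
      (d * ∫ u in Set.Ioc 1 (2 * x), ‖partialSum f u‖ * (I d).indicator 1 u) ≤
      4 * C * x ^ 2 * (δ * J + 1 / δ) := by
    have e : ∑ d ∈ Finset.Ioc 0 N, vonMangoldt d *
        (d * ∫ u in Set.Ioc 1 (2 * x), ‖partialSum f u‖ * (I d).indicator 1 u) =
        ∫ u in Set.Ioc 1 (2 * x), ∑ d ∈ Finset.Ioc 0 N, vonMangoldt d *
          (d * (‖partialSum f u‖ * (I d).indicator 1 u)) := by
      rw [integral_finsetSum _ fun d _ => ((hint d).const_mul _).const_mul _]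
      simp_rw [integral_const_mul]
    rw [e]
    refine (setIntegral_mono_on (integrable_finsetSum _ fun d _ => ((hint d).const_mul _).const_mul _)
      (((hJint.const_mul δ).add hindint).const_mul _) measurableSet_Ioc hW).trans ?_
    rw [integral_const_mul, integral_add' (hJint.const_mul δ) hindint, integral_const_mul]
    gcongr
  have hS1 : ‖partialSum (fun n => f n * Real.log n) x‖ ≤
      ∑ d ∈ Finset.Ioc 0 N, vonMangoldt d * ‖partialSum f (x / d)‖ := by
    rw [partialSum_mul_log_eq]
    refine norm_sum_le_of_le _ fun d _ => ?_
    rw [norm_mul, norm_mul, Complex.norm_real, Real.norm_of_nonneg vonMangoldt_nonneg]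
    gcongr
    exact mul_le_of_le_one_left vonMangoldt_nonneg (hf d)
  have hMert := sum_vonMangoldt_div_le hx
  have hCheb := Chebyshev.psi_le_const_mul_self hx0.le
  rw [Chebyshev.psi] at hCheb
  have hlog4 : Real.log 4 ≤ 3 := by
    have := Real.log_le_sub_one_of_pos (x := 4) (by norm_num); linarith
  have hδx : 0 < δ * x := by positivity
  have h1 : δ * x * ‖partialSum (fun n => f n * Real.log n) x‖ ≤
      4 * C * x ^ 2 * (δ * J + 1 / δ) + δ * x * (δ * x * (Real.log x + 7) + 7 * x) := by
    calc δ * x * ‖partialSum (fun n => f n * Real.log n) x‖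
        ≤ δ * x * ∑ d ∈ Finset.Ioc 0 N, vonMangoldt d * ‖partialSum f (x / d)‖ := by gcongr
      _ = ∑ d ∈ Finset.Ioc 0 N, vonMangoldt d * (δ * x * ‖partialSum f (x / d)‖) := by
          rw [Finset.mul_sum]; refine Finset.sum_congr rfl fun d _ => by ring
      _ ≤ ∑ d ∈ Finset.Ioc 0 N, vonMangoldt d *
          (d * (∫ u in Set.Ioc 1 (2 * x), ‖partialSum f u‖ * (I d).indicator 1 u) +
            δ * x * (δ * x * (1 / d) + 1)) :=
          Finset.sum_le_sum fun d hd => mul_le_mul_of_nonneg_left (havg d hd) vonMangoldt_nonneg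
      _ = ∑ d ∈ Finset.Ioc 0 N, vonMangoldt d *
            (d * ∫ u in Set.Ioc 1 (2 * x), ‖partialSum f u‖ * (I d).indicator 1 u) +
          δ * x * (δ * x * ∑ d ∈ Finset.Ioc 0 N, vonMangoldt d / d + ∑ d ∈ Finset.Ioc 0 N, vonMangoldt d) := by
          rw [Finset.mul_sum, ← Finset.sum_add_distrib, Finset.mul_sum, ← Finset.sum_add_distrib]
          refine Finset.sum_congr rfl fun d _ => by ring
      _ ≤ _ := by
          gcongr
          · linarith
          · refine hCheb.trans ?_
            gcongr; linarith
  have h2 := norm_partialSum_mul_log_le hf hx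
  have h3 : ‖partialSum (fun n => f n * Real.log n) x‖ ≤
      4 * C * (x * J + x / δ ^ 2) + (δ * x * (Real.log x + 7) + 7 * x) := by
    refine le_of_mul_le_mul_left (h1.trans (le_of_eq ?_)) hδx
    field_simp
  have h4 : x ≤ x / δ ^ 2 := by
    rw [le_div_iff₀ (by positivity)]
    have : δ ^ 2 ≤ 1 := pow_le_one₀ hδ.le hδ1
    nlinarith
  have h5 : δ * x ≤ x := by nlinarith
  have h6 : 0 ≤ x * J := by positivity
  have h7 : 0 ≤ δ * x * Real.log x := by positivity
  nlinarith [mul_nonneg hC.le h7]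

/-! ### Dirichlet series near the line `Re s = 1` -/

/-- The Riemann zeta function on the real half-line `σ > 1`, as a sum. -/
noncomputable def zetaSum (σ : ℝ) : ℝ := ∑' n : ℕ, (n:ℝ) ^ (-σ)

theorem summable_zetaSum {σ : ℝ} (hσ : 1 < σ) : Summable fun n : ℕ => (n:ℝ) ^ (-σ) :=
  Real.summable_nat_rpow.mpr (by linarith)

open MeasureTheory in
theorem zetaSum_bounds {σ : ℝ} (hσ : 1 < σ) : 1 / (σ - 1) ≤ zetaSum σ ∧ zetaSum σ ≤ σ / (σ - 1) := by
  have hO : (fun n : ℕ ↦ ∑ k ∈ Finset.Icc 1 n, ‖(1:ℂ)‖) =O[Filter.atTop] fun n ↦ (n:ℝ) ^ (1:ℝ) := by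
    refine Asymptotics.IsBigO.of_bound 1 (Filter.Eventually.of_forall fun n => ?_)
    simp
  have h1 := LSeries_eq_mul_integral' (fun _ => 1) zero_le_one (s := (σ:ℂ)) (by simpa using hσ) hO
  have h2 : LSeries (fun _ => 1) (σ:ℂ) = (zetaSum σ : ℂ) := by
    rw [LSeries, zetaSum, Complex.ofReal_tsum]
    refine tsum_congr fun n => ?_
    rcases eq_or_ne n 0 with rfl | hn
    · simp [LSeries.term_zero, Real.zero_rpow (by linarith : -σ ≠ 0)]
    · rw [LSeries.term_of_ne_zero hn, Complex.ofReal_cpow (by positivity)]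
      push_cast
      rw [Complex.cpow_neg, one_div]
  have h3 : ∫ t in Set.Ioi (1 : ℝ), (∑ k ∈ Finset.Icc 1 ⌊t⌋₊, (1:ℂ)) * (t:ℂ) ^ (-((σ:ℂ) + 1)) =
      ((∫ t in Set.Ioi (1 : ℝ), (⌊t⌋₊ : ℝ) * t ^ (-(σ + 1)) : ℝ) : ℂ) := by
    refine Eq.trans (setIntegral_congr_fun measurableSet_Ioi fun t ht => ?_) integral_complex_ofReal
    have : (0:ℝ) ≤ t := le_trans zero_le_one (le_of_lt ht)
    simp only [Finset.sum_const, Nat.card_Icc, add_tsub_cancel_right, nsmul_eq_mul, mul_one]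
    push_cast
    rw [Complex.ofReal_cpow this]
    push_cast
    rfl
  rw [h2, h3, ← Complex.ofReal_mul, Complex.ofReal_inj] at h1
  have e1 : ∫ t in Set.Ioi (1:ℝ), t ^ (-σ) = 1 / (σ - 1) := by
    rw [integral_Ioi_rpow_of_lt (by linarith) zero_lt_one, Real.one_rpow, neg_div,
      show -σ + 1 = -(σ - 1) by ring, div_neg, neg_neg]
  have e2 : ∫ t in Set.Ioi (1:ℝ), t ^ (-(σ + 1)) = 1 / σ := by
    rw [integral_Ioi_rpow_of_lt (by linarith) zero_lt_one, Real.one_rpow, neg_div,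
      show -(σ + 1) + 1 = -σ by ring, div_neg, neg_neg]
  have i1 : IntegrableOn (fun t : ℝ => t ^ (-σ)) (Set.Ioi 1) := integrableOn_Ioi_rpow_of_lt (by linarith) zero_lt_one
  have i2 : IntegrableOn (fun t : ℝ => t ^ (-(σ + 1))) (Set.Ioi 1) :=
    integrableOn_Ioi_rpow_of_lt (by linarith) zero_lt_one
  have hpt : ∀ t ∈ Set.Ioi (1:ℝ), t ^ (-σ) - t ^ (-(σ + 1)) ≤ (⌊t⌋₊ : ℝ) * t ^ (-(σ + 1)) ∧
      (⌊t⌋₊ : ℝ) * t ^ (-(σ + 1)) ≤ t ^ (-σ) := by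
    intro t ht
    have ht0 : 0 < t := lt_trans zero_lt_one ht
    have : t ^ (-σ) = t * t ^ (-(σ + 1)) := by
      rw [show -σ = 1 + -(σ + 1) by ring, Real.rpow_add ht0, Real.rpow_one]
    have h0 : 0 < t ^ (-(σ + 1)) := by positivity
    have := Nat.floor_le ht0.le
    have := Nat.lt_floor_add_one t
    constructor <;> nlinarith
  have i3 : IntegrableOn (fun t : ℝ => (⌊t⌋₊ : ℝ) * t ^ (-(σ + 1))) (Set.Ioi 1) := by
    refine Integrable.mono' i1 ?_ ?_
    · exact (((measurable_from_top (f := fun n : ℕ => (n:ℝ))).comp Nat.measurable_floor).mul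
        (measurable_id.pow_const _)).aestronglyMeasurable
    · filter_upwards [ae_restrict_mem measurableSet_Ioi] with t ht
      have ht0 : 0 < t := lt_trans zero_lt_one ht
      rw [Real.norm_of_nonneg (by positivity)]
      exact (hpt t ht).2
  have l1 := setIntegral_mono_on (i1.sub i2) i3 measurableSet_Ioi fun t ht => (hpt t ht).1
  have l2 := setIntegral_mono_on i3 i1 measurableSet_Ioi fun t ht => (hpt t ht).2
  rw [integral_sub' i1 i2, e1, e2] at l1
  rw [e1] at l2
  have hσ0 : 0 < σ := by linarith
  rw [h1]
  constructor
  · calc 1 / (σ - 1) = σ * (1 / (σ - 1) - 1 / σ) := by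
          have : σ - 1 ≠ 0 := by linarith
          field_simp; ring
      _ ≤ _ := by gcongr
  · calc _ ≤ σ * (1 / (σ - 1)) := by gcongr
      _ = _ := by ring

/-- The trivial bound `|F(s)| ≤ ζ(Re s)`. -/
theorem norm_LSeries_le_zetaSum {f : ℕ → ℂ} (hf : ∀ n, ‖f n‖ ≤ 1) {s : ℂ} (hs : 1 < s.re) :
    ‖LSeries f s‖ ≤ zetaSum s.re := by
  refine tsum_of_norm_bounded (summable_zetaSum hs).hasSum fun n => ?_
  rw [LSeries.norm_term_eq]
  split_ifs with h
  · positivity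
  · rw [Real.rpow_neg (by positivity), ← one_div]
    gcongr
    exact hf n

open ArithmeticFunction in
theorem sum_norm_mul_vonMangoldt_mul_rpow_le {f : ℕ → ℂ} (hf : ∀ n, ‖f n‖ ≤ 1) {a : ℝ} (ha : 0 ≤ a)
    (n : ℕ) : ∑ k ∈ Finset.Icc 1 n, ‖f k * vonMangoldt k * ((k:ℝ) ^ a : ℝ)‖ ≤ 7 * (n:ℝ) ^ (a + 1) := by
  rcases Nat.eq_zero_or_pos n with rfl | hn
  · simp; positivity
  have hn0 : (0:ℝ) < n := by exact_mod_cast hn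
  have hψ : Chebyshev.psi n ≤ (Real.log 4 + 4) * n := Chebyshev.psi_le_const_mul_self (by positivity)
  rw [Chebyshev.psi, Nat.floor_natCast] at hψ
  have hlog4 : Real.log 4 ≤ 3 := by
    have := Real.log_le_sub_one_of_pos (x := 4) (by norm_num); linarith
  calc _ ≤ ∑ k ∈ Finset.Ioc 0 n, (n:ℝ) ^ a * vonMangoldt k := by
        change ∑ k ∈ Finset.Ioc 0 n, _ ≤ _
        refine Finset.sum_le_sum fun k hk => ?_
        have hkn : (k:ℝ) ≤ n := by exact_mod_cast (Finset.mem_Ioc.mp hk).2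
        rw [norm_mul, norm_mul, Complex.norm_real, Complex.norm_real, Real.norm_of_nonneg vonMangoldt_nonneg,
          Real.norm_of_nonneg (by positivity), mul_comm]
        have := mul_le_of_le_one_left (vonMangoldt_nonneg (n := k)) (hf k)
        gcongr
    _ = (n:ℝ) ^ a * ∑ k ∈ Finset.Ioc 0 n, vonMangoldt k := by rw [Finset.mul_sum]
    _ ≤ (n:ℝ) ^ a * (7 * n) := by
        gcongr; refine hψ.trans ?_; gcongr; linarith
    _ = _ := by rw [Real.rpow_add hn0, Real.rpow_one]; ring

open ArithmeticFunction LSeries.notation in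
/-- The identity `-F' = F * (-F' / F)`; the second factor is the Dirichlet series of `f Λ`. -/
theorem LSeries_mul_log_eq (f : ℕ →*₀ ℂ) (hf : ∀ n, ‖f n‖ ≤ 1) {s : ℂ} (hs : 1 < s.re) :
    LSeries (fun n => f n * Real.log n) s = LSeries f s * LSeries (fun n => f n * vonMangoldt n) s := by
  have h1 : LSeriesSummable f s := LSeriesSummable_of_bounded_of_one_lt_re (fun n _ => hf n) hs
  have h2 : LSeriesSummable (fun n => f n * vonMangoldt n) s := by
    refine LSeriesSummable_of_sum_norm_bigO (r := 1) ?_ zero_le_one hs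
    refine Asymptotics.IsBigO.of_bound 7 (Filter.Eventually.of_forall fun n => ?_)
    have := sum_norm_mul_vonMangoldt_mul_rpow_le hf le_rfl n
    simp only [Real.rpow_zero, Complex.ofReal_one, mul_one, zero_add] at this
    rw [Real.norm_of_nonneg (Finset.sum_nonneg fun _ _ => norm_nonneg _), Real.norm_of_nonneg (by positivity)]
    exact this
  rw [mul_comm, ← LSeries_convolution' h2 h1]
  congr 1
  ext n
  rw [LSeries.convolution_def]
  exact (sum_divisorsAntidiagonal_mul_vonMangoldt f n).symm

theorem tendsto_neg_inv_one_add_log :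
    Filter.Tendsto (fun u => -(1 + Real.log u)⁻¹) Filter.atTop (nhds 0) := by
  have := (tendsto_inv_atTop_zero.comp (Filter.tendsto_atTop_add_const_left _ 1 Real.tendsto_log_atTop)).neg
  simpa using this

theorem hasDerivAt_neg_inv_one_add_log {u : ℝ} (hu : 1 ≤ u) :
    HasDerivAt (fun u => -(1 + Real.log u)⁻¹) (u⁻¹ * (1 / (1 + Real.log u)) ^ 2) u := by
  have hl := Real.log_nonneg hu
  have := (((Real.hasDerivAt_log (by linarith : u ≠ 0)).const_add 1).inv (by linarith : 1 + Real.log u ≠ 0)).neg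
  refine this.congr_deriv ?_
  field_simp

open MeasureTheory in
theorem integral_inv_mul_one_add_log_sq :
    IntegrableOn (fun u : ℝ => u⁻¹ * (1 / (1 + Real.log u)) ^ 2) (Set.Ioi 1) ∧
    ∫ u in Set.Ioi (1:ℝ), u⁻¹ * (1 / (1 + Real.log u)) ^ 2 = 1 := by
  have hpos : ∀ u ∈ Set.Ioi (1:ℝ), 0 ≤ u⁻¹ * (1 / (1 + Real.log u)) ^ 2 := fun u hu => by
    have : (0:ℝ) < u := lt_trans zero_lt_one hu
    positivity
  refine ⟨integrableOn_Ioi_deriv_of_nonneg' (fun u hu => hasDerivAt_neg_inv_one_add_log hu) hpos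
    tendsto_neg_inv_one_add_log, ?_⟩
  rw [integral_Ioi_of_hasDerivAt_of_nonneg' (fun u hu => hasDerivAt_neg_inv_one_add_log hu) hpos
    tendsto_neg_inv_one_add_log]
  simp

open ArithmeticFunction MeasureTheory Real Complex in
/-- A mean square estimate for `F' / F` on a segment of length about `T` of the line
`Re s = 1 + 1 / L`: as long as `T ^ 2 ≤ L`, the total over `|t| ≤ T` is `O(L)`, with no loss in `T`. The weight
`1 / |T + i t|` arises from applying `mellin_plancherel` to `f(n) Λ(n) n ^ (T - σ)` on the line
`Re s = T`; there the partial sums only see a short range of prime powers. -/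
theorem exists_integral_norm_sq_LSeries_vonMangoldt_le :
    ∃ C : ℝ, 0 < C ∧ ∀ f : ℕ → ℂ, (∀ n, ‖f n‖ ≤ 1) → ∀ L T : ℝ, 1 ≤ L → 3 ≤ T → T ^ 2 ≤ L →
      Integrable (fun t : ℝ => ‖LSeries (fun n => f n * vonMangoldt n) ((1 + 1 / L : ℝ) + t * I) / (T + t * I)‖ ^ 2) ∧
      ∫ t : ℝ, ‖LSeries (fun n => f n * vonMangoldt n) ((1 + 1 / L : ℝ) + t * I) / (T + t * I)‖ ^ 2 ≤
        C * L / T ^ 2 := by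
  obtain ⟨C, hC, H⟩ := exists_sum_vonMangoldt_div_mul_rpow_le
  refine ⟨12 * π * C ^ 2, by positivity, fun f hf L T hL hT hTL => ?_⟩
  have hL0 : 0 < L := by linarith
  have hLi : 1 / L ≤ 1 := by rw [div_le_one hL0]; exact hL
  have hLi0 : 0 < 1 / L := by positivity
  set σ := 1 + 1 / L with hσ
  set b : ℕ → ℂ := fun n => f n * vonMangoldt n * ((n:ℝ) ^ (T - σ) : ℝ) with hb
  have hbs : ∀ n : ℕ, 1 ≤ n → ∑ k ∈ Finset.Icc 1 n, ‖b k‖ ≤ 7 * (n:ℝ) ^ (T - σ + 1) := fun n _ =>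
    sum_norm_mul_vonMangoldt_mul_rpow_le hf (by linarith) n
  obtain ⟨h1, h2, h3⟩ := mellin_plancherel (θ := T) (by linarith) (by linarith) hbs
  have hLS : ∀ t : ℝ, LSeries b (T + t * I) = LSeries (fun n => f n * vonMangoldt n) (σ + t * I) := by
    intro t
    refine tsum_congr fun n => ?_
    rcases eq_or_ne n 0 with rfl | hn
    · simp
    · have hn0 : (n:ℂ) ≠ 0 := by exact_mod_cast hn
      have e : (T + t * I : ℂ) = ((T - σ : ℝ) : ℂ) + (σ + t * I) := by push_cast; ring
      rw [LSeries.term_of_ne_zero hn, LSeries.term_of_ne_zero hn, hb, e, cpow_add _ _ hn0]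
      beta_reduce
      rw [ofReal_cpow (by positivity), ofReal_natCast]
      have : (n:ℂ) ^ ((T - σ : ℝ) : ℂ) ≠ 0 := by simp [cpow_eq_zero_iff, hn0]
      rw [mul_comm (f n * (vonMangoldt n : ℂ)), mul_div_mul_left _ _ this]
  simp_rw [hLS] at h1 h3
  refine ⟨h1, ?_⟩
  rw [h3]
  have hB : ∀ u ∈ Set.Ioi (1:ℝ), ‖partialSum b u‖ ^ 2 * u ^ (-(2 * T) - 1) ≤
      2 * C ^ 2 * (4 / T ^ 2 * u ^ (-(2 / L) - 1) + u⁻¹ * (1 / (1 + Real.log u)) ^ 2) := by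
    intro u hu
    have hu1 : (1:ℝ) ≤ u := le_of_lt hu
    have hu0 : 0 < u := by linarith
    have hl := Real.log_nonneg hu1
    have hT' : 2 ≤ T - 1 / L := by linarith
    have hs : ‖partialSum b u‖ ≤ u ^ (T - 1 / L) * (C * (1 / (T - 1 / L) + 1 / (1 + Real.log u))) := by
      refine le_trans ?_ (mul_le_mul_of_nonneg_left (H (T - 1 / L) u hT' hu1) (by positivity))
      rw [partialSum_eq_sum_Ioc, Finset.mul_sum]
      refine norm_sum_le_of_le _ fun k hk => ?_
      have hk0 : (0:ℝ) < k := by exact_mod_cast (Finset.mem_Ioc.mp hk).1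
      rw [hb, norm_mul, norm_mul, norm_real, norm_real, Real.norm_of_nonneg vonMangoldt_nonneg,
        Real.norm_of_nonneg (by positivity), Real.div_rpow hk0.le hu0.le]
      have e1 : (k:ℝ) ^ (T - σ) = k ^ (T - 1 / L) / k := by
        rw [← Real.rpow_sub_one hk0.ne']; congr 1; rw [hσ]; ring
      have e2 : u ^ (T - 1 / L) ≠ 0 := by positivity
      rw [e1]
      calc ‖f k‖ * vonMangoldt k * ((k:ℝ) ^ (T - 1 / L) / k)
          ≤ vonMangoldt k * ((k:ℝ) ^ (T - 1 / L) / k) :=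
            mul_le_mul_of_nonneg_right (mul_le_of_le_one_left vonMangoldt_nonneg (hf k)) (by positivity)
        _ = _ := by field_simp
    have h4 : 1 / (T - 1 / L) ≤ 2 / T := by
      rw [div_le_div_iff₀ (by linarith) (by linarith)]; linarith
    have h5 : ‖partialSum b u‖ ^ 2 ≤ (u ^ (T - 1 / L) * (C * (2 / T + 1 / (1 + Real.log u)))) ^ 2 := by
      refine pow_le_pow_left₀ (norm_nonneg _) (hs.trans ?_) 2
      gcongr
    have e3 : (u ^ (T - 1 / L)) ^ 2 * u ^ (-(2 * T) - 1) = u ^ (-(2 / L) - 1) := by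
      rw [← Real.rpow_natCast, ← Real.rpow_mul hu0.le, ← Real.rpow_add hu0]
      congr 1; push_cast; ring
    have e4 : u ^ (-(2 / L) - 1) ≤ u⁻¹ := by
      rw [← Real.rpow_neg_one]
      apply Real.rpow_le_rpow_of_exponent_le hu1
      have : 0 ≤ 2 / L := by positivity
      linarith
    have e5 : (2 / T + 1 / (1 + Real.log u)) ^ 2 ≤ 2 * (4 / T ^ 2 + (1 / (1 + Real.log u)) ^ 2) := by
      have : 4 / T ^ 2 = (2 / T) ^ 2 := by rw [div_pow]; norm_num
      rw [this]; nlinarith [sq_nonneg (2 / T - 1 / (1 + Real.log u))]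
    calc ‖partialSum b u‖ ^ 2 * u ^ (-(2 * T) - 1)
        ≤ (u ^ (T - 1 / L) * (C * (2 / T + 1 / (1 + Real.log u)))) ^ 2 * u ^ (-(2 * T) - 1) := by gcongr
      _ = C ^ 2 * (2 / T + 1 / (1 + Real.log u)) ^ 2 * ((u ^ (T - 1 / L)) ^ 2 * u ^ (-(2 * T) - 1)) := by ring
      _ = C ^ 2 * (2 / T + 1 / (1 + Real.log u)) ^ 2 * u ^ (-(2 / L) - 1) := by rw [e3]
      _ ≤ C ^ 2 * (2 * (4 / T ^ 2 + (1 / (1 + Real.log u)) ^ 2)) * u ^ (-(2 / L) - 1) := by gcongr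
      _ = 2 * C ^ 2 * (4 / T ^ 2 * u ^ (-(2 / L) - 1) + u ^ (-(2 / L) - 1) * (1 / (1 + Real.log u)) ^ 2) := by ring
      _ ≤ _ := by gcongr
  have h2L : 0 < 2 / L := by positivity
  have i1 : IntegrableOn (fun u : ℝ => u ^ (-(2 / L) - 1)) (Set.Ioi 1) :=
    integrableOn_Ioi_rpow_of_lt (by linarith) zero_lt_one
  have e1 : ∫ u in Set.Ioi (1:ℝ), u ^ (-(2 / L) - 1) = L / 2 := by
    rw [integral_Ioi_rpow_of_lt (by linarith) zero_lt_one, Real.one_rpow]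
    field_simp; ring
  obtain ⟨i2, e2⟩ := integral_inv_mul_one_add_log_sq
  have hle := setIntegral_mono_on h2 (((i1.const_mul (4 / T ^ 2)).add i2).const_mul (2 * C ^ 2)) measurableSet_Ioi hB
  rw [integral_const_mul, integral_add' (i1.const_mul _) i2, integral_const_mul, e1, e2] at hle
  have h6 : 1 ≤ L / T ^ 2 := by rw [le_div_iff₀ (by positivity)]; linarith
  calc _ ≤ 2 * π * (2 * C ^ 2 * (4 / T ^ 2 * (L / 2) + 1)) := by gcongr
    _ = 2 * π * (2 * C ^ 2 * (2 * (L / T ^ 2) + 1)) := by ring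
    _ ≤ 2 * π * (2 * C ^ 2 * (2 * (L / T ^ 2) + L / T ^ 2)) := by gcongr
    _ = _ := by ring

open ArithmeticFunction MeasureTheory Real Complex in
/-- If `F(s) / s` is nowhere larger than `m L` on the line `Re s = 1 + 1 / L`, then the partial sums
of `f log` are small in mean square. By Plancherel this is a statement on `F' / s = F / s * F' / F`. The
factor `F` is bounded by `m L |s|` for `|t| ≤ 1 / m` and trivially by `2 L` beyond, and `F' / F` is controlled
in mean square. -/
theorem exists_integral_norm_sq_partialSum_mul_log_le :
    ∃ C : ℝ, 0 < C ∧ ∀ f : ℕ →*₀ ℂ, (∀ n, ‖f n‖ ≤ 1) → ∀ L m : ℝ, 1 ≤ L → 0 < m → m ≤ 1 / 3 →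
      1 ≤ m ^ 2 * L →
      (∀ t : ℝ, ‖LSeries f ((1 + 1 / L : ℝ) + t * I)‖ ≤ m * L * ‖((1 + 1 / L : ℝ) : ℂ) + t * I‖) →
      IntegrableOn (fun u : ℝ => ‖partialSum (fun n => f n * Real.log n) u‖ ^ 2 *
        u ^ (-(2 * (1 + 1 / L)) - 1)) (Set.Ioi 1) ∧
      ∫ u in Set.Ioi (1:ℝ), ‖partialSum (fun n => f n * Real.log n) u‖ ^ 2 *
        u ^ (-(2 * (1 + 1 / L)) - 1) ≤ C * m ^ 2 * L ^ 3 := by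
  obtain ⟨C, hC, H⟩ := exists_integral_norm_sq_LSeries_vonMangoldt_le
  refine ⟨C, hC, fun f hf L m hL hm hm3 hmL hF => ?_⟩
  have hL0 : 0 < L := by linarith
  have hLi0 : 0 < 1 / L := by positivity
  set σ := 1 + 1 / L with hσ
  have hσ1 : 1 < σ := by linarith
  -- Mellin–Plancherel for `f log`
  have hbs : ∀ n : ℕ, 1 ≤ n → ∑ k ∈ Finset.Icc 1 n, ‖f k * (Real.log k : ℂ)‖ ≤
      2 * L * (n:ℝ) ^ (1 + 1 / (2 * L)) := by
    intro n hn
    have hn1 : (1:ℝ) ≤ n := by exact_mod_cast hn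
    have hlog : Real.log n ≤ 2 * L * (n:ℝ) ^ (1 / (2 * L)) := by
      have := Real.log_le_rpow_div (x := n) (by positivity) (ε := 1 / (2 * L)) (by positivity)
      rwa [div_div_eq_mul_div, div_one, mul_comm] at this
    calc ∑ k ∈ Finset.Icc 1 n, ‖f k * (Real.log k : ℂ)‖ ≤ ∑ k ∈ Finset.Icc 1 n, Real.log n := by
          refine Finset.sum_le_sum fun k hk => ?_
          obtain ⟨ha, hb⟩ := Finset.mem_Icc.mp hk
          have hk1 : (1:ℝ) ≤ k := by exact_mod_cast ha
          have hlk := Real.log_nonneg hk1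
          rw [norm_mul, norm_real, Real.norm_of_nonneg hlk]
          refine (mul_le_of_le_one_left hlk (hf k)).trans (Real.log_le_log (by linarith) (by exact_mod_cast hb))
      _ = n * Real.log n := by simp
      _ ≤ n * (2 * L * (n:ℝ) ^ (1 / (2 * L))) := by gcongr
      _ = _ := by rw [Real.rpow_add (by linarith), Real.rpow_one]; ring
  have hr : 1 + 1 / (2 * L) < σ := by
    have : 1 / (2 * L) < 1 / L := one_div_lt_one_div_of_lt hL0 (by linarith)
    linarith
  obtain ⟨h1, h2, h3⟩ := mellin_plancherel (by positivity) hr hbs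
  refine ⟨h2, ?_⟩
  -- the mean square of the logarithmic derivative, with `T = 1 / m`
  have hmT : 3 ≤ 1 / m := by
    rw [le_div_iff₀ hm]; linarith
  obtain ⟨g1, g2⟩ := H f hf L (1 / m) hL hmT (by
    rw [div_pow, one_pow, div_le_iff₀ (by positivity)]; linarith)
  have hpt : ∀ t : ℝ, ‖LSeries (fun n => f n * (Real.log n : ℂ)) (σ + t * I) / (σ + t * I)‖ ^ 2 ≤
      5 * L ^ 2 * ‖LSeries (fun n => f n * vonMangoldt n) (σ + t * I) / ((1 / m : ℝ) + t * I)‖ ^ 2 := by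
    intro t
    have hs : 1 < (σ + t * I : ℂ).re := by simpa using hσ1
    rw [LSeries_mul_log_eq f hf hs]
    have hF1 := hF t
    have hF2 : ‖LSeries f (σ + t * I)‖ ≤ 2 * L := by
      refine (norm_LSeries_le_zetaSum hf hs).trans ?_
      have : (σ + t * I : ℂ).re = σ := by simp
      rw [this]
      refine (zetaSum_bounds hσ1).2.trans ?_
      rw [hσ, add_sub_cancel_left, div_div_eq_mul_div, div_one, add_mul, one_div_mul_cancel hL0.ne']
      linarith
    have hn : ∀ a : ℝ, ‖(a : ℂ) + t * I‖ ^ 2 = a ^ 2 + t ^ 2 := by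
      intro a
      rw [← normSq_eq_norm_sq, normSq_add_mul_I]
    have hs0 : 0 < ‖(σ:ℂ) + t * I‖ ^ 2 := by rw [hn]; positivity
    have hT0 : 0 < ‖((1 / m : ℝ):ℂ) + t * I‖ ^ 2 := by rw [hn]; positivity
    have hkey : ‖LSeries f (σ + t * I)‖ ^ 2 * ‖((1 / m : ℝ):ℂ) + t * I‖ ^ 2 ≤
        5 * L ^ 2 * ‖(σ:ℂ) + t * I‖ ^ 2 := by
      have a1 : ‖LSeries f (σ + t * I)‖ ^ 2 ≤ (m * L * ‖(σ:ℂ) + t * I‖) ^ 2 :=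
        pow_le_pow_left₀ (norm_nonneg _) hF1 2
      have a2 : ‖LSeries f (σ + t * I)‖ ^ 2 ≤ (2 * L) ^ 2 := pow_le_pow_left₀ (norm_nonneg _) hF2 2
      rw [hn (1 / m)]
      have a3 : ‖LSeries f (σ + t * I)‖ ^ 2 * t ^ 2 ≤ (2 * L) ^ 2 * ‖(σ:ℂ) + t * I‖ ^ 2 := by
        rw [hn σ]
        gcongr
        nlinarith
      have a4 : ‖LSeries f (σ + t * I)‖ ^ 2 * (1 / m) ^ 2 ≤ L ^ 2 * ‖(σ:ℂ) + t * I‖ ^ 2 := by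
        calc _ ≤ (m * L * ‖(σ:ℂ) + t * I‖) ^ 2 * (1 / m) ^ 2 := by gcongr
          _ = _ := by field_simp
      nlinarith
    rw [norm_div, norm_div, div_pow, div_pow, norm_mul, mul_pow, ← mul_div_assoc,
      div_le_div_iff₀ hs0 hT0]
    have := mul_le_mul_of_nonneg_right hkey (sq_nonneg ‖LSeries (fun n => f n * (vonMangoldt n : ℂ)) (σ + t * I)‖)
    linarith
  have h4 := integral_mono h1 (g1.const_mul (5 * L ^ 2)) hpt
  rw [integral_const_mul, h3] at h4
  have h5 : 2 * π * ∫ u in Set.Ioi (1:ℝ), ‖partialSum (fun n => f n * Real.log n) u‖ ^ 2 *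
      u ^ (-(2 * σ) - 1) ≤ 5 * L ^ 2 * (C * L / (1 / m) ^ 2) := h4.trans (by gcongr)
  have h6 : 5 * L ^ 2 * (C * L / (1 / m) ^ 2) = 5 * (C * m ^ 2 * L ^ 3) := by field_simp
  rw [h6] at h5
  have hpi := Real.pi_gt_three
  have h7 : 0 < C * m ^ 2 * L ^ 3 := by positivity
  by_contra hcon
  push Not at hcon
  nlinarith

/-! ### Halász's theorem -/

open MeasureTheory in
theorem integral_inv_mul_log_sq_Ioi {w : ℝ} (hw : 1 < w) :
    IntegrableOn (fun u : ℝ => u⁻¹ * (1 / Real.log u) ^ 2) (Set.Ioi w) ∧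
    ∫ u in Set.Ioi w, u⁻¹ * (1 / Real.log u) ^ 2 = 1 / Real.log w := by
  have hderiv : ∀ u ∈ Set.Ici w, HasDerivAt (fun u => -(Real.log u)⁻¹) (u⁻¹ * (1 / Real.log u) ^ 2) u := by
    intro u hu
    have hu1 : 1 < u := lt_of_lt_of_le hw hu
    have hl := Real.log_pos hu1
    refine (((Real.hasDerivAt_log (by linarith : u ≠ 0)).inv hl.ne').neg).congr_deriv ?_
    field_simp
  have hpos : ∀ u ∈ Set.Ioi w, 0 ≤ u⁻¹ * (1 / Real.log u) ^ 2 := fun u hu => by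
    have : (0:ℝ) < u := by linarith [Set.mem_Ioi.mp hu]
    positivity
  have htend : Filter.Tendsto (fun u => -(Real.log u)⁻¹) Filter.atTop (nhds 0) := by
    simpa using (tendsto_inv_atTop_zero.comp Real.tendsto_log_atTop).neg
  refine ⟨integrableOn_Ioi_deriv_of_nonneg' hderiv hpos htend, ?_⟩
  rw [integral_Ioi_of_hasDerivAt_of_nonneg' hderiv hpos htend]
  simp

open MeasureTheory in
theorem integrableOn_one_div_Ioc {a b : ℝ} (ha : 0 < a) : IntegrableOn (fun u : ℝ => 1 / u) (Set.Ioc a b) := by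
  refine (ContinuousOn.integrableOn_Icc ?_).mono_set Set.Ioc_subset_Icc_self
  refine ContinuousOn.div₀ (by fun_prop) (by fun_prop) fun u hu => ?_
  have := hu.1
  linarith

open MeasureTheory in
theorem integral_one_div_Ioc {a b : ℝ} (ha : 0 < a) (hab : a ≤ b) :
    ∫ u in Set.Ioc a b, 1 / u = Real.log (b / a) := by
  rw [← intervalIntegral.integral_of_le hab, integral_one_div_of_pos ha (by linarith)]

/-- The inequality `a * b ≤ (l * a ^ 2 + b ^ 2 / l) / 2` in the shape used for `∫ ‖S(u)‖ / u ^ 2`; the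
variable `v` stands for `log u`. -/
theorem div_sq_mul_le_add {u v l : ℝ} (hu : 0 < u) (hv : 0 < v) (hl : 0 < l) (a : ℝ) :
    a / (u ^ 2 * v) ≤ l / 2 * (a ^ 2 * (u ^ 3)⁻¹) + 1 / (2 * l) * (u⁻¹ * (1 / v) ^ 2) := by
  have h : l / 2 * (a ^ 2 * (u ^ 3)⁻¹) + 1 / (2 * l) * (u⁻¹ * (1 / v) ^ 2) - a / (u ^ 2 * v) =
      1 / (2 * l * u) * (l * a / u - 1 / v) ^ 2 := by
    field_simp; ring
  have : 0 ≤ 1 / (2 * l * u) * (l * a / u - 1 / v) ^ 2 := by positivity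
  linarith

theorem inv_cube_le_exp_mul_rpow {u L : ℝ} (hu : 0 < u) (hL : 0 < L) (h : Real.log u ≤ 2 * L) :
    (u ^ 3)⁻¹ ≤ Real.exp 4 * u ^ (-(2 * (1 + 1 / L)) - 1) := by
  have c1 : u ^ (-(2 * (1 + 1 / L)) - 1) = (u ^ 3)⁻¹ * u ^ (-(2 / L)) := by
    rw [← Real.rpow_natCast, ← Real.rpow_neg hu.le, ← Real.rpow_add hu]
    congr 1; push_cast; ring
  have c2 : u ^ (-(2 / L)) = Real.exp (-(2 / L * Real.log u)) := by
    rw [Real.rpow_def_of_pos hu]; congr 1; ring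
  have c3 : 2 / L * Real.log u ≤ 4 := by
    rw [div_mul_eq_mul_div, div_le_iff₀ hL]; linarith
  have c4 : 1 ≤ Real.exp 4 * u ^ (-(2 / L)) := by
    rw [c2, ← Real.exp_add]; exact Real.one_le_exp (by linarith)
  rw [c1]
  have : 0 < (u ^ 3)⁻¹ := by positivity
  nlinarith

open MeasureTheory in
/-- A Cauchy–Schwarz step, carried out pointwise: the logarithmic mean of `‖S(u)‖ / u` is controlled by
a weighted mean square of the partial sums of `f log`. -/
theorem integral_norm_partialSum_div_sq_le {f : ℕ → ℂ} (hf : ∀ n, ‖f n‖ ≤ 1) {L κ B : ℝ} (hL : 1 ≤ L)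
    (hκ : 0 < κ) (hκ1 : κ ≤ 1)
    (hi : IntegrableOn (fun u : ℝ => ‖partialSum (fun n => f n * Real.log n) u‖ ^ 2 *
        u ^ (-(2 * (1 + 1 / L)) - 1)) (Set.Ioi 1))
    (hB : ∫ u in Set.Ioi (1:ℝ), ‖partialSum (fun n => f n * Real.log n) u‖ ^ 2 *
        u ^ (-(2 * (1 + 1 / L)) - 1) ≤ B * L ^ 3) :
    ∫ u in Set.Ioc 1 (2 * Real.exp L), ‖partialSum f u‖ / u ^ 2 ≤
      κ * L + Real.exp 4 * B * L / (2 * κ ^ 2) + κ * L / 2 + 2 / κ := by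
  have hL0 : 0 < L := by linarith
  set x := Real.exp L with hx
  have hx1 : 1 ≤ x := Real.one_le_exp hL0.le
  set w := Real.exp (κ * L) with hw
  have hw1 : 1 < w := Real.one_lt_exp_iff.mpr (by positivity)
  have hwx : w ≤ 2 * x := by
    have : w ≤ x := Real.exp_le_exp.mpr (by nlinarith)
    linarith
  have hlw : Real.log w = κ * L := Real.log_exp _
  have hlog2 : Real.log 2 ≤ 1 := by
    have := Real.log_le_sub_one_of_pos (x := 2) (by norm_num); linarith
  have hlx : Real.log (2 * x) ≤ 1 + L := by
    rw [Real.log_mul (by norm_num) (by positivity), hx, Real.log_exp]; linarith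
  set S1 : ℝ → ℝ := fun u => ‖partialSum (fun n => f n * Real.log n) u‖ with hS1
  set R := Set.Ioc 1 (2 * x) with hR
  set g1 : ℝ → ℝ := (Set.Ioc 1 w).indicator (fun u => 1 / u) with hg1
  set g2 : ℝ → ℝ := fun u => S1 u ^ 2 * u ^ (-(2 * (1 + 1 / L)) - 1) with hg2
  set g3 : ℝ → ℝ := (Set.Ioi w).indicator (fun u => u⁻¹ * (1 / Real.log u) ^ 2) with hg3
  obtain ⟨i3', e3'⟩ := integral_inv_mul_log_sq_Ioi hw1
  have hsub : R ⊆ Set.Ioi 1 := Set.Ioc_subset_Ioi_self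
  have i1 : IntegrableOn g1 R := (integrableOn_one_div_Ioc zero_lt_one).indicator measurableSet_Ioc
  have i2 : IntegrableOn g2 R := hi.mono_set hsub
  have i3 : IntegrableOn g3 R := (i3'.integrable_indicator measurableSet_Ioi).integrableOn
  have i4 : IntegrableOn (fun u : ℝ => 1 / u) R := integrableOn_one_div_Ioc zero_lt_one
  have e1 : ∫ u in R, g1 u ≤ κ * L := by
    rw [hg1, setIntegral_indicator measurableSet_Ioc,
      Set.inter_eq_self_of_subset_right (Set.Ioc_subset_Ioc_right hwx),
      integral_one_div_Ioc zero_lt_one hw1.le, div_one, hlw]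
  have e2 : ∫ u in R, g2 u ≤ B * L ^ 3 := by
    refine (setIntegral_mono_set hi ?_ hsub.eventuallyLE).trans hB
    filter_upwards [ae_restrict_mem measurableSet_Ioi] with u hu
    have : (0:ℝ) < u := lt_trans zero_lt_one hu
    simp only [Pi.zero_apply]
    positivity
  have e3 : ∫ u in R, g3 u ≤ 1 / (κ * L) := by
    rw [← hlw, ← e3', ← integral_indicator measurableSet_Ioi]
    refine setIntegral_le_integral (i3'.integrable_indicator measurableSet_Ioi) (ae_of_all _ fun u => ?_)
    refine Set.indicator_nonneg (fun v hv => ?_) u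
    have : (0:ℝ) < v := by linarith [Set.mem_Ioi.mp hv]
    positivity
  have e4 : ∫ u in R, 1 / u ≤ 1 + L := by
    rw [hR, integral_one_div_Ioc zero_lt_one (by linarith), div_one]; exact hlx
  -- `l` is the weight in the inequality `a * b ≤ (l * a ^ 2 + b ^ 2 / l) / 2`
  set l := 1 / (κ ^ 2 * L ^ 2) with hl
  have hl0 : 0 < l := by positivity
  have hpt : ∀ u ∈ R, ‖partialSum f u‖ / u ^ 2 ≤
      g1 u + l * Real.exp 4 / 2 * g2 u + 1 / (2 * l) * g3 u + 1 / (κ * L) * (1 / u) := by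
    intro u hu
    have hu1 : 1 < u := hu.1
    have hu0 : 0 < u := by linarith
    have hg20 : 0 ≤ g2 u := by simp only [hg2]; positivity
    by_cases huw : u ≤ w
    · have a1 : g1 u = 1 / u := by rw [hg1, Set.indicator_of_mem (Set.mem_Ioc.mpr ⟨hu1, huw⟩)]
      have a3 : g3 u = 0 := by rw [hg3, Set.indicator_of_notMem (by simpa using huw)]
      have : ‖partialSum f u‖ / u ^ 2 ≤ 1 / u := by
        rw [div_le_div_iff₀ (by positivity) hu0]
        have := norm_partialSum_le hf hu0.le
        nlinarith
      rw [a1, a3]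
      have : 0 ≤ l * Real.exp 4 / 2 * g2 u := by positivity
      have : 0 ≤ 1 / (κ * L) * (1 / u) := by positivity
      linarith
    · push Not at huw
      have a1 : g1 u = 0 := by
        rw [hg1, Set.indicator_of_notMem (fun h => absurd h.2 (not_le.mpr huw))]
      have a3 : g3 u = u⁻¹ * (1 / Real.log u) ^ 2 := by rw [hg3, Set.indicator_of_mem (Set.mem_Ioi.mpr huw)]
      have hlu : κ * L ≤ Real.log u := by rw [← hlw]; exact Real.log_le_log (by linarith) huw.le
      have hκL : 0 < κ * L := by positivity
      have hlu0 : 0 < Real.log u := by linarith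
      have b1 := norm_partialSum_mul_log_le hf hu1.le
      have b2 : ‖partialSum f u‖ / u ^ 2 ≤ S1 u / (u ^ 2 * Real.log u) + 1 / (κ * L) * (1 / u) := by
        have : ‖partialSum f u‖ / u ^ 2 ≤ (S1 u + u) / (u ^ 2 * Real.log u) := by
          rw [div_le_div_iff₀ (by positivity) (by positivity)]
          calc ‖partialSum f u‖ * (u ^ 2 * Real.log u) = ‖partialSum f u‖ * Real.log u * u ^ 2 := by ring
            _ ≤ (S1 u + u) * u ^ 2 := by gcongr
        refine this.trans ?_
        rw [add_div]
        gcongr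
        rw [one_div_mul_one_div, div_le_div_iff₀ (by positivity) (by positivity)]
        calc u * (κ * L * u) = κ * L * u ^ 2 := by ring
          _ ≤ Real.log u * u ^ 2 := by gcongr
          _ = 1 * (u ^ 2 * Real.log u) := by ring
      have b3 : S1 u / (u ^ 2 * Real.log u) ≤
          l / 2 * (S1 u ^ 2 * (u ^ 3)⁻¹) + 1 / (2 * l) * (u⁻¹ * (1 / Real.log u) ^ 2) :=
        div_sq_mul_le_add hu0 hlu0 hl0 (S1 u)
      have b4 : (u ^ 3)⁻¹ ≤ Real.exp 4 * u ^ (-(2 * (1 + 1 / L)) - 1) :=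
        inv_cube_le_exp_mul_rpow hu0 hL0 ((Real.log_le_log hu0 hu.2).trans (by linarith))
      have b5 : l / 2 * (S1 u ^ 2 * (u ^ 3)⁻¹) ≤ l * Real.exp 4 / 2 * g2 u := by
        calc l / 2 * (S1 u ^ 2 * (u ^ 3)⁻¹) ≤
              l / 2 * (S1 u ^ 2 * (Real.exp 4 * u ^ (-(2 * (1 + 1 / L)) - 1))) := by gcongr
          _ = _ := by simp only [hg2]; ring
      rw [a1, a3]
      linarith
  have i0 : IntegrableOn (fun u => ‖partialSum f u‖ / u ^ 2) R := by
    refine integrableOn_norm_partialSum_mul hf (φ := fun u => (u ^ 2)⁻¹) zero_le_one ?_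
    refine (ContinuousOn.integrableOn_Icc ?_).mono_set Set.Ioc_subset_Icc_self
    refine ContinuousOn.inv₀ (by fun_prop) fun u hu => ?_
    have := hu.1
    positivity
  have j12 := i1.add (i2.const_mul (l * Real.exp 4 / 2))
  have j123 := j12.add (i3.const_mul (1 / (2 * l)))
  have := setIntegral_mono_on i0 (j123.add (i4.const_mul (1 / (κ * L)))) measurableSet_Ioc hpt
  rw [integral_add' j123 (i4.const_mul _), integral_add' j12 (i3.const_mul _),
    integral_add' i1 (i2.const_mul _), integral_const_mul, integral_const_mul, integral_const_mul] at this
  refine this.trans ?_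
  have k2 : l * Real.exp 4 / 2 * ∫ u in R, g2 u ≤ Real.exp 4 * B * L / (2 * κ ^ 2) := by
    calc _ ≤ l * Real.exp 4 / 2 * (B * L ^ 3) := by gcongr
      _ = _ := by rw [hl]; field_simp
  have k3 : 1 / (2 * l) * ∫ u in R, g3 u ≤ κ * L / 2 := by
    calc _ ≤ 1 / (2 * l) * (1 / (κ * L)) := by gcongr
      _ = _ := by rw [hl]; field_simp
  have k4 : 1 / (κ * L) * ∫ u in R, 1 / u ≤ 2 / κ := by
    calc _ ≤ 1 / (κ * L) * (1 + L) := by gcongr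
      _ ≤ 1 / (κ * L) * (L + L) := by gcongr
      _ = _ := by field_simp; ring
  linarith

open Complex in
/-- A quantitative form of Halász's theorem: a large partial sum forces a large value of `F(s) / s`
on the line `Re s = 1 + 1 / L`, where `L = log x`. The power `η ^ (3 / 2)`, written `η * √η`, is what the
argument loses: with `F(s) / s` at most `m L`, the logarithmic mean of `‖S(u)‖ / u` is
`O(κ L + m ^ 2 L / κ ^ 2 + 1 / κ)` for every `κ`, and the terms are small against `η L` for `κ` a small multiple of
`η` and `m ^ 2` a small multiple of `η ^ 3`. -/
theorem exists_large_LSeries :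
    ∃ c K : ℝ, 0 < c ∧ 0 < K ∧ ∀ f : ℕ →*₀ ℂ, (∀ n, ‖f n‖ ≤ 1) → ∀ η L : ℝ, 0 < η → η ≤ 1 → 1 ≤ L →
      K ≤ η ^ 6 * L → η * Real.exp L ≤ ‖partialSum f (Real.exp L)‖ →
      ∃ t : ℝ, c * (η * √η) * L * ‖((1 + 1 / L : ℝ) : ℂ) + t * I‖ ≤ ‖LSeries f ((1 + 1 / L : ℝ) + t * I)‖ := by
  obtain ⟨C₁, hC₁, H₁⟩ := exists_norm_partialSum_mul_log_le
  obtain ⟨C₂, hC₂, H₂⟩ := exists_integral_norm_sq_partialSum_mul_log_le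
  set c₁ := 1 / (12 * (C₁ + 1)) with hc₁
  have hc₁0 : 0 < c₁ := by positivity
  have hc₁1 : c₁ ≤ 1 / 12 := one_div_le_one_div_of_le (by norm_num) (by linarith)
  set c := min (1 / 3) (√(c₁ ^ 3 / (Real.exp 4 * C₂))) with hc
  have hc0 : 0 < c := lt_min (by norm_num) (by positivity)
  have hc3 : c ≤ 1 / 3 := min_le_left _ _
  have hcsq : c ^ 2 ≤ c₁ ^ 3 / (Real.exp 4 * C₂) := by
    calc c ^ 2 ≤ (√(c₁ ^ 3 / (Real.exp 4 * C₂))) ^ 2 := pow_le_pow_left₀ hc0.le (min_le_right _ _) 2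
      _ = _ := Real.sq_sqrt (by positivity)
  refine ⟨c, 1 / c ^ 2 + 2 / c₁ ^ 2 + 5 * C₁ / (3 * c₁) ^ 2, hc0, by positivity,
    fun f hf η L hη hη1 hL hK hS => ?_⟩
  by_contra! hcon
  have hL0 : 0 < L := by linarith
  set m := c * (η * √η) with hm
  have hm0 : 0 < m := by positivity
  have hsη : √η ≤ 1 := Real.sqrt_le_one.mpr hη1
  have hm2 : m ^ 2 = c ^ 2 * η ^ 3 := by
    rw [hm, mul_pow, mul_pow, Real.sq_sqrt hη.le]; ring
  have hη63 : η ^ 6 ≤ η ^ 3 := pow_le_pow_of_le_one hη.le hη1 (by norm_num)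
  have hη32 : η ^ 3 ≤ η ^ 2 := pow_le_pow_of_le_one hη.le hη1 (by norm_num)
  have hη6L : η ^ 6 * L ≤ η ^ 3 * L := by gcongr
  have hη3L : η ^ 3 * L ≤ η ^ 2 * L := by gcongr
  have p1 : 0 < 1 / c ^ 2 := by positivity
  have p2 : 0 < 2 / c₁ ^ 2 := by positivity
  have p3 : 0 < 5 * C₁ / (3 * c₁) ^ 2 := by positivity
  have q1 : 1 / c ^ 2 ≤ η ^ 3 * L := by linarith
  have q2 : 2 / c₁ ^ 2 ≤ η ^ 2 * L := by linarith
  have q3 : 5 * C₁ / (3 * c₁) ^ 2 ≤ η ^ 3 * L := by linarith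
  obtain ⟨hi, hB⟩ := H₂ f hf L m hL hm0
    (by
      have : η * √η ≤ 1 := mul_le_one₀ hη1 (Real.sqrt_nonneg _) hsη
      calc m ≤ 1 / 3 * 1 := mul_le_mul hc3 this (by positivity) (by norm_num)
        _ = 1 / 3 := mul_one _)
    (by
      rw [hm2, mul_assoc]
      rw [div_le_iff₀ (by positivity)] at q1
      linarith)
    (fun t => (hcon t).le)
  set κ := c₁ * η with hκ
  have hκ0 : 0 < κ := by positivity
  have hκ12 : κ ≤ 1 / 12 := by
    calc κ ≤ 1 / 12 * 1 := mul_le_mul hc₁1 hη1 hη.le (by norm_num)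
      _ = 1 / 12 := by norm_num
  have hκ1 : κ ≤ 1 := by linarith
  -- `3 * κ` is the relative length of the short averages
  have h1 := H₁ f hf (Real.exp L) (3 * κ) (Real.one_le_exp hL0.le) (by positivity) (by linarith)
  rw [Real.log_exp] at h1
  have hJ := integral_norm_partialSum_div_sq_le hf hL hκ0 hκ1 hi hB
  generalize (∫ u in Set.Ioc 1 (2 * Real.exp L), ‖partialSum f u‖ / u ^ 2) = J at hJ h1
  have hJ2 : Real.exp 4 * (C₂ * m ^ 2) * L / (2 * κ ^ 2) ≤ κ * L / 2 := by
    rw [div_le_div_iff₀ (by positivity) (by norm_num), hm2]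
    rw [le_div_iff₀ (by positivity)] at hcsq
    have := mul_le_mul_of_nonneg_right hcsq (by positivity : 0 ≤ η ^ 3 * L * 2)
    calc _ = c ^ 2 * (Real.exp 4 * C₂) * (η ^ 3 * L * 2) := by ring
      _ ≤ _ := this
      _ = _ := by rw [hκ]; ring
  have hJ4 : 2 / κ ≤ κ * L := by
    rw [div_le_iff₀ hκ0]
    rw [div_le_iff₀ (by positivity)] at q2
    calc 2 ≤ η ^ 2 * L * c₁ ^ 2 := q2
      _ = κ * L * κ := by rw [hκ]; ring
  have hJ' : J ≤ 3 * κ * L := by linarith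
  set x := Real.exp L with hx
  have hx0 : 0 < x := Real.exp_pos L
  have h2 : η * x * L ≤ C₁ * (x * (3 * κ * L) + x / (3 * κ) ^ 2 + 3 * κ * x * L) := by
    calc η * x * L ≤ ‖partialSum f x‖ * L := by gcongr
      _ ≤ _ := h1
      _ ≤ _ := by gcongr
  have h3 : η * L ≤ C₁ * (3 * κ * L + 1 / (3 * κ) ^ 2 + 3 * κ * L) := by
    refine le_of_mul_le_mul_left ?_ hx0
    calc x * (η * L) = η * x * L := by ring
      _ ≤ _ := h2
      _ = _ := by ring
  have h4 : C₁ * (3 * κ) ≤ η / 4 := by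
    have : C₁ * (3 * κ) = η / 4 * (C₁ / (C₁ + 1)) := by rw [hκ, hc₁]; field_simp; ring
    rw [this]
    have : C₁ / (C₁ + 1) ≤ 1 := (div_le_one (by positivity)).mpr (by linarith)
    exact mul_le_of_le_one_right (by positivity) this
  have h5 : C₁ * (1 / (3 * κ) ^ 2) ≤ η * L / 5 := by
    have e : C₁ * (1 / (3 * κ) ^ 2) = 5 * C₁ / (3 * c₁) ^ 2 / (5 * η ^ 2) := by
      rw [hκ]; field_simp
    rw [e, div_le_iff₀ (by positivity)]
    calc _ ≤ η ^ 3 * L := q3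
      _ = _ := by ring
  have h6 : C₁ * (3 * κ) * L ≤ η / 4 * L := by gcongr
  have h7 : 0 < η * L := by positivity
  have h8 : C₁ * (3 * κ * L + 1 / (3 * κ) ^ 2 + 3 * κ * L) =
      C₁ * (3 * κ) * L + C₁ * (1 / (3 * κ) ^ 2) + C₁ * (3 * κ) * L := by ring
  have h9 : η / 4 * L = η * L / 4 := by ring
  linarith

/-! ### Pretentious distance and the product of two functions -/

/-- `∑ p⁻²`, the constant that bounds the contribution of higher prime powers to `log F`. -/
noncomputable def sumPrimesInvSq : ℝ := ∑' p : Nat.Primes, (p:ℝ) ^ (-2 : ℝ)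

open Complex in
/-- The terms with `k ≥ 2` in `-log (1 - z) = ∑ z ^ k / k` add up to at most `|z| ^ 2`. -/
theorem abs_re_neg_log_one_sub_sub_re_le {z : ℂ} (hz : ‖z‖ ≤ 1 / 2) :
    |(-log (1 - z)).re - z.re| ≤ ‖z‖ ^ 2 := by
  have h := norm_log_one_add_sub_self_le (z := -z) (by rw [norm_neg]; linarith)
  rw [norm_neg] at h
  have e : (-log (1 - z)).re - z.re = -(log (1 + -z) - -z).re := by
    simp [sub_eq_add_neg]
    ring
  rw [e, abs_neg]
  refine (abs_re_le_norm _).trans (h.trans ?_)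
  have : (1 - ‖z‖)⁻¹ ≤ 2 := by
    rw [inv_le_comm₀ (by linarith) (by norm_num)]; linarith
  have h0 := sq_nonneg ‖z‖
  nlinarith

open Complex in
/-- The Euler product in absolute value: up to a bounded factor only the primes themselves matter,
not their higher powers. -/
theorem norm_tsum_bounds_exp {σ : ℝ} (hσ : 1 < σ) (g : ℕ →*₀ ℂ) (hg : ∀ n : ℕ, ‖g n‖ ≤ (n:ℝ) ^ (-σ)) :
    Summable (fun p : Nat.Primes => (g p).re) ∧
    Real.exp (∑' p : Nat.Primes, (g p).re - sumPrimesInvSq) ≤ ‖∑' n, g n‖ ∧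
    ‖∑' n, g n‖ ≤ Real.exp (∑' p : Nat.Primes, (g p).re + sumPrimesInvSq) := by
  have hs : Summable fun n => ‖g n‖ :=
    Summable.of_nonneg_of_le (fun _ => norm_nonneg _) hg (summable_zetaSum hσ)
  have hsp : Summable fun p : Nat.Primes => g p := hs.of_norm.comp_injective Nat.Primes.coe_nat_injective
  have hre : Summable fun p : Nat.Primes => (g p).re := (hasSum_re hsp.hasSum).summable
  have hinv : Summable fun p : Nat.Primes => (p:ℝ) ^ (-2 : ℝ) :=
    Nat.Primes.summable_rpow.mpr (by norm_num)
  have hp2 : ∀ p : Nat.Primes, (2:ℝ) ≤ p := fun p => by exact_mod_cast p.2.two_le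
  have hgp : ∀ p : Nat.Primes, ‖g p‖ ≤ (p:ℝ)⁻¹ := fun p => by
    refine (hg p).trans ?_
    rw [← Real.rpow_neg_one]
    exact Real.rpow_le_rpow_of_exponent_le (by linarith [hp2 p]) (by linarith)
  have hpt : ∀ p : Nat.Primes, |(-log (1 - g p)).re - (g p).re| ≤ (p:ℝ) ^ (-2 : ℝ) := fun p => by
    refine (abs_re_neg_log_one_sub_sub_re_le ((hgp p).trans ?_)).trans ?_
    · rw [one_div]; exact inv_anti₀ (by norm_num) (hp2 p)
    · refine (pow_le_pow_left₀ (norm_nonneg _) (hgp p) 2).trans ?_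
      rw [Real.rpow_neg (by linarith [hp2 p])]
      simp
  have hlog : Summable fun p : Nat.Primes => -log (1 - g p) := by
    have := (hs.of_norm.clog_one_sub).neg.comp_injective Nat.Primes.coe_nat_injective
    exact this
  have hlre : Summable fun p : Nat.Primes => (-log (1 - g p)).re := (hasSum_re hlog.hasSum).summable
  have hE := EulerProduct.exp_tsum_primes_log_eq_tsum (f := g) hs
  have hn : ‖∑' n, g n‖ = Real.exp (∑' p : Nat.Primes, (-log (1 - g p)).re) := by
    rw [← hE, norm_exp, re_tsum hlog]
  have hdiff : |∑' p : Nat.Primes, (-log (1 - g p)).re - ∑' p : Nat.Primes, (g p).re| ≤ sumPrimesInvSq := by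
    rw [← hlre.tsum_sub hre]
    rw [← Real.norm_eq_abs]
    exact tsum_of_norm_bounded hinv.hasSum hpt
  obtain ⟨h1, h2⟩ := abs_le.mp hdiff
  refine ⟨hre, ?_, ?_⟩ <;> rw [hn] <;> apply Real.exp_le_exp.mpr <;> linarith

open Complex in
/-- The square of the pretentious distance between `f` and `n ↦ n ^ (i t)`: a sum over all primes, with
the weight `p ^ (-σ)` in place of a cut-off at `p ≤ exp (1 / (σ - 1))`. -/
noncomputable def pretentiousDist (f : ℕ → ℂ) (σ t : ℝ) : ℝ :=
  ∑' p : Nat.Primes, (p:ℝ) ^ (-σ) * (1 - (f p * (p:ℂ) ^ (-(t * I))).re)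

open Complex in
theorem norm_mul_cpow_le {f : ℕ → ℂ} (hf : ∀ n, ‖f n‖ ≤ 1) (t : ℝ) (p : Nat.Primes) :
    ‖f p * (p:ℂ) ^ (-(t * I))‖ ≤ 1 := by
  rw [norm_mul, norm_natCast_cpow_of_pos p.2.pos]
  simpa using hf p

open Complex in
theorem summable_pretentiousDist {f : ℕ → ℂ} (hf : ∀ n, ‖f n‖ ≤ 1) {σ : ℝ} (hσ : 1 < σ) (t : ℝ) :
    Summable fun p : Nat.Primes => (p:ℝ) ^ (-σ) * (1 - (f p * (p:ℂ) ^ (-(t * I))).re) := by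
  have h : Summable fun p : Nat.Primes => (p:ℝ) ^ (-σ) * 2 :=
    (Nat.Primes.summable_rpow.mpr (by linarith)).mul_right 2
  refine Summable.of_nonneg_of_le (fun p => ?_) (fun p => ?_) h
  all_goals
    have h1 := abs_le.mp ((abs_re_le_norm _).trans (norm_mul_cpow_le hf t p))
  · exact mul_nonneg (by positivity) (by linarith)
  · gcongr; linarith

open Complex in
/-- `|F(σ + i t)| / ζ(σ)` is comparable to `exp (-D)` with `D` the pretentious distance. -/
theorem norm_LSeries_bounds (f : ℕ →*₀ ℂ) (hf : ∀ n, ‖f n‖ ≤ 1) {σ : ℝ} (hσ : 1 < σ) (t : ℝ) :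
    zetaSum σ * Real.exp (-pretentiousDist f σ t - 2 * sumPrimesInvSq) ≤ ‖LSeries f (σ + t * I)‖ ∧
    ‖LSeries f (σ + t * I)‖ ≤ zetaSum σ * Real.exp (-pretentiousDist f σ t + 2 * sumPrimesInvSq) := by
  have hs0 : (σ + t * I : ℂ) ≠ 0 := by
    intro h; have := congrArg Complex.re h; simp at this; linarith
  have hσ0 : (σ : ℂ) ≠ 0 := by exact_mod_cast (by linarith : σ ≠ 0)
  have hnorm : ∀ (s : ℂ), s.re = σ → ∀ n : ℕ, ‖(n:ℂ) ^ (-s)‖ = (n:ℝ) ^ (-σ) := by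
    intro s hs n
    rcases eq_or_ne n 0 with rfl | hn
    · have : -s ≠ 0 := by intro h; rw [neg_eq_zero] at h; rw [h] at hs; simp at hs; linarith
      rw [Nat.cast_zero, zero_cpow this, Nat.cast_zero, Real.zero_rpow (by linarith), norm_zero]
    · rw [norm_natCast_cpow_of_pos (Nat.pos_of_ne_zero hn), neg_re, hs]
  have h1 := norm_tsum_bounds_exp hσ (f * riemannZetaSummandHom hs0) (fun n => by
    change ‖f n * (n:ℂ) ^ (-(σ + t * I : ℂ))‖ ≤ _
    rw [norm_mul, hnorm _ (by simp)]
    exact mul_le_of_le_one_left (by positivity) (hf n))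
  have h2 := norm_tsum_bounds_exp hσ (riemannZetaSummandHom hσ0) (fun n => (hnorm _ (by simp) n).le)
  have e1 : ∑' n, (f * riemannZetaSummandHom hs0) n = LSeries f (σ + t * I) := by
    refine tsum_congr fun n => ?_
    rw [LSeries.term_def₀ (map_zero f)]
    rfl
  have hreal : ∀ n : ℕ, riemannZetaSummandHom hσ0 n = (((n:ℝ) ^ (-σ) : ℝ) : ℂ) := fun n => by
    change (n:ℂ) ^ (-(σ:ℂ)) = _
    rw [ofReal_cpow (by positivity)]
    push_cast; rfl
  have e2 : ‖∑' n, riemannZetaSummandHom hσ0 n‖ = zetaSum σ := by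
    simp_rw [hreal]
    rw [← ofReal_tsum, norm_real, Real.norm_of_nonneg (tsum_nonneg fun n => by positivity)]
    rfl
  rw [e1] at h1
  rw [e2] at h2
  obtain ⟨s1, l1, u1⟩ := h1
  obtain ⟨s2, l2, u2⟩ := h2
  have hD : pretentiousDist f σ t = ∑' p : Nat.Primes, (riemannZetaSummandHom hσ0 p).re -
      ∑' p : Nat.Primes, ((f * riemannZetaSummandHom hs0) p).re := by
    rw [← s2.tsum_sub s1]
    refine tsum_congr fun p => ?_
    rw [hreal]
    change _ = _ - (f p * (p:ℂ) ^ (-(σ + t * I : ℂ))).re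
    have hp0 : (p:ℂ) ≠ 0 := by exact_mod_cast p.2.ne_zero
    have e : f p * (p:ℂ) ^ (-(σ + t * I : ℂ)) = (((p:ℝ) ^ (-σ) : ℝ) : ℂ) * (f p * (p:ℂ) ^ (-(t * I))) := by
      rw [neg_add, cpow_add _ _ hp0, ofReal_cpow (by positivity)]
      push_cast; ring
    rw [e, re_ofReal_mul, ofReal_re]
    ring
  constructor
  · calc _ ≤ Real.exp (∑' p : Nat.Primes, (riemannZetaSummandHom hσ0 p).re + sumPrimesInvSq) *
          Real.exp (-pretentiousDist f σ t - 2 * sumPrimesInvSq) := by gcongr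
      _ = Real.exp (∑' p : Nat.Primes, ((f * riemannZetaSummandHom hs0) p).re - sumPrimesInvSq) := by
          rw [← Real.exp_add, hD]; congr 1; ring
      _ ≤ _ := l1
  · calc _ ≤ _ := u1
      _ = Real.exp (∑' p : Nat.Primes, (riemannZetaSummandHom hσ0 p).re - sumPrimesInvSq) *
          Real.exp (-pretentiousDist f σ t + 2 * sumPrimesInvSq) := by
          rw [← Real.exp_add, hD]; congr 1; ring
      _ ≤ _ := by gcongr

theorem pretentiousDist_anti {f : ℕ → ℂ} (hf : ∀ n, ‖f n‖ ≤ 1) {σ σ' : ℝ} (hσ' : 1 < σ') (h : σ' ≤ σ) (t : ℝ) :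
    pretentiousDist f σ t ≤ pretentiousDist f σ' t := by
  refine (summable_pretentiousDist hf (by linarith) t).tsum_le_tsum (fun p => ?_)
    (summable_pretentiousDist hf hσ' t)
  have h1 := abs_le.mp ((Complex.abs_re_le_norm _).trans (norm_mul_cpow_le hf t p))
  have h2 : (1:ℝ) ≤ p := by exact_mod_cast p.2.one_le
  refine mul_le_mul_of_nonneg_right ?_ (by linarith)
  exact Real.rpow_le_rpow_of_exponent_le h2 (by linarith)

open Complex in
/-- The triangle inequality for the pretentious distance at a single prime. It rests on
`|1 - z| ^ 2 ≤ 2 (1 - Re z)` in the closed unit disc. -/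
theorem one_sub_re_mul_le {z w : ℂ} (hz : ‖z‖ ≤ 1) (hw : ‖w‖ ≤ 1) :
    1 - (z * w).re ≤ 2 * (1 - z.re) + 2 * (1 - w.re) := by
  have hsq : ∀ v : ℂ, ‖v‖ ≤ 1 → ‖1 - v‖ ^ 2 ≤ 2 * (1 - v.re) := by
    intro v hv
    have h1 : ‖v‖ ^ 2 ≤ 1 := pow_le_one₀ (norm_nonneg _) hv
    rw [← normSq_eq_norm_sq, normSq_apply] at h1 ⊢
    simp only [sub_re, one_re, sub_im, one_im]
    nlinarith
  have h1 : 1 - (z * w).re = (1 - z.re) + (1 - w.re) - ((1 - z) * (1 - w)).re := by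
    simp only [mul_re, sub_re, one_re, sub_im, one_im]; ring
  have h2 := (abs_le.mp ((abs_re_le_norm ((1 - z) * (1 - w))))).1
  rw [norm_mul] at h2
  nlinarith [hsq z hz, hsq w hw, sq_nonneg (‖1 - z‖ - ‖1 - w‖)]

open Complex in
/-- The triangle inequality for the pretentious distance, in squared form: if `f₁` is close to
`n ^ (i t₁)` and `f₂` to `n ^ (i t₂)`, then `f₁ f₂` is close to `n ^ (i (t₁ + t₂))`. -/
theorem pretentiousDist_mul_le {f₁ f₂ : ℕ → ℂ} (hf₁ : ∀ n, ‖f₁ n‖ ≤ 1) (hf₂ : ∀ n, ‖f₂ n‖ ≤ 1) {σ : ℝ}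
    (hσ : 1 < σ) (t₁ t₂ : ℝ) :
    pretentiousDist (fun n => f₁ n * f₂ n) σ (t₁ + t₂) ≤
      2 * pretentiousDist f₁ σ t₁ + 2 * pretentiousDist f₂ σ t₂ := by
  have s1 := summable_pretentiousDist hf₁ hσ t₁
  have s2 := summable_pretentiousDist hf₂ hσ t₂
  have hf : ∀ n, ‖f₁ n * f₂ n‖ ≤ 1 := fun n => by
    rw [norm_mul]; exact mul_le_one₀ (hf₁ n) (norm_nonneg _) (hf₂ n)
  unfold pretentiousDist
  rw [← tsum_mul_left, ← tsum_mul_left, ← (s1.mul_left 2).tsum_add (s2.mul_left 2)]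
  refine (summable_pretentiousDist hf hσ _).tsum_le_tsum (fun p => ?_) ((s1.mul_left 2).add (s2.mul_left 2))
  have hp0 : (p:ℂ) ≠ 0 := by exact_mod_cast p.2.ne_zero
  have e : f₁ p * f₂ p * (p:ℂ) ^ (-(((t₁ + t₂ : ℝ) : ℂ) * I)) =
      (f₁ p * (p:ℂ) ^ (-(t₁ * I))) * (f₂ p * (p:ℂ) ^ (-(t₂ * I))) := by
    have : -(((t₁ + t₂ : ℝ) : ℂ) * I) = -(t₁ * I) + -(t₂ * I) := by push_cast; ring
    rw [this, cpow_add _ _ hp0]; ring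
  rw [e]
  have h := one_sub_re_mul_le (norm_mul_cpow_le hf₁ t₁ p) (norm_mul_cpow_le hf₂ t₂ p)
  have h0 : (0:ℝ) ≤ (p:ℝ) ^ (-σ) := by positivity
  have := mul_le_mul_of_nonneg_left h h0
  linarith

open Complex in
/-- If `F₁` and `F₂` are large compared with `ζ`, at points possibly closer to the line `Re s = 1`,
then so is the Dirichlet series of the product. The squares come from the factors `2` in
`pretentiousDist_mul_le`; moving to a larger `σ` only decreases the distances. -/
theorem exists_norm_LSeries_mul_ge :
    ∃ c : ℝ, 0 < c ∧ ∀ f₁ f₂ : ℕ →*₀ ℂ, (∀ n, ‖f₁ n‖ ≤ 1) → (∀ n, ‖f₂ n‖ ≤ 1) →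
      ∀ σ σ₁ σ₂ t₁ t₂ : ℝ, 1 < σ₁ → 1 < σ₂ → σ₁ ≤ σ → σ₂ ≤ σ →
      c * zetaSum σ * (‖LSeries f₁ (σ₁ + t₁ * I)‖ / zetaSum σ₁) ^ 2 * (‖LSeries f₂ (σ₂ + t₂ * I)‖ / zetaSum σ₂) ^ 2 ≤
        ‖LSeries (fun n => f₁ n * f₂ n) (σ + ((t₁ + t₂ : ℝ) : ℂ) * I)‖ := by
  refine ⟨Real.exp (-10 * sumPrimesInvSq), Real.exp_pos _,
    fun f₁ f₂ hf₁ hf₂ σ σ₁ σ₂ t₁ t₂ hσ₁ hσ₂ h1 h2 => ?_⟩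
  have hσ : 1 < σ := by linarith
  have hz : ∀ {s : ℝ}, 1 < s → 0 < zetaSum s := fun {s} hs =>
    lt_of_lt_of_le (one_div_pos.mpr (by linarith)) (zetaSum_bounds hs).1
  have hf : ∀ n, ‖(f₁ * f₂) n‖ ≤ 1 := fun n => by
    change ‖f₁ n * f₂ n‖ ≤ 1
    rw [norm_mul]; exact mul_le_one₀ (hf₁ n) (norm_nonneg _) (hf₂ n)
  have u1 : ‖LSeries f₁ (σ₁ + t₁ * I)‖ / zetaSum σ₁ ≤
      Real.exp (-pretentiousDist f₁ σ t₁ + 2 * sumPrimesInvSq) := by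
    rw [div_le_iff₀ (hz hσ₁), mul_comm (Real.exp _)]
    refine (norm_LSeries_bounds f₁ hf₁ hσ₁ t₁).2.trans ?_
    have := (hz hσ₁).le
    gcongr
    exact pretentiousDist_anti hf₁ hσ₁ h1 t₁
  have u2 : ‖LSeries f₂ (σ₂ + t₂ * I)‖ / zetaSum σ₂ ≤
      Real.exp (-pretentiousDist f₂ σ t₂ + 2 * sumPrimesInvSq) := by
    rw [div_le_iff₀ (hz hσ₂), mul_comm (Real.exp _)]
    refine (norm_LSeries_bounds f₂ hf₂ hσ₂ t₂).2.trans ?_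
    have := (hz hσ₂).le
    gcongr
    exact pretentiousDist_anti hf₂ hσ₂ h2 t₂
  have l := (norm_LSeries_bounds (f₁ * f₂) hf hσ (t₁ + t₂)).1
  have d := pretentiousDist_mul_le hf₁ hf₂ hσ t₁ t₂
  have hz0 := (hz hσ).le
  have n1 : 0 ≤ ‖LSeries f₁ (σ₁ + t₁ * I)‖ / zetaSum σ₁ := div_nonneg (norm_nonneg _) (hz hσ₁).le
  have n2 : 0 ≤ ‖LSeries f₂ (σ₂ + t₂ * I)‖ / zetaSum σ₂ := div_nonneg (norm_nonneg _) (hz hσ₂).le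
  refine le_trans ?_ l
  calc _ ≤ Real.exp (-10 * sumPrimesInvSq) * zetaSum σ *
        Real.exp (-pretentiousDist f₁ σ t₁ + 2 * sumPrimesInvSq) ^ 2 *
        Real.exp (-pretentiousDist f₂ σ t₂ + 2 * sumPrimesInvSq) ^ 2 := by gcongr
    _ = zetaSum σ * Real.exp (-(2 * pretentiousDist f₁ σ t₁ + 2 * pretentiousDist f₂ σ t₂) - 2 * sumPrimesInvSq) := by
        rw [← Real.exp_nat_mul, ← Real.exp_nat_mul, mul_comm (Real.exp _) (zetaSum σ), mul_assoc, mul_assoc,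
          ← Real.exp_add, ← Real.exp_add]
        congr 2; push_cast; ring
    _ ≤ _ := by
        gcongr
        exact d

/-! ### Partial sums of a product -/

open MeasureTheory Complex in
/-- Partial summation: small partial sums from `exp (ξ L)` on bound the Dirichlet series on the line
`Re s = 1 + 1 / L`. The range below `exp (ξ L)`, where only `‖S(u)‖ ≤ u` is available, contributes the same
`ξ L` as the range above. -/
theorem norm_LSeries_le_of_norm_partialSum_le {f : ℕ → ℂ} (hf : ∀ n, ‖f n‖ ≤ 1) {L ξ : ℝ} (hL : 0 < L)
    (hξ : 0 < ξ) (h : ∀ u, Real.exp (ξ * L) ≤ u → ‖partialSum f u‖ ≤ ξ * u) (t : ℝ) :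
    ‖LSeries f ((1 + 1 / L : ℝ) + t * I)‖ ≤ 2 * ξ * L * ‖((1 + 1 / L : ℝ) : ℂ) + t * I‖ := by
  set σ := 1 + 1 / L with hσ
  set s : ℂ := (σ : ℂ) + t * I with hs
  have hre : s.re = σ := by simp [hs]
  have hσ1 : 1 < σ := by
    have : 0 < 1 / L := by positivity
    linarith
  set Y := Real.exp (ξ * L) with hY
  have hY1 : 1 < Y := Real.one_lt_exp_iff.mpr (by positivity)
  have hO : (fun n ↦ ∑ k ∈ Finset.Icc 1 n, ‖f k‖) =O[Filter.atTop] fun n ↦ (n : ℝ) ^ (1:ℝ) := by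
    refine Asymptotics.isBigO_of_le _ fun n => ?_
    rw [Real.rpow_one, Real.norm_of_nonneg (Finset.sum_nonneg fun _ _ => norm_nonneg _),
      Real.norm_of_nonneg (Nat.cast_nonneg n)]
    calc ∑ k ∈ Finset.Icc 1 n, ‖f k‖ ≤ ∑ _k ∈ Finset.Icc 1 n, (1:ℝ) := Finset.sum_le_sum fun k _ => hf k
      _ = n := by simp
  rw [LSeries_eq_mul_integral' f zero_le_one (by rw [hre]; exact hσ1) hO, norm_mul]
  set g1 : ℝ → ℝ := (Set.Ioc 1 Y).indicator (fun u => 1 / u) with hg1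
  have i1 : IntegrableOn g1 (Set.Ioi 1) :=
    ((integrableOn_one_div_Ioc zero_lt_one).integrable_indicator measurableSet_Ioc).integrableOn
  have i2 : IntegrableOn (fun u : ℝ => u ^ (-σ)) (Set.Ioi 1) :=
    integrableOn_Ioi_rpow_of_lt (by linarith) zero_lt_one
  have e1 : ∫ u in Set.Ioi 1, g1 u = ξ * L := by
    rw [hg1, setIntegral_indicator measurableSet_Ioc, Set.inter_eq_self_of_subset_right Set.Ioc_subset_Ioi_self,
      integral_one_div_Ioc zero_lt_one hY1.le, div_one, hY, Real.log_exp]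
  have e2 : ∫ u in Set.Ioi (1:ℝ), u ^ (-σ) = L := by
    rw [integral_Ioi_rpow_of_lt (by linarith) zero_lt_one, Real.one_rpow, hσ]
    field_simp
    ring
  have hpt : ∀ u ∈ Set.Ioi (1:ℝ), ‖partialSum f u * (u:ℂ) ^ (-(s + 1))‖ ≤ g1 u + ξ * u ^ (-σ) := by
    intro u hu
    have hu1 : 1 < u := hu
    have hu0 : 0 < u := by linarith
    have hn : ‖(u:ℂ) ^ (-(s + 1))‖ = u ^ (-σ - 1) := by
      rw [Complex.norm_cpow_eq_rpow_re_of_pos hu0]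
      congr 1
      rw [neg_re, add_re, hre, one_re]; ring
    have hu2 : u * u ^ (-σ - 1) = u ^ (-σ) := by
      rw [Real.rpow_sub_one hu0.ne']; field_simp
    rw [norm_mul, hn]
    have hp : 0 < u ^ (-σ - 1) := by positivity
    by_cases huY : u ≤ Y
    · rw [hg1, Set.indicator_of_mem (Set.mem_Ioc.mpr ⟨hu1, huY⟩)]
      have h1 : ‖partialSum f u‖ * u ^ (-σ - 1) ≤ u ^ (-σ) := by
        rw [← hu2]; gcongr; exact norm_partialSum_le hf hu0.le
      have h2 : u ^ (-σ) ≤ 1 / u := by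
        rw [one_div, ← Real.rpow_neg_one]
        exact Real.rpow_le_rpow_of_exponent_le hu1.le (by linarith)
      have : 0 ≤ ξ * u ^ (-σ) := by positivity
      linarith
    · rw [hg1, Set.indicator_of_notMem (fun h => huY h.2), zero_add, ← hu2, ← mul_assoc]
      gcongr
      exact h u (not_le.mp huY).le
  have hint := norm_integral_le_of_norm_le (i1.add (i2.const_mul ξ))
    ((ae_restrict_mem measurableSet_Ioi).mono hpt)
  rw [integral_add' i1 (i2.const_mul ξ), integral_const_mul, e1, e2] at hint
  calc _ ≤ ‖s‖ * (ξ * L + ξ * L) := by gcongr; exact hint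
    _ = _ := by ring

open Complex in
/-- The main estimate for completely multiplicative functions with value `0` at `0`, in logarithmic
coordinates `x₁ = exp L₁`, `x₂ = exp L₂`. The exponent `6` is `2 * (3 / 2) + 2 * (3 / 2)`, from
`exists_large_LSeries` for both functions and the squares in `exists_norm_LSeries_mul_ge`. -/
theorem exists_large_norm_partialSum_mul :
    ∃ c K : ℝ, 0 < c ∧ 0 < K ∧ ∀ f₁ f₂ : ℕ →*₀ ℂ, (∀ n, ‖f₁ n‖ ≤ 1) → (∀ n, ‖f₂ n‖ ≤ 1) →
      ∀ η L L₁ L₂ ξ : ℝ, 0 < η → η ≤ 1 → 1 ≤ L → L ≤ L₁ → L ≤ L₂ → K ≤ η ^ 6 * L → 0 < ξ → ξ ≤ c * η ^ 6 →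
      η * Real.exp L₁ ≤ ‖partialSum f₁ (Real.exp L₁)‖ → η * Real.exp L₂ ≤ ‖partialSum f₂ (Real.exp L₂)‖ →
      ∃ u, Real.exp (ξ * L) ≤ u ∧ ξ * u ≤ ‖partialSum (fun n => f₁ n * f₂ n) u‖ := by
  obtain ⟨c₇, K, hc₇, hK, H₇⟩ := exists_large_LSeries
  obtain ⟨c₈, hc₈, H₈⟩ := exists_norm_LSeries_mul_ge
  refine ⟨c₈ * (c₇ / 2) ^ 4 / 16, K, by positivity, hK,
    fun f₁ f₂ hf₁ hf₂ η L L₁ L₂ ξ hη hη1 hL hL₁ hL₂ hKL hξ hξc hS₁ hS₂ => ?_⟩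
  by_contra! hcon
  have hL0 : 0 < L := by linarith
  have hη6 : 0 < η ^ 6 := by positivity
  -- each Halász point gives a lower bound for `‖F(s)‖ / ζ(σ)`
  have key : ∀ f : ℕ →*₀ ℂ, (∀ n, ‖f n‖ ≤ 1) → ∀ M, L ≤ M → η * Real.exp M ≤ ‖partialSum f (Real.exp M)‖ →
      ∃ t r : ℝ, 1 ≤ r ∧ |t| ≤ r ∧ (c₇ / 2) ^ 2 * η ^ 3 * r ^ 2 ≤
        (‖LSeries f (((1 + 1 / M : ℝ) : ℂ) + t * I)‖ / zetaSum (1 + 1 / M)) ^ 2 := by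
    intro f hf M hM hS
    have hM0 : 0 < M := by linarith
    obtain ⟨t, ht⟩ := H₇ f hf η M hη hη1 (hL.trans hM) (hKL.trans (by gcongr)) hS
    set s : ℂ := ((1 + 1 / M : ℝ) : ℂ) + t * I with hs
    have hMi : 0 < 1 / M := by positivity
    have hz := zetaSum_bounds (σ := 1 + 1 / M) (by linarith)
    have hz1 : (1 + 1 / M) / (1 + 1 / M - 1) = M + 1 := by field_simp; ring
    have hz2 : 1 / (1 + 1 / M - 1) = M := by field_simp; ring
    rw [hz1, hz2] at hz
    have hz0 : 0 < zetaSum (1 + 1 / M) := by linarith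
    have hre : s.re = 1 + 1 / M := by simp [hs]
    have him : s.im = t := by simp [hs]
    refine ⟨t, ‖s‖, ?_, ?_, ?_⟩
    · have := (le_abs_self _).trans (abs_re_le_norm s)
      rw [hre] at this; linarith
    · have := abs_im_le_norm s
      rwa [him] at this
    · have h1 : c₇ / 2 * (η * √η) * ‖s‖ ≤ ‖LSeries f s‖ / zetaSum (1 + 1 / M) := by
        rw [le_div_iff₀ hz0]
        calc c₇ / 2 * (η * √η) * ‖s‖ * zetaSum (1 + 1 / M)
            ≤ c₇ / 2 * (η * √η) * ‖s‖ * (2 * M) := by gcongr; linarith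
          _ = c₇ * (η * √η) * M * ‖s‖ := by ring
          _ ≤ _ := ht
      calc (c₇ / 2) ^ 2 * η ^ 3 * ‖s‖ ^ 2 = (c₇ / 2 * (η * √η) * ‖s‖) ^ 2 := by
            rw [mul_pow, mul_pow, mul_pow, Real.sq_sqrt hη.le]; ring
        _ ≤ _ := by gcongr
  obtain ⟨t₁, r₁, hr₁, htr₁, h₁⟩ := key f₁ hf₁ L₁ hL₁ hS₁
  obtain ⟨t₂, r₂, hr₂, htr₂, h₂⟩ := key f₂ hf₂ L₂ hL₂ hS₂
  have hLi : 0 < 1 / L := by positivity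
  have hL1i : 1 / L ≤ 1 := by rw [div_le_one hL0]; exact hL
  have hσ : ∀ M, L ≤ M → 1 < 1 + 1 / M ∧ 1 + 1 / M ≤ 1 + 1 / L := fun M hM => by
    have hM0 : 0 < M := by linarith
    have h1 : 0 < 1 / M := by positivity
    have h2 : 1 / M ≤ 1 / L := one_div_le_one_div_of_le hL0 hM
    exact ⟨by linarith, by linarith⟩
  have h8 := H₈ f₁ f₂ hf₁ hf₂ (1 + 1 / L) (1 + 1 / L₁) (1 + 1 / L₂) t₁ t₂ (hσ L₁ hL₁).1 (hσ L₂ hL₂).1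
    (hσ L₁ hL₁).2 (hσ L₂ hL₂).2
  have hup := norm_LSeries_le_of_norm_partialSum_le (f := fun n => f₁ n * f₂ n)
    (fun n => by rw [norm_mul]; exact mul_le_one₀ (hf₁ n) (norm_nonneg _) (hf₂ n)) hL0 hξ
    (fun u hu => (hcon u hu).le) (t₁ + t₂)
  have hz := (zetaSum_bounds (σ := 1 + 1 / L) (by linarith)).1
  have hz2 : 1 / (1 + 1 / L - 1) = L := by field_simp; ring
  rw [hz2] at hz
  have hz0 : 0 ≤ zetaSum (1 + 1 / L) := hL0.le.trans hz
  have hlow : c₈ * L * ((c₇ / 2) ^ 2 * η ^ 3 * r₁ ^ 2) * ((c₇ / 2) ^ 2 * η ^ 3 * r₂ ^ 2) ≤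
      2 * ξ * L * ‖((1 + 1 / L : ℝ) : ℂ) + ((t₁ + t₂ : ℝ) : ℂ) * I‖ := by
    refine le_trans ?_ (h8.trans hup)
    gcongr
  -- the gain `|s₁| ^ 2 * |s₂| ^ 2` in the lower bound absorbs the factor `|s|` of the upper bound
  have hn : ‖((1 + 1 / L : ℝ) : ℂ) + ((t₁ + t₂ : ℝ) : ℂ) * I‖ ≤ 4 * (r₁ ^ 2 * r₂ ^ 2) := by
    have e1 : ‖((1 + 1 / L : ℝ) : ℂ)‖ ≤ 2 := by
      rw [Complex.norm_real, Real.norm_of_nonneg (by linarith)]; linarith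
    have e2 : ‖((t₁ + t₂ : ℝ) : ℂ) * I‖ ≤ r₁ + r₂ := by
      rw [norm_mul, norm_I, mul_one, Complex.norm_real, Real.norm_eq_abs]
      exact (abs_add_le _ _).trans (add_le_add htr₁ htr₂)
    have e3 := norm_add_le ((1 + 1 / L : ℝ) : ℂ) (((t₁ + t₂ : ℝ) : ℂ) * I)
    have e4 : r₁ ≤ r₁ ^ 2 * r₂ ^ 2 := by
      calc r₁ = r₁ * 1 * 1 := by ring
        _ ≤ r₁ * r₁ * r₂ ^ 2 := by gcongr; exact one_le_pow₀ hr₂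
        _ = _ := by ring
    have e5 : r₂ ≤ r₁ ^ 2 * r₂ ^ 2 := by
      calc r₂ = r₂ * 1 * 1 := by ring
        _ ≤ r₂ * r₂ * r₁ ^ 2 := by gcongr; exact one_le_pow₀ hr₁
        _ = _ := by ring
    linarith
  set P := r₁ ^ 2 * r₂ ^ 2 with hP
  have hP0 : 0 < P := by positivity
  have hfin : c₈ * (c₇ / 2) ^ 4 * η ^ 6 * (L * P) ≤ c₈ * (c₇ / 2) ^ 4 / 2 * η ^ 6 * (L * P) := by
    calc _ = c₈ * L * ((c₇ / 2) ^ 2 * η ^ 3 * r₁ ^ 2) * ((c₇ / 2) ^ 2 * η ^ 3 * r₂ ^ 2) := by rw [hP]; ring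
      _ ≤ _ := hlow
      _ ≤ 2 * (c₈ * (c₇ / 2) ^ 4 / 16 * η ^ 6) * L * (4 * P) := by gcongr
      _ = _ := by ring
  have : 0 < c₈ * (c₇ / 2) ^ 4 * η ^ 6 * (L * P) := by positivity
  linarith

/-- The extension by `0` at `0` of a completely multiplicative function, as a homomorphism of monoids
with zero. -/
def IsCompletelyMultiplicative.toHom {f : ℕ → ℂ} (hf : IsCompletelyMultiplicative f) : ℕ →*₀ ℂ where
  toFun n := if n = 0 then 0 else f n
  map_zero' := if_pos rfl
  map_one' := by simpa using hf.map_one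
  map_mul' m n := by
    rcases Nat.eq_zero_or_pos m with rfl | hm
    · simp
    rcases Nat.eq_zero_or_pos n with rfl | hn
    · simp
    simp [hm.ne', hn.ne', hf.map_mul m n hm hn]

theorem IsCompletelyMultiplicative.toHom_of_pos {f : ℕ → ℂ} (hf : IsCompletelyMultiplicative f) {n : ℕ}
    (hn : 1 ≤ n) : hf.toHom n = f n := if_neg (by omega)

theorem IsCompletelyMultiplicative.norm_toHom_le {f : ℕ → ℂ} (hf : IsCompletelyMultiplicative f)
    (h : ∀ n : ℕ, 1 ≤ n → ‖f n‖ ≤ 1) (n : ℕ) : ‖hf.toHom n‖ ≤ 1 := by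
  rcases Nat.eq_zero_or_pos n with rfl | hn
  · simp
  · rw [hf.toHom_of_pos hn]; exact h n hn

theorem partialSum_congr {f g : ℕ → ℂ} (h : ∀ n : ℕ, 1 ≤ n → f n = g n) (x : ℝ) :
    partialSum f x = partialSum g x :=
  Finset.sum_congr rfl fun n hn => h n (Finset.mem_Icc.mp hn).1

theorem partialSum_of_lt_one (f : ℕ → ℂ) {x : ℝ} (hx : x < 1) : partialSum f x = 0 := by
  rw [partialSum, Nat.floor_eq_zero.mpr hx]; simp

theorem partialSum_of_lt_two (f : ℕ → ℂ) {x : ℝ} (hx : 1 ≤ x) (hx2 : x < 2) : partialSum f x = f 1 := by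
  have : ⌊x⌋₊ = 1 := (Nat.floor_eq_iff (by linarith)).mpr ⟨by simpa using hx, by norm_num; linarith⟩
  rw [partialSum, this]; simp

/-- A bounded sequence can have a partial sum of size `η * x` only if `1 ≤ x` and `η ≤ 1`. -/
theorem one_le_of_le_norm_partialSum {f : ℕ → ℂ} (hf : ∀ n, ‖f n‖ ≤ 1) {η x : ℝ} (hη : 0 < η) (hx : 0 < x)
    (h : η * x ≤ ‖partialSum f x‖) : 1 ≤ x ∧ η ≤ 1 := by
  constructor
  · by_contra! hx1
    rw [partialSum_of_lt_one f hx1, norm_zero] at h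
    have : 0 < η * x := by positivity
    linarith
  · have := h.trans (norm_partialSum_le hf hx.le)
    exact le_of_mul_le_mul_right (by linarith) hx

theorem exists_large_partialSum_mul_of_isCompletelyMultiplicative :
    ∃ c : ℝ, 0 < c ∧ ∀ f₁ f₂ : ℕ → ℂ,
      IsCompletelyMultiplicative f₁ → IsCompletelyMultiplicative f₂ →
      (∀ n : ℕ, 1 ≤ n → ‖f₁ n‖ ≤ 1) → (∀ n : ℕ, 1 ≤ n → ‖f₂ n‖ ≤ 1) →
      ∀ η x₁ x₂ : ℝ, 0 < η → 0 < x₁ → 0 < x₂ →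
        η * x₁ ≤ ‖partialSum f₁ x₁‖ → η * x₂ ≤ ‖partialSum f₂ x₂‖ →
        ∃ x : ℝ, (min x₁ x₂) ^ (c * η ^ 6) ≤ x ∧
          (c * η ^ 6) * x ≤ ‖partialSum (fun n => f₁ n * f₂ n) x‖ := by
  obtain ⟨c₀, K, hc₀, hK, H⟩ := exists_large_norm_partialSum_mul
  have hlog2 : 0 < Real.log 2 := Real.log_pos (by norm_num)
  set c := min c₀ (min (1 / 2) (min (Real.log 2) (Real.log 2 / K))) with hc
  have hc0 : 0 < c := by positivity
  have hcc : c ≤ c₀ := min_le_left _ _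
  have hc2 : c ≤ 1 / 2 := (min_le_right _ _).trans (min_le_left _ _)
  have hcl : c ≤ Real.log 2 :=
    (min_le_right _ _).trans ((min_le_right _ _).trans (min_le_left _ _))
  have hcK : c ≤ Real.log 2 / K :=
    (min_le_right _ _).trans ((min_le_right _ _).trans (min_le_right _ _))
  refine ⟨c, hc0, fun f₁ f₂ hf₁ hf₂ hb₁ hb₂ η x₁ x₂ hη hx₁ hx₂ hS₁ hS₂ => ?_⟩
  have hn₁ := hf₁.norm_toHom_le hb₁
  have hn₂ := hf₂.norm_toHom_le hb₂
  rw [← partialSum_congr (fun n hn => hf₁.toHom_of_pos hn)] at hS₁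
  rw [← partialSum_congr (fun n hn => hf₂.toHom_of_pos hn)] at hS₂
  obtain ⟨hx₁1, hη1⟩ := one_le_of_le_norm_partialSum hn₁ hη hx₁ hS₁
  obtain ⟨hx₂1, -⟩ := one_le_of_le_norm_partialSum hn₂ hη hx₂ hS₂
  set X := min x₁ x₂ with hX
  have hX1 : 1 ≤ X := le_min hx₁1 hx₂1
  have hX0 : 0 < X := by linarith
  set ξ := c * η ^ 6 with hξ
  have hη6 : η ^ 6 ≤ 1 := pow_le_one₀ hη.le hη1
  have hη60 : 0 < η ^ 6 := by positivity
  have hξ0 : 0 < ξ := by positivity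
  have hξ2 : ξ ≤ 1 / 2 := by
    calc ξ ≤ 1 / 2 * 1 := mul_le_mul hc2 hη6 hη60.le (by norm_num)
      _ = 1 / 2 := mul_one _
  have hXξ : X ^ ξ = Real.exp (ξ * Real.log X) := by rw [Real.rpow_def_of_pos hX0, mul_comm]
  -- below `2` the partial sums of `f₁ * f₂` equal `1`
  by_cases hsmall : X ^ ξ < 2
  · refine ⟨X ^ ξ, le_rfl, ?_⟩
    rw [partialSum_of_lt_two _ (Real.one_le_rpow hX1 hξ0.le) hsmall, hf₁.map_one, hf₂.map_one, mul_one,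
      norm_one]
    calc ξ * X ^ ξ ≤ 1 / 2 * 2 := by gcongr
      _ = 1 := by norm_num
  · have hlarge : Real.log 2 ≤ ξ * Real.log X := by
      rw [not_lt, hXξ, ← Real.log_le_iff_le_exp (by norm_num)] at hsmall
      exact hsmall
    have hη6L : Real.log 2 / c ≤ η ^ 6 * Real.log X := by
      rw [div_le_iff₀ hc0]
      calc _ ≤ _ := hlarge
        _ = _ := by rw [hξ]; ring
    have h1 : 1 ≤ Real.log 2 / c := (one_le_div hc0).mpr hcl
    have h2 : K ≤ Real.log 2 / c := by
      rw [le_div_iff₀ hK] at hcK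
      rw [le_div_iff₀ hc0]; linarith
    have h3 : η ^ 6 * Real.log X ≤ 1 * Real.log X := by
      gcongr
      exact Real.log_nonneg hX1
    obtain ⟨u, hu, hSu⟩ := H hf₁.toHom hf₂.toHom hn₁ hn₂ η (Real.log X) (Real.log x₁) (Real.log x₂) ξ hη hη1
      (by linarith) (Real.log_le_log hX0 (min_le_left _ _)) (Real.log_le_log hX0 (min_le_right _ _))
      (by linarith) hξ0 (by rw [hξ]; gcongr) (by rwa [Real.exp_log hx₁]) (by rwa [Real.exp_log hx₂])
    refine ⟨u, by rwa [hXξ], ?_⟩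
    rwa [partialSum_congr (g := fun n => f₁ n * f₂ n)
      (fun n hn => by rw [hf₁.toHom_of_pos hn, hf₂.toHom_of_pos hn])] at hSu

theorem DirichletCharacter.isCompletelyMultiplicative {q : ℕ} (χ : DirichletCharacter ℂ q) :
    IsCompletelyMultiplicative fun n => χ (n : ZMod q) where
  map_one := by simp
  map_mul m n _ _ := by simp

theorem theorem6p2 :
    ∃ c : ℝ, 0 < c ∧
      (∀ f₁ f₂ : ℕ → ℂ,
        IsCompletelyMultiplicative f₁ → IsCompletelyMultiplicative f₂ →
        (∀ n : ℕ, 1 ≤ n → ‖f₁ n‖ ≤ 1) → (∀ n : ℕ, 1 ≤ n → ‖f₂ n‖ ≤ 1) →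
        ∀ η x₁ x₂ : ℝ, 0 < η → 0 < x₁ → 0 < x₂ →
          η * x₁ ≤ ‖partialSum f₁ x₁‖ → η * x₂ ≤ ‖partialSum f₂ x₂‖ →
          ∃ x : ℝ, (min x₁ x₂) ^ (c * η ^ 6) ≤ x ∧
            (c * η ^ 6) * x ≤ ‖partialSum (fun n => f₁ n * f₂ n) x‖) ∧
      (∀ (q : ℕ) [NeZero q] (χ₁ χ₂ : DirichletCharacter ℂ q),
        ∀ η x₁ x₂ : ℝ, 0 < η → 0 < x₁ → 0 < x₂ →
          η * x₁ ≤ ‖partialSum (fun n => χ₁ (n : ZMod q)) x₁‖ →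
          η * x₂ ≤ ‖partialSum (fun n => χ₂ (n : ZMod q)) x₂‖ →
          ∃ x : ℝ, (min x₁ x₂) ^ (c * η ^ 6) ≤ x ∧
            (c * η ^ 6) * x ≤ ‖partialSum (fun n => (χ₁ * χ₂) (n : ZMod q)) x‖) := by
  obtain ⟨c, hc, H⟩ := exists_large_partialSum_mul_of_isCompletelyMultiplicative
  refine ⟨c, hc, H, fun q _ χ₁ χ₂ η x₁ x₂ hη hx₁ hx₂ hS₁ hS₂ => ?_⟩
  simp only [MulChar.mul_apply]
  exact H _ _ χ₁.isCompletelyMultiplicative χ₂.isCompletelyMultiplicative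
    (fun n _ => χ₁.norm_le_one _) (fun n _ => χ₂.norm_le_one _) η x₁ x₂ hη hx₁ hx₂ hS₁ hS₂
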